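/- Let $k_\sigma\in(0,1]$ and $\sigma_0,\nu>0$ be fixed, and let $p_n\ge 1$ be integers with $p_n^5/n\to 0$. \textbf{Data.} For each $n$ let $Y_1,\dots,Y_n$ be i.i.d. in $\mathbb R^{p_n}$ with mean zero and covariance matrix $\Sigma_{0n}$, all of whose eigenvalues lie in $[k_\sigma,1/k_\sigma]$, and suppose $\|\Sigma_{0n}^{-1/2}Y_1\|_{\psi_2}\le\sigma_0$. Here $\|X\|_{\psi_2}=\sup_{\|u\|=1}\sup_{q\ge1}q^{-1/2}(E|u^TX|^q)^{1/q}$. Let $\mathbb P_{0n}$ be the joint law of the data and $S=\frac1n\sum_{i=1}^nY_iY_i^T$. All convergences in probability are under $\mathbb P_{0n}$ as $n\to\infty$, and $\|\cdot\|$ is the spectral norm on matrices. \textbf{Prior and posterior.} Let $\Psi_{2n}$ be any positive definite $p_n\times p_n$ matrices and let $\nu^*_n>0$ satisfy $\nu^*_n=O(p_n)$. The covariance matrix $\Sigma$ of the working model $N_{p_n}(0,\Sigma)$ is given the matrix-$F$ prior, with density on the cone of positive definite matrices (with respect to Lebesgue measure on symmetric matrices) $$\pi_n(\Sigma)\propto\det(\Sigma)^{-(\nu+2p_n)/2}\det(\Sigma^{-1}+\Psi_{2n}^{-1})^{-(\nu^*_n+\nu+p_n-1)/2}.$$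 The posterior $\Pi_n(\cdot\mid Y_1,\dots,Y_n)$ has density proportional to $\det(\Sigma)^{-n/2}e^{-\frac n2\operatorname{tr}(\Sigma^{-1}S)}\pi_n(\Sigma)$. (If $\nu_n^*\le p_n-1$ the prior is improper; only its density up to a constant factor is used.) \textbf{Conclusion.} \begin{enumerate} \item With $\mathbb P_{0n}$-probability tending to one, $S$ is positive definite and the posterior is a well-defined probability distribution. \item (Flatness around $S$.) For every constant $M>0$, with $\epsilon_n=M\sqrt{p_n/n}$, $$\sup\left\{\left|\frac{\pi_n(S+T/\sqrt n)}{\pi_n(S)}-1\right| : S+\tfrac{T}{\sqrt n}\text{ positive definite},\ \|T\|\le\sqrt n\,\epsilon_n\right\}\to 0\quad\text{in probability.}$$ \item (Posterior contraction rate $\sqrt{p_n/n}$.) For every sequence $M_n\to\infty$, $$\Pi_n\left(\|\Sigma-\Sigma_{0n}\|>M_n\sqrt{p_n/n}\mid Y_1,\dots,Y_n\right)\to0\quad\text{in probability.}$$ If moreover $p_n\to\infty$, then there is a constant $M_0>0$ such that, for every constant $M\ge M_0$, $$\Pi_n\left(\|\Sigma-\Sigma_{0n}\|>M\sqrt{p_n/n}\mid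 Y_1,\dots,Y_n\right)\to0\quad\text{in probability.}$$ \end{enumerate} -/

import Mathlib

open MeasureTheory ProbabilityTheory Filter Topology Asymptotics
open scoped ENNReal

noncomputable section

namespace HighDimCov

/-- Real `p × p` matrices. -/
abbrev Mat (p : ℕ) : Type := Matrix (Fin p) (Fin p) ℝ

/-- Coordinates of a symmetric `p × p` matrix: one real number for each unordered pair of indices,
that is, the half-vectorisation of the matrix. The measure `volume` on this space is Lebesgue
measure on `ℝ^(p(p+1)/2)`. -/
abbrev SymCoord (p : ℕ) : Type := Sym2 (Fin p) → ℝ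

/-- The symmetric matrix with the given coordinates. -/
def symMat {p : ℕ} (x : SymCoord p) : Mat p := Matrix.of fun i j => x s(i, j)

/-- The spectral norm of a matrix. -/
def specNorm {p : ℕ} (A : Mat p) : ℝ := ‖Matrix.toEuclideanCLM (n := Fin p) (𝕜 := ℝ) A‖

/-! ### Convergence in probability -/

/-- Nonnegative extended-real quantities `f n`, defined on probability spaces that may change
with `n`, tend to `0` in probability. -/
def TendstoZeroInProb {Ω : ℕ → Type*} [∀ n, MeasurableSpace (Ω n)] (P : ∀ n, Measure (Ω n))
    (f : ∀ n, Ω n → ℝ≥0∞) : Prop :=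
  ∀ δ : ℝ≥0∞, 0 < δ → Tendsto (fun n => P n {ω | δ ≤ f n ω}) atTop (𝓝 0)

/-- The event `A n` has probability tending to one. -/
def WithProbTendingToOne {Ω : ℕ → Type*} [∀ n, MeasurableSpace (Ω n)] (P : ∀ n, Measure (Ω n))
    (A : ∀ n, Set (Ω n)) : Prop :=
  Tendsto (fun n => P n (A n)ᶜ) atTop (𝓝 0)

/-! ### The true data-generating mechanism -/

/-- The sub-Gaussian norm `sup_{q ≥ 1} q^(-1/2) (E |X|^q)^(1/q)` of a real random variable. -/
def subGaussianNorm {Ω : Type*} [MeasurableSpace Ω] (μ : Measure Ω) (X : Ω → ℝ) : ℝ≥0∞ :=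
  ⨆ (q : ℝ) (_ : 1 ≤ q),
    ENNReal.ofReal (q ^ (-(1 / 2) : ℝ)) * eLpNorm X (ENNReal.ofReal q) μ

/-- The sub-Gaussian norm `sup_{‖u‖ = 1} ‖uᵀ X‖` of a random vector. -/
def vecSubGaussianNorm {Ω : Type*} [MeasurableSpace Ω] {p : ℕ} (μ : Measure Ω)
    (X : Ω → Fin p → ℝ) : ℝ≥0∞ :=
  ⨆ (u : EuclideanSpace ℝ (Fin p)) (_ : ‖u‖ = 1),
    subGaussianNorm μ (fun ω => ∑ i, u i * X ω i)

/-- The covariance matrix of a law on `ℝ^p`. -/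
def covMatrix {p : ℕ} (μ : Measure (EuclideanSpace ℝ (Fin p))) : Mat p :=
  Matrix.of fun i j => covariance (fun y => y i) (fun y => y j) μ

open scoped MatrixOrder in
/-- The inverse square root `A^(-1/2)` of a positive definite matrix. -/
def invSqrt {p : ℕ} (A : Mat p) : Mat p := (CFC.sqrt A)⁻¹

/-- All eigenvalues of the symmetric matrix `A` lie in `[k, 1/k]`. -/
def EigenvaluesBounded {p : ℕ} (k : ℝ) (A : Mat p) : Prop :=
  ∃ hA : A.IsHermitian, ∀ i, k ≤ hA.eigenvalues i ∧ hA.eigenvalues i ≤ 1 / k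

/-- A probability law on `ℝ^p` with mean zero whose covariance matrix `Σ₀` has all eigenvalues in
`[k, 1/k]`, and for which `Σ₀^(-1/2) Y`, with `Y` of this law, has sub-Gaussian norm at
most `σ₀`. -/
structure IsAdmissibleLaw {p : ℕ} (k σ₀ : ℝ) (μ : Measure (EuclideanSpace ℝ (Fin p))) :
    Prop where
  prob : IsProbabilityMeasure μ
  mean_zero : ∀ i, ∫ y, y i ∂μ = 0
  eigenvalues : EigenvaluesBounded k (covMatrix μ)
  subGaussian :
    vecSubGaussianNorm μ (fun y => Matrix.mulVec (invSqrt (covMatrix μ)) (fun i => y i))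
      ≤ ENNReal.ofReal σ₀

/-- A data set of `n` observations in `ℝ^p`. -/
abbrev Data (n p : ℕ) : Type := Fin n → EuclideanSpace ℝ (Fin p)

/-- The joint law of `n` independent observations with law `μ`. -/
def dataLaw {p : ℕ} (n : ℕ) (μ : Measure (EuclideanSpace ℝ (Fin p))) : Measure (Data n p) :=
  Measure.pi fun _ => μ

/-- The sample covariance matrix `S = (1/n) ∑ Y_i Y_iᵀ`. -/
def sampleCov {n p : ℕ} (Y : Data n p) : Mat p :=
  Matrix.of fun a b => (1 / (n : ℝ)) * ∑ i, Y i a * Y i b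

/-! ### The working Gaussian model and the posterior -/

/-- The Gaussian `N_p(0, A)` log-likelihood of the data, as a function of the covariance
matrix `A`. -/
def logLik {n p : ℕ} (Y : Data n p) (A : Mat p) : ℝ :=
  -((n : ℝ) * p / 2) * Real.log (2 * Real.pi) - (n : ℝ) / 2 * Real.log A.det
    - (n : ℝ) / 2 * (A⁻¹ * sampleCov Y).trace

/-- Likelihood times prior density, as a measure on the positive definite cone. -/
def unnormalizedPosterior {n p : ℕ} (π : Mat p → ℝ) (Y : Data n p) : Measure (SymCoord p) :=
  (volume : Measure (SymCoord p)).withDensity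
    ({x | (symMat x).PosDef}.indicator fun x =>
      ENNReal.ofReal (Real.exp (logLik Y (symMat x)) * π (symMat x)))

/-- The posterior distribution of the covariance matrix for the prior density `π` on the positive
definite cone; `π` needs to be known only up to a positive factor. -/
def posterior {n p : ℕ} (π : Mat p → ℝ) (Y : Data n p) : Measure (SymCoord p) :=
  (unnormalizedPosterior π Y Set.univ)⁻¹ • unnormalizedPosterior π Y

/-- The posterior probability that the covariance matrix is at spectral distance more than `ε`
from `A₀`. -/
def posteriorTail {n p : ℕ} (π : Mat p → ℝ) (Y : Data n p) (A₀ : Mat p) (ε : ℝ) : ℝ≥0∞ :=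
  posterior π Y {x | ε < specNorm (symMat x - A₀)}

/-- The oscillation `ρ^π(ε) = sup |π(S + T/√n) / π(S) - 1|` of the prior density around the
sample covariance matrix, over all `T` with `S + T/√n` positive definite and `‖T‖ ≤ √n ε`. -/
def oscillation {n p : ℕ} (π : Mat p → ℝ) (Y : Data n p) (ε : ℝ) : ℝ≥0∞ :=
  ⨆ (T : Mat p) (_ : (sampleCov Y + (1 / √(n : ℝ)) • T).PosDef ∧ specNorm T ≤ √(n : ℝ) * ε),
    ENNReal.ofReal |π (sampleCov Y + (1 / √(n : ℝ)) • T) / π (sampleCov Y) - 1|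

/-- The sequence of priors with densities `π n` is flat around the sample covariance matrix, at
radius `ε n`. -/
def IsFlat {p : ℕ → ℕ} (μ : ∀ n, Measure (EuclideanSpace ℝ (Fin (p n))))
    (π : ∀ n, Mat (p n) → ℝ) (ε : ℕ → ℝ) : Prop :=
  TendstoZeroInProb (fun n => dataLaw n (μ n)) (fun n Y => oscillation (π n) Y (ε n))

/-- The posterior probability of the complement of the `ε n`-ball around the true covariance
matrix tends to zero in probability. -/
def PosteriorContracts {p : ℕ → ℕ} (μ : ∀ n, Measure (EuclideanSpace ℝ (Fin (p n))))
    (π : ∀ n, Mat (p n) → ℝ) (ε : ℕ → ℝ) : Prop :=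
  TendstoZeroInProb (fun n => dataLaw n (μ n))
    (fun n Y => posteriorTail (π n) Y (covMatrix (μ n)) (ε n))

/-! ### The matrix-`F` prior -/

/-- The unnormalised density
`det(A)^(-(ν + 2p)/2) det(A⁻¹ + Ψ⁻¹)^(-(ν* + ν + p - 1)/2)` of the matrix-`F` prior. -/
def matrixFKernel {p : ℕ} (ν νs : ℝ) (Ψ A : Mat p) : ℝ :=
  A.det ^ (-(ν + 2 * p) / 2) * (A⁻¹ + Ψ⁻¹).det ^ (-(νs + ν + p - 1) / 2)

/-- `π` is a matrix-`F` density on the positive definite cone, up to a positive factor. -/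
def IsMatrixFDensity {p : ℕ} (ν νs : ℝ) (Ψ : Mat p) (π : Mat p → ℝ) : Prop :=
  ∃ c : ℝ, 0 < c ∧ ∀ A : Mat p, A.PosDef → π A = c * matrixFKernel ν νs Ψ A

end HighDimCov

end

namespace HighDimCov

open Matrix

/-! ### Linear algebra of positive definite matrices -/

/-! Write `S = G * G` with `G` positive definite and substitute `Σ = G * A * G`. The likelihood
becomes a constant times `exp (-(n / 2) * steinLoss A)` (`logLik_conj`), where `steinLoss A` sums
`d⁻¹ - 1 + log d` over the eigenvalues `d` of `A`. Each term is nonnegative and quadratic near `d =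
1`.

The prior enters through one inequality. Passing from `G * G` to `G * A * G` changes its logarithm
by at most `b / 2 * ∑ |log d|`, where `b = (ν + 2p) + (ν* + ν + p - 1) = O(p)`, whatever `Ψ` is
(`abs_log_matrixFKernel_sub_le`). For `Σ` within `M √(p/n)` of `S` every `|log d|` is `O(√(p/n))`,
so the log-ratio is `O(p · p · √(p/n)) = O(√(p⁵/n))`. This is flatness.

For contraction a global bound is needed, and `|log d| ≤ (d⁻¹ - 1 + log d) / τ + τ` gives it. The
prior then merely shifts the degrees of freedom `n` by `± b/τ` and costs a factor `exp (bpτ/2)`.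
With `τ = 1 / (3p²)` that factor is bounded and `b/τ = O(p³) = o(n)`. The numerator is bounded above
with `n - b/τ` degrees of freedom. The normalising constant is bounded below on `‖A⁻¹ - 1‖ ≲
√(p/n)`, where the loss is `O(p²/n)`, so that the same `n - b/τ` can be restored at the cost `exp
(O(p³ · p²/n))`. Hence posterior probabilities are at most a constant times those of a single
inverse Wishart law (`posterior_comparison`), and no normalising constant has to be evaluated.

That law concentrates at the identity: its moment generating function along a direction is found
exactly by a rank-one change of variables, and a net of at most `5 ^ p` directions turns this into a
spectral norm bound (`steinMeasure_tail`). The same net and sub-Gaussian moments bring `S` within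
`O(√(p/n))` of the truth (`dataLaw_specNorm_tail`). Both error probabilities are of the form `exp
(-c M² p)`, which vanishes when `M → ∞`, or for fixed large `M` when `p → ∞`. -/

theorem _root_.Matrix.IsHermitian.exists_orthogonal_conj {p : ℕ} {A : Mat p} (hA : A.IsHermitian) :
    ∃ U : Mat p, Uᵀ * U = 1 ∧ U * Uᵀ = 1 ∧ A = U * diagonal hA.eigenvalues * Uᵀ := by
  refine ⟨hA.eigenvectorUnitary, ?_, ?_, ?_⟩
  · have := Unitary.coe_star_mul_self hA.eigenvectorUnitary
    rwa [star_eq_conjTranspose, conjTranspose_eq_transpose_of_trivial] at this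
  · have := Unitary.coe_mul_star_self hA.eigenvectorUnitary
    rwa [Unitary.coe_star, star_eq_conjTranspose, conjTranspose_eq_transpose_of_trivial] at this
  · have := hA.spectral_theorem
    rw [Unitary.conjStarAlgAut_apply] at this
    conv_lhs => rw [this]
    rw [star_eq_conjTranspose, conjTranspose_eq_transpose_of_trivial]
    rfl

open scoped MatrixOrder in
theorem exists_posDef_sqrt_inv_eq {p : ℕ} {S : Mat p} (hS : S.PosDef) :
    ∃ G : Mat p, G.PosDef ∧ G * G = S ∧ invSqrt S = G⁻¹ := by
  refine ⟨CFC.sqrt S, ?_, CFC.sqrt_mul_sqrt_self S hS.posSemidef.nonneg, rfl⟩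
  have h : (CFC.sqrt S).PosSemidef := nonneg_iff_posSemidef.1 (CFC.sqrt_nonneg S)
  rw [h.posDef_iff_det_ne_zero]
  intro h0
  have := congrArg det (CFC.sqrt_mul_sqrt_self S hS.posSemidef.nonneg)
  rw [det_mul, h0] at this
  exact hS.det_pos.ne' (by simpa using this.symm)

theorem exists_posDef_sqrt {p : ℕ} {S : Mat p} (hS : S.PosDef) :
    ∃ G : Mat p, G.PosDef ∧ G * G = S :=
  (exists_posDef_sqrt_inv_eq hS).imp fun _ h => ⟨h.1, h.2.1⟩

theorem PosDef.transpose_eq {p : ℕ} {A : Mat p} (hA : A.PosDef) : Aᵀ = A := by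
  have := hA.isHermitian
  rwa [IsHermitian, conjTranspose_eq_transpose_of_trivial] at this

theorem PosSemidef.one_le_det_one_add {p : ℕ} {C : Mat p} (hC : C.PosSemidef) :
    1 ≤ (1 + C).det := by
  obtain ⟨U, h1, h2, h3⟩ := hC.isHermitian.exists_orthogonal_conj
  have h4 : 1 + C = U * diagonal (fun i => 1 + hC.isHermitian.eigenvalues i) * Uᵀ := by
    have : (diagonal (fun i => 1 + hC.isHermitian.eigenvalues i) : Mat p)
        = 1 + diagonal hC.isHermitian.eigenvalues := by
      rw [← diagonal_one, diagonal_add]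
    rw [this, mul_add, add_mul, ← h3, mul_one, h2]
  rw [h4, det_mul_right_comm, h2, one_mul, det_diagonal]
  exact Finset.one_le_prod fun i _ => by
    have := hC.eigenvalues_nonneg i
    linarith

theorem PosDef.isUnit_det {p : ℕ} {A : Mat p} (hA : A.PosDef) : IsUnit A.det :=
  isUnit_iff_ne_zero.2 hA.det_pos.ne'

theorem PosSemidef.conj {p : ℕ} {A : Mat p} (hA : A.PosSemidef) (R : Mat p) :
    (R * A * Rᵀ).PosSemidef := by
  simpa using hA.mul_mul_conjTranspose_same R

theorem PosDef.conj {p : ℕ} {A : Mat p} (hA : A.PosDef) {R : Mat p} (hR : IsUnit R.det) :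
    (R * A * Rᵀ).PosDef := by
  have : R.vecMul.Injective := vecMul_injective_iff_isUnit.2 ((isUnit_iff_isUnit_det R).2 hR)
  simpa using hA.mul_mul_conjTranspose_same this

/-- With `A = G * G`, the larger matrix is `G * (1 + C) * G` where `C = G⁻¹ * (B - A) * G⁻¹` is
positive semidefinite. -/
theorem det_le_det_of_posSemidef_sub {p : ℕ} {A B : Mat p} (hA : A.PosDef)
    (hB : (B - A).PosSemidef) : A.det ≤ B.det := by
  obtain ⟨G, hG, rfl⟩ := exists_posDef_sqrt hA
  have hu := PosDef.isUnit_det hG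
  have hC := PosSemidef.conj hB G⁻¹
  have hGt : (G⁻¹)ᵀ = G⁻¹ := by rw [transpose_nonsing_inv, PosDef.transpose_eq hG]
  rw [hGt] at hC
  have : B = G * (1 + G⁻¹ * (B - G * G) * G⁻¹) * G := by
    rw [mul_add, add_mul, mul_one]
    simp only [mul_assoc, nonsing_inv_mul _ hu, mul_one]
    rw [← mul_assoc G, mul_nonsing_inv _ hu, one_mul]
    abel
  rw [this, det_mul, det_mul, det_mul]
  have h1 := PosSemidef.one_le_det_one_add hC
  have h2 := hG.det_pos
  nlinarith [mul_pos h2 h2]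

open scoped MatrixOrder in
theorem PosSemidef.exists_factor {p : ℕ} {Q : Mat p} (hQ : Q.PosSemidef) :
    ∃ R : Mat p, Q = Rᵀ * R := by
  refine ⟨CFC.sqrt Q, ?_⟩
  have h : (CFC.sqrt Q).PosSemidef := nonneg_iff_posSemidef.1 (CFC.sqrt_nonneg Q)
  have h1 := h.isHermitian
  rw [IsHermitian, conjTranspose_eq_transpose_of_trivial] at h1
  rw [h1, CFC.sqrt_mul_sqrt_self Q hQ.nonneg]

theorem PosSemidef.one_add {p : ℕ} {Q : Mat p} (hQ : Q.PosSemidef) : (1 + Q).PosDef :=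
  PosDef.one.add_posSemidef hQ

theorem diagonal_inv_of_pos {p : ℕ} {e : Fin p → ℝ} (he : ∀ i, 0 < e i) :
    (diagonal e : Mat p) * diagonal (fun i => (e i)⁻¹) = 1 := by
  rw [diagonal_mul_diagonal, ← diagonal_one]
  congr 1
  funext i
  exact mul_inv_cancel₀ (he i).ne'

/-- `det (E + RᵀR) = det E * det (1 + R E⁻¹ Rᵀ)` for a positive diagonal matrix `E`. -/
theorem det_diagonal_add_gram {p : ℕ} {e : Fin p → ℝ} (he : ∀ i, 0 < e i) (R : Mat p) :
    (diagonal e + Rᵀ * R).det =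
      (∏ i, e i) * (1 + R * diagonal (fun i => (e i)⁻¹) * Rᵀ).det := by
  have : diagonal e + Rᵀ * R
      = diagonal e * (1 + (diagonal (fun i => (e i)⁻¹) * Rᵀ) * R) := by
    rw [mul_add, mul_one, ← mul_assoc, ← mul_assoc, diagonal_inv_of_pos he, one_mul]
  rw [this, det_mul, det_diagonal, det_one_add_mul_comm, mul_assoc R]

/-- Once `∏ e` is factored out, the weights left inside are `e⁻¹ ≤ 1`. Replacing them by `1`
enlarges the matrix in the Loewner order, hence its determinant. -/
theorem det_diagonal_add_le {p : ℕ} {e : Fin p → ℝ} (he : ∀ i, 1 ≤ e i) {Q : Mat p}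
    (hQ : Q.PosSemidef) : (diagonal e + Q).det ≤ (∏ i, e i) * (1 + Q).det := by
  have he0 : ∀ i, 0 < e i := fun i => one_pos.trans_le (he i)
  obtain ⟨R, rfl⟩ := PosSemidef.exists_factor hQ
  rw [det_diagonal_add_gram he0, det_one_add_mul_comm Rᵀ R]
  refine mul_le_mul_of_nonneg_left ?_ (Finset.prod_nonneg fun i _ => (he0 i).le)
  apply det_le_det_of_posSemidef_sub
  · exact PosSemidef.one_add (PosSemidef.conj (PosSemidef.diagonal fun i => (inv_pos.2 (he0 i)).le) R)
  · have : 1 + R * Rᵀ - (1 + R * diagonal (fun i => (e i)⁻¹) * Rᵀ)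
        = R * diagonal (fun i => 1 - (e i)⁻¹) * Rᵀ := by
      rw [← diagonal_sub, mul_sub, sub_mul]
      simp
    rw [this]
    exact PosSemidef.conj (PosSemidef.diagonal fun i => sub_nonneg.2 (inv_le_one_of_one_le₀ (he i))) R

theorem le_det_diagonal_add {p : ℕ} {e : Fin p → ℝ} (he0 : ∀ i, 0 < e i) (he : ∀ i, e i ≤ 1)
    {Q : Mat p} (hQ : Q.PosSemidef) : (∏ i, e i) * (1 + Q).det ≤ (diagonal e + Q).det := by
  obtain ⟨R, rfl⟩ := PosSemidef.exists_factor hQ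
  rw [det_diagonal_add_gram he0, det_one_add_mul_comm Rᵀ R]
  refine mul_le_mul_of_nonneg_left ?_ (Finset.prod_nonneg fun i _ => (he0 i).le)
  apply det_le_det_of_posSemidef_sub
  · simpa using PosSemidef.one_add (PosSemidef.conj PosSemidef.one R)
  · have : 1 + R * diagonal (fun i => (e i)⁻¹) * Rᵀ - (1 + R * Rᵀ)
        = R * diagonal (fun i => (e i)⁻¹ - 1) * Rᵀ := by
      rw [← diagonal_sub, mul_sub, sub_mul]
      simp
    rw [this]
    exact PosSemidef.conj
      (PosSemidef.diagonal fun i => sub_nonneg.2 ((one_le_inv₀ (he0 i)).2 (he i))) R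

/-- The bound does not involve `Q`, which is why the scale matrix of the prior may be arbitrary. The
upper half replaces `e` by `max 1 e` and the lower half by `min 1 e`, so that the one-sided
determinant bounds apply. -/
theorem abs_log_det_diagonal_add_sub_le {p : ℕ} {e : Fin p → ℝ} (he : ∀ i, 0 < e i) {Q : Mat p}
    (hQ : Q.PosSemidef) :
    |Real.log (diagonal e + Q).det - Real.log (1 + Q).det| ≤ ∑ i, |Real.log (e i)| := by
  have hQ1 := (PosSemidef.one_add hQ).det_pos
  have hdiff : ∀ f g : Fin p → ℝ, (∀ i, 0 < f i) → (∀ i, f i ≤ g i) →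
      0 < (diagonal f + Q).det ∧ (diagonal f + Q).det ≤ (diagonal g + Q).det := by
    intro f g hf hfg
    have hpd : (diagonal f + Q).PosDef := (PosDef.diagonal hf).add_posSemidef hQ
    refine ⟨hpd.det_pos, det_le_det_of_posSemidef_sub hpd ?_⟩
    rw [add_sub_add_right_eq_sub, diagonal_sub]
    exact PosSemidef.diagonal fun i => sub_nonneg.2 (hfg i)
  rw [abs_sub_le_iff]
  constructor
  · obtain ⟨h1, h2⟩ := hdiff e (fun i => max 1 (e i)) he (fun i => le_max_right _ _)
    have h3 := det_diagonal_add_le (e := fun i => max 1 (e i)) (fun i => le_max_left _ _) hQ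
    have h4 := Real.log_le_log h1 (h2.trans h3)
    rw [Real.log_mul (Finset.prod_pos fun i _ => by positivity).ne' hQ1.ne',
      Real.log_prod (fun i _ => by positivity)] at h4
    have h5 : ∑ i, Real.log (max 1 (e i)) ≤ ∑ i, |Real.log (e i)| := by
      refine Finset.sum_le_sum fun i _ => ?_
      rcases max_cases 1 (e i) with h | h <;> rw [h.1]
      · simp
      · exact le_abs_self _
    linarith
  · have hpos : ∀ i, 0 < min 1 (e i) := fun i => lt_min one_pos (he i)
    obtain ⟨h1, h2⟩ := hdiff (fun i => min 1 (e i)) e hpos (fun i => min_le_right _ _)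
    have h3 := le_det_diagonal_add hpos (fun i => min_le_left _ _) hQ
    have hprod : 0 < ∏ i, min 1 (e i) := Finset.prod_pos fun i _ => hpos i
    have h4 := Real.log_le_log (mul_pos hprod hQ1) (h3.trans h2)
    rw [Real.log_mul hprod.ne' hQ1.ne', Real.log_prod (fun i _ => (hpos i).ne')] at h4
    have h5 : -∑ i, Real.log (min 1 (e i)) ≤ ∑ i, |Real.log (e i)| := by
      rw [← Finset.sum_neg_distrib]
      refine Finset.sum_le_sum fun i _ => ?_
      rcases min_cases 1 (e i) with h | h <;> rw [h.1]
      · simp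
      · exact neg_le_abs _
    linarith

/-- The sum of the absolute logarithms of the eigenvalues. -/
noncomputable def logSpread {p : ℕ} {A : Mat p} (hA : A.PosDef) : ℝ :=
  ∑ i, |Real.log (hA.isHermitian.eigenvalues i)|

/-- Twice the Kullback–Leibler divergence of `N(0, 1)` from `N(0, A)`. -/
noncomputable def steinLoss {p : ℕ} (A : Mat p) : ℝ := A⁻¹.trace - p + Real.log A.det

theorem PosDef.inv_eq_conj_diagonal {p : ℕ} {A U : Mat p} {d : Fin p → ℝ} (hd : ∀ i, 0 < d i)
    (h1 : Uᵀ * U = 1) (h2 : U * Uᵀ = 1) (h3 : A = U * diagonal d * Uᵀ) :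
    A⁻¹ = U * diagonal (fun i => (d i)⁻¹) * Uᵀ := by
  apply inv_eq_right_inv
  rw [h3]
  calc U * diagonal d * Uᵀ * (U * diagonal (fun i => (d i)⁻¹) * Uᵀ)
      = U * diagonal d * (Uᵀ * U) * diagonal (fun i => (d i)⁻¹) * Uᵀ := by
        simp only [mul_assoc]
    _ = 1 := by
        rw [h1, mul_one, mul_assoc U, diagonal_inv_of_pos hd, mul_one, h2]

theorem steinLoss_eq_sum {p : ℕ} {A : Mat p} (hA : A.PosDef) :
    steinLoss A = ∑ i, ((hA.isHermitian.eigenvalues i)⁻¹ - 1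
      + Real.log (hA.isHermitian.eigenvalues i)) := by
  obtain ⟨U, h1, h2, h3⟩ := hA.isHermitian.exists_orthogonal_conj
  have hd := hA.eigenvalues_pos
  have h4 := PosDef.inv_eq_conj_diagonal hd h1 h2 h3
  have h5 : A⁻¹.trace = ∑ i, (hA.isHermitian.eigenvalues i)⁻¹ := by
    rw [h4, mul_assoc, trace_mul_comm, mul_assoc, h1, mul_one, trace_diagonal]
  have h6 : A.det = ∏ i, hA.isHermitian.eigenvalues i := by
    simpa using hA.isHermitian.det_eq_prod_eigenvalues
  rw [steinLoss, h5, h6, Real.log_prod (fun i _ => (hd i).ne'), Finset.sum_add_distrib,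
    Finset.sum_sub_distrib]
  simp

/-- Arithmetic-geometric mean inequality in `y = log d`. The function `exp (-y) - 1 + y` dominates
`y² / 2` for `y ≤ 0` and `y² / 4` on `[0, 1]`. Beyond `1` it lies above its tangent line, of slope
`1 - 1/e`, and only there is `τ ≤ 1 / 3` needed. -/
theorem abs_log_le_stein_term {τ d : ℝ} (hτ : 0 < τ) (hτ1 : τ ≤ 1 / 3) (hd : 0 < d) :
    |Real.log d| ≤ (d⁻¹ - 1 + Real.log d) / τ + τ := by
  set y := Real.log d with hy
  have hexp : d⁻¹ = Real.exp (-y) := by rw [Real.exp_neg, hy, Real.exp_log hd]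
  rw [hexp]
  have key : |y| * τ ≤ (Real.exp (-y) - 1 + y) + τ ^ 2 := by
    rcases le_total y 0 with h | h
    · have h1 := Real.quadratic_le_exp_of_nonneg (x := -y) (by linarith)
      rw [abs_of_nonpos h]
      nlinarith [sq_nonneg (y + τ)]
    · rw [abs_of_nonneg h]
      rcases le_total y 1 with h1 | h1
      · have h3 : 1 - y + y ^ 2 / 4 ≤ Real.exp (-y) := by
          have h4 := Real.exp_bound (x := -y) (n := 3) (by rw [abs_neg, abs_of_nonneg h]; exact h1)
            (by norm_num)
          rw [abs_neg, abs_of_nonneg h] at h4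
          have h5 := (abs_le.1 h4).1
          simp [Finset.sum_range_succ, Nat.factorial] at h5
          nlinarith [mul_nonneg (sq_nonneg y) (sub_nonneg.2 h1)]
        nlinarith [sq_nonneg (y - 2 * τ)]
      · have h2 : Real.exp (-1) + Real.exp (-1) * (1 - y) ≤ Real.exp (-y) := by
          have := Real.add_one_le_exp (1 - y)
          have h3 : Real.exp (-y) = Real.exp (-1) * Real.exp (1 - y) := by
            rw [← Real.exp_add]; ring_nf
          rw [h3]
          nlinarith [Real.exp_pos (-1)]
        have h4 : Real.exp (-1) < 0.3678794412 := Real.exp_neg_one_lt_d9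
        have h5 : 0.36787944116 < Real.exp (-1) := Real.exp_neg_one_gt_d9
        nlinarith
  rw [div_add' _ _ _ hτ.ne', le_div_iff₀ hτ]
  nlinarith [key]

theorem logSpread_le {p : ℕ} {A : Mat p} (hA : A.PosDef) {τ : ℝ} (hτ : 0 < τ) (hτ1 : τ ≤ 1 / 3) :
    logSpread hA ≤ steinLoss A / τ + p * τ := by
  rw [logSpread, steinLoss_eq_sum hA, Finset.sum_div]
  calc _ ≤ ∑ i, (((hA.isHermitian.eigenvalues i)⁻¹ - 1
        + Real.log (hA.isHermitian.eigenvalues i)) / τ + τ) :=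
        Finset.sum_le_sum fun i _ => abs_log_le_stein_term hτ hτ1 (hA.eigenvalues_pos i)
    _ = _ := by rw [Finset.sum_add_distrib]; simp

theorem steinLoss_nonneg {p : ℕ} {A : Mat p} (hA : A.PosDef) : 0 ≤ steinLoss A := by
  rw [steinLoss_eq_sum hA]
  refine Finset.sum_nonneg fun i _ => ?_
  have := Real.one_sub_inv_le_log_of_pos (hA.eigenvalues_pos i)
  linarith

/-! ### The spectral norm -/

open scoped Matrix.Norms.L2Operator in
theorem specNorm_eq_norm {p : ℕ} (A : Mat p) : specNorm A = ‖A‖ := rfl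

theorem specNorm_nonneg {p : ℕ} (A : Mat p) : 0 ≤ specNorm A := norm_nonneg _

theorem specNorm_mul_le {p : ℕ} (A B : Mat p) : specNorm (A * B) ≤ specNorm A * specNorm B := by
  simp only [specNorm_eq_norm]
  exact l2_opNorm_mul A B

open scoped Matrix.Norms.L2Operator in
theorem specNorm_add_le {p : ℕ} (A B : Mat p) : specNorm (A + B) ≤ specNorm A + specNorm B := by
  simp only [specNorm_eq_norm]
  exact norm_add_le A B

open scoped Matrix.Norms.L2Operator in
theorem specNorm_neg {p : ℕ} (A : Mat p) : specNorm (-A) = specNorm A := by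
  simp only [specNorm_eq_norm]
  exact norm_neg A

open scoped Matrix.Norms.L2Operator in
theorem specNorm_smul {p : ℕ} (c : ℝ) (A : Mat p) : specNorm (c • A) = |c| * specNorm A := by
  simp only [specNorm_eq_norm]
  exact norm_smul c A

theorem specNorm_transpose_mul_self {p : ℕ} (A : Mat p) :
    specNorm (Aᵀ * A) = specNorm A * specNorm A := by
  simp only [specNorm_eq_norm]
  simpa using l2_opNorm_conjTranspose_mul_self A

theorem specNorm_transpose {p : ℕ} (A : Mat p) : specNorm Aᵀ = specNorm A := by
  simp only [specNorm_eq_norm]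
  simpa using l2_opNorm_conjTranspose A

theorem specNorm_diagonal {p : ℕ} (v : Fin p → ℝ) : specNorm (diagonal v) = ‖v‖ := by
  simp only [specNorm_eq_norm]
  exact l2_opNorm_diagonal v

theorem specNorm_one_le {p : ℕ} : specNorm (1 : Mat p) ≤ 1 := by
  rw [← diagonal_one, specNorm_diagonal]
  exact (pi_norm_le_iff_of_nonneg zero_le_one).2 fun i => by simp

theorem specNorm_le_one_of_orthogonal {p : ℕ} {U : Mat p} (hU : Uᵀ * U = 1) : specNorm U ≤ 1 := by
  have h := specNorm_transpose_mul_self U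
  rw [hU] at h
  have := specNorm_one_le (p := p)
  nlinarith [specNorm_nonneg U]

theorem specNorm_conj_le {p : ℕ} {U : Mat p} (hU : Uᵀ * U = 1) (B : Mat p) :
    specNorm (Uᵀ * B * U) ≤ specNorm B := by
  have h1 := specNorm_le_one_of_orthogonal hU
  have h2 := specNorm_mul_le (Uᵀ * B) U
  have h3 := specNorm_mul_le Uᵀ B
  rw [specNorm_transpose] at h3
  have h4 := specNorm_nonneg B
  have h5 := specNorm_nonneg U
  have h6 := specNorm_nonneg (Uᵀ * B)
  nlinarith

theorem specNorm_symm_conj_le {p : ℕ} {G : Mat p} (hG : Gᵀ = G) (B : Mat p) :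
    specNorm (G * B * G) ≤ specNorm (G * G) * specNorm B := by
  have h1 := specNorm_transpose_mul_self G
  rw [hG] at h1
  rw [h1]
  calc specNorm (G * B * G) ≤ specNorm (G * B) * specNorm G := specNorm_mul_le _ _
    _ ≤ (specNorm G * specNorm B) * specNorm G :=
        mul_le_mul_of_nonneg_right (specNorm_mul_le _ _) (specNorm_nonneg _)
    _ = _ := by ring

theorem toEuclideanCLM_inner {p : ℕ} (B : Mat p) (v w : EuclideanSpace ℝ (Fin p)) :
    inner ℝ v (Matrix.toEuclideanCLM (n := Fin p) (𝕜 := ℝ) B w) = v.ofLp ⬝ᵥ B *ᵥ w.ofLp := by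
  rw [EuclideanSpace.inner_eq_star_dotProduct]
  simp [dotProduct_comm]

theorem euclidean_norm_sq {p : ℕ} (w : EuclideanSpace ℝ (Fin p)) : ‖w‖ ^ 2 = w.ofLp ⬝ᵥ w.ofLp := by
  rw [EuclideanSpace.real_norm_sq_eq, dotProduct]
  exact Finset.sum_congr rfl fun i _ => by ring

theorem abs_dotProduct_mulVec_le {p : ℕ} (B : Mat p) (w : Fin p → ℝ) :
    |w ⬝ᵥ B *ᵥ w| ≤ specNorm B * (w ⬝ᵥ w) := by
  have h := toEuclideanCLM_inner B (WithLp.toLp 2 w) (WithLp.toLp 2 w)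
  have h1 := euclidean_norm_sq (WithLp.toLp 2 w)
  simp only at h h1
  rw [← h, ← h1]
  refine (abs_real_inner_le_norm _ _).trans ?_
  have := ContinuousLinearMap.le_opNorm
    (Matrix.toEuclideanCLM (n := Fin p) (𝕜 := ℝ) B) (WithLp.toLp 2 w)
  rw [specNorm]
  nlinarith [norm_nonneg (WithLp.toLp 2 w : EuclideanSpace ℝ (Fin p))]

theorem continuous_specNorm {p : ℕ} : Continuous (specNorm : Mat p → ℝ) := by
  have : Continuous (fun A : Mat p => Matrix.toEuclideanCLM (n := Fin p) (𝕜 := ℝ) A) :=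
    LinearMap.continuous_of_finiteDimensional
      ((Matrix.toEuclideanCLM (n := Fin p) (𝕜 := ℝ)).toAlgEquiv.toLinearMap)
  exact this.norm

/-! ### Eigenvalues near one -/

theorem abs_inv_eigenvalue_sub_one_le {p : ℕ} {A : Mat p} (hA : A.PosDef) (i : Fin p) :
    |(hA.isHermitian.eigenvalues i)⁻¹ - 1| ≤ specNorm (A⁻¹ - 1) := by
  obtain ⟨U, h1, h2, h3⟩ := hA.isHermitian.exists_orthogonal_conj
  have h4 := PosDef.inv_eq_conj_diagonal hA.eigenvalues_pos h1 h2 h3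
  have h5 : Uᵀ * (A⁻¹ - 1) * U = diagonal (fun i => (hA.isHermitian.eigenvalues i)⁻¹ - 1) := by
    rw [mul_sub, sub_mul, h4, mul_one, h1]
    simp only [← mul_assoc, h1, one_mul]
    rw [mul_assoc, h1, mul_one, ← diagonal_one, diagonal_sub]
  have h6 := specNorm_conj_le h1 (A⁻¹ - 1)
  rw [h5, specNorm_diagonal] at h6
  exact (norm_le_pi_norm (fun i => (hA.isHermitian.eigenvalues i)⁻¹ - 1) i).trans h6

theorem logSpread_le_of_near_one {p : ℕ} {A : Mat p} (hA : A.PosDef) {t : ℝ} (ht : t ≤ 1 / 2)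
    (h : specNorm (A⁻¹ - 1) ≤ t) : logSpread hA ≤ p * (2 * t) := by
  calc logSpread hA ≤ ∑ _i : Fin p, 2 * t := by
        refine Finset.sum_le_sum fun i _ => ?_
        have h1 := (abs_inv_eigenvalue_sub_one_le hA i).trans h
        have hd := hA.eigenvalues_pos i
        set d := hA.isHermitian.eigenvalues i
        have hi : 0 < d⁻¹ := inv_pos.2 hd
        obtain ⟨h2, h3⟩ := abs_le.1 h1
        have h4 := Real.log_le_sub_one_of_pos hi
        have h5 := Real.one_sub_inv_le_log_of_pos hi
        rw [Real.log_inv] at h4 h5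
        have h6 : d - 1 ≤ 2 * t := by
          have : d * d⁻¹ = 1 := mul_inv_cancel₀ hd.ne'
          rw [inv_inv] at h5
          nlinarith
        rw [inv_inv] at h5
        rw [abs_le]
        constructor <;> linarith
    _ = _ := by simp

/-- By `log d ≤ d - 1`, each term is at most `d⁻¹ + d - 2 = d * (d⁻¹ - 1) ^ 2`, and `d ≤ 2`. The
loss is thus of order `t²`, whereas `logSpread` is only of order `t`. -/
theorem steinLoss_le_of_near_one {p : ℕ} {A : Mat p} (hA : A.PosDef) {t : ℝ} (ht : t ≤ 1 / 2)
    (h : specNorm (A⁻¹ - 1) ≤ t) : steinLoss A ≤ p * (2 * t ^ 2) := by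
  rw [steinLoss_eq_sum hA]
  calc _ ≤ ∑ _i : Fin p, 2 * t ^ 2 := by
        refine Finset.sum_le_sum fun i _ => ?_
        have h1 := (abs_inv_eigenvalue_sub_one_le hA i).trans h
        have hd := hA.eigenvalues_pos i
        set d := hA.isHermitian.eigenvalues i
        have hi : 0 < d⁻¹ := inv_pos.2 hd
        have h3 := abs_le.1 h1
        have h4 := Real.log_le_sub_one_of_pos hd
        have h6 : d ≤ 2 := by
          have : d * d⁻¹ = 1 := mul_inv_cancel₀ hd.ne'
          nlinarith
        have h7 : (d⁻¹ - 1) ^ 2 ≤ t ^ 2 := sq_le_sq' (by linarith) h3.2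
        have h8 : d⁻¹ - 1 + (d - 1) = d * (d⁻¹ - 1) ^ 2 := by field_simp; ring
        nlinarith [sq_nonneg (d⁻¹ - 1)]
    _ = _ := by simp

theorem specNorm_sub_one_le {p : ℕ} {A : Mat p} (hA : A.PosDef) {t : ℝ} (ht : t ≤ 1 / 2)
    (h : specNorm (A⁻¹ - 1) ≤ t) : specNorm (A - 1) ≤ 2 * t := by
  have h1 : A - 1 = -((A - 1) * (A⁻¹ - 1) + (A⁻¹ - 1)) := by
    have := mul_nonsing_inv A (PosDef.isUnit_det hA)
    rw [sub_mul, mul_sub, this]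
    simp
  have h2 : specNorm (A - 1) ≤ specNorm (A - 1) * specNorm (A⁻¹ - 1) + specNorm (A⁻¹ - 1) := by
    conv_lhs => rw [h1, specNorm_neg]
    exact (specNorm_add_le _ _).trans (by gcongr; exact specNorm_mul_le _ _)
  have h3 := specNorm_nonneg (A - 1)
  nlinarith

/-! ### Oscillation of the matrix-`F` kernel -/

theorem matrixFKernel_pos {p : ℕ} {ν νs : ℝ} {Ψ A : Mat p} (hΨ : Ψ.PosDef) (hA : A.PosDef) :
    0 < matrixFKernel ν νs Ψ A :=
  mul_pos (Real.rpow_pos_of_pos hA.det_pos _)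
    (Real.rpow_pos_of_pos (hA.inv.add hΨ.inv).det_pos _)

theorem log_matrixFKernel {p : ℕ} {ν νs : ℝ} {Ψ A : Mat p} (hΨ : Ψ.PosDef) (hA : A.PosDef) :
    Real.log (matrixFKernel ν νs Ψ A) = -(ν + 2 * p) / 2 * Real.log A.det
      + -(νs + ν + p - 1) / 2 * Real.log (A⁻¹ + Ψ⁻¹).det := by
  have h2 := (hA.inv.add hΨ.inv).det_pos
  rw [matrixFKernel, Real.log_mul (Real.rpow_pos_of_pos hA.det_pos _).ne'
    (Real.rpow_pos_of_pos h2 _).ne', Real.log_rpow hA.det_pos, Real.log_rpow h2]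

theorem log_det_eq_sum {p : ℕ} {A : Mat p} (hA : A.PosDef) :
    Real.log A.det = ∑ i, Real.log (hA.isHermitian.eigenvalues i) := by
  rw [show A.det = ∏ i, hA.isHermitian.eigenvalues i by
    simpa using hA.isHermitian.det_eq_prod_eigenvalues,
    Real.log_prod (fun i _ => (hA.eigenvalues_pos i).ne')]

theorem PosDef.conj_symm {p : ℕ} {A G : Mat p} (hA : A.PosDef) (hG : G.PosDef) :
    (G * A * G).PosDef := by
  have := PosDef.conj hA (PosDef.isUnit_det hG)
  rwa [PosDef.transpose_eq hG] at this

/-- Conjugating by `G` and then by the eigenvectors `U` of `A` turns the two matrices into `diagonal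
d⁻¹ + Q` and `1 + Q` with the same `Q = Uᵀ * G * P * G * U`. The factor `det G⁻¹ ^ 2` is common to
both and cancels. -/
theorem abs_log_det_inv_add_sub_le {p : ℕ} {A G P : Mat p} (hA : A.PosDef) (hG : G.PosDef)
    (hP : P.PosDef) :
    |Real.log ((G * A * G)⁻¹ + P).det - Real.log ((G * G)⁻¹ + P).det| ≤ logSpread hA := by
  obtain ⟨U, h1, h2, h3⟩ := hA.isHermitian.exists_orthogonal_conj
  have hd := hA.eigenvalues_pos
  have h4 := PosDef.inv_eq_conj_diagonal hd h1 h2 h3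
  have hGu := PosDef.isUnit_det hG
  have hGt := PosDef.transpose_eq hG
  have hQ : (Uᵀ * G * P * (Uᵀ * G)ᵀ).PosSemidef := PosSemidef.conj hP.posSemidef _
  rw [transpose_mul, hGt, transpose_transpose] at hQ
  set Q := Uᵀ * G * P * (G * U) with hQdef
  have hW : U * Q * Uᵀ = G * P * G := by
    calc U * Q * Uᵀ = (U * Uᵀ) * G * P * G * (U * Uᵀ) := by simp only [hQdef, mul_assoc]
      _ = _ := by rw [h2, one_mul, mul_one]
  have hP' : G⁻¹ * (G * P * G) * G⁻¹ = P := by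
    calc G⁻¹ * (G * P * G) * G⁻¹ = (G⁻¹ * G) * P * (G * G⁻¹) := by simp only [mul_assoc]
      _ = P := by rw [nonsing_inv_mul _ hGu, mul_nonsing_inv _ hGu, one_mul, mul_one]
  have e1 : (G * A * G)⁻¹ + P
      = G⁻¹ * (U * (diagonal (fun i => (hA.isHermitian.eigenvalues i)⁻¹) + Q) * Uᵀ) * G⁻¹ := by
    rw [mul_add, add_mul, ← h4, hW, mul_add, add_mul, hP', Matrix.mul_inv_rev, Matrix.mul_inv_rev, mul_assoc]
  have e2 : (G * G)⁻¹ + P = G⁻¹ * (U * (1 + Q) * Uᵀ) * G⁻¹ := by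
    rw [mul_add, add_mul, mul_one, h2, hW, mul_add, add_mul, hP', Matrix.mul_inv_rev, mul_one]
  have hdet : ∀ X : Mat p, 0 < X.det → Real.log (G⁻¹ * (U * X * Uᵀ) * G⁻¹).det
      = Real.log (G⁻¹.det * G⁻¹.det) + Real.log X.det := by
    intro X hX
    have hGi := hG.inv.det_pos
    rw [← Real.log_mul (mul_pos hGi hGi).ne' hX.ne', det_mul, det_mul, det_mul_right_comm U, h2,
      one_mul]
    congr 1
    ring
  have hpos1 : 0 < (diagonal (fun i => (hA.isHermitian.eigenvalues i)⁻¹) + Q).det :=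
    ((PosDef.diagonal fun i => inv_pos.2 (hd i)).add_posSemidef hQ).det_pos
  rw [e1, e2, hdet _ hpos1, hdet _ (PosSemidef.one_add hQ).det_pos, add_sub_add_left_eq_sub]
  refine (abs_log_det_diagonal_add_sub_le (fun i => inv_pos.2 (hd i)) hQ).trans_eq ?_
  simp [logSpread]

/-- Each of the two determinants moves by at most `logSpread hA` on the logarithmic scale, and their
exponents add up to the constant. -/
theorem abs_log_matrixFKernel_sub_le {p : ℕ} {ν νs : ℝ} (h1 : 0 ≤ ν + 2 * p)
    (h2 : 0 ≤ νs + ν + p - 1) {Ψ A G : Mat p} (hΨ : Ψ.PosDef) (hA : A.PosDef) (hG : G.PosDef) :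
    |Real.log (matrixFKernel ν νs Ψ (G * A * G)) - Real.log (matrixFKernel ν νs Ψ (G * G))|
      ≤ ((ν + 2 * p) + (νs + ν + p - 1)) / 2 * logSpread hA := by
  have hGG : (G * G).PosDef := by simpa using PosDef.conj_symm PosDef.one hG
  rw [log_matrixFKernel hΨ (PosDef.conj_symm hA hG), log_matrixFKernel hΨ hGG]
  have h3 := abs_log_det_inv_add_sub_le hA hG hΨ.inv
  have h4 : |Real.log (G * A * G).det - Real.log (G * G).det| ≤ logSpread hA := by
    have : Real.log (G * A * G).det = Real.log (G * G).det + Real.log A.det := by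
      rw [← Real.log_mul hGG.det_pos.ne' hA.det_pos.ne']
      congr 1
      simp only [det_mul]
      ring
    rw [this, add_sub_cancel_left, log_det_eq_sum hA]
    exact Finset.abs_sum_le_sum_abs _ _
  rw [abs_le] at h3 h4 ⊢
  constructor <;> nlinarith

/-! ### Congruence transformations in symmetric coordinates -/

theorem symMat_apply {p : ℕ} (x : SymCoord p) (i j : Fin p) : symMat x i j = x s(i, j) := rfl

theorem symMat_transpose {p : ℕ} (x : SymCoord p) : (symMat x)ᵀ = symMat x := by
  ext i j
  simp [symMat_apply, Sym2.eq_swap]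

theorem symMat_isHermitian {p : ℕ} (x : SymCoord p) : (symMat x).IsHermitian := by
  rw [IsHermitian, conjTranspose_eq_transpose_of_trivial, symMat_transpose]

theorem symMat_injective {p : ℕ} : Function.Injective (symMat : SymCoord p → Mat p) := by
  intro x y h
  funext s
  induction s using Sym2.ind with
  | _ i j => exact congrFun (congrFun h i) j

theorem continuous_symMat {p : ℕ} : Continuous (symMat : SymCoord p → Mat p) :=
  continuous_matrix fun _ _ => continuous_apply _

/-- The coordinates of a symmetric matrix. -/
def symCoords {p : ℕ} (A : Mat p) (hA : Aᵀ = A) : SymCoord p :=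
  Sym2.lift ⟨fun i j => A i j, fun i j => congrFun (congrFun hA.symm i) j⟩

theorem symMat_symCoords {p : ℕ} (A : Mat p) (hA : Aᵀ = A) : symMat (symCoords A hA) = A := rfl

theorem transpose_conj_symMat {p : ℕ} (H : Mat p) (x : SymCoord p) :
    (H * symMat x * Hᵀ)ᵀ = H * symMat x * Hᵀ := by
  simp [transpose_mul, symMat_transpose, mul_assoc]

/-- The linear map `A ↦ H A Hᵀ` in symmetric coordinates. -/
def congrMap {p : ℕ} (H : Mat p) : SymCoord p →ₗ[ℝ] SymCoord p where
  toFun x := symCoords (H * symMat x * Hᵀ) (transpose_conj_symMat H x)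
  map_add' x y := symMat_injective <| by
    change H * (symMat x + symMat y) * Hᵀ = H * symMat x * Hᵀ + H * symMat y * Hᵀ
    rw [mul_add, add_mul]
  map_smul' c x := symMat_injective <| by
    change H * (c • symMat x) * Hᵀ = c • (H * symMat x * Hᵀ)
    rw [mul_smul_comm, smul_mul_assoc]

theorem symMat_congrMap {p : ℕ} (H : Mat p) (x : SymCoord p) :
    symMat (congrMap H x) = H * symMat x * Hᵀ := rfl

theorem congrMap_mul {p : ℕ} (H K : Mat p) : congrMap (H * K) = congrMap H ∘ₗ congrMap K := by
  refine LinearMap.ext fun x => ?_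
  apply symMat_injective
  simp [symMat_congrMap, transpose_mul, mul_assoc]

theorem congrMap_one {p : ℕ} : congrMap (1 : Mat p) = LinearMap.id := by
  refine LinearMap.ext fun x => ?_
  apply symMat_injective
  simp [symMat_congrMap]

/-- The product `d i * d j` over an unordered pair. -/
def pairWeight {p : ℕ} (d : Fin p → ℝ) : Sym2 (Fin p) → ℝ :=
  Sym2.lift ⟨fun i j => d i * d j, fun _ _ => mul_comm _ _⟩

/-- Each index occurs once in every pair with another index and twice in its diagonal pair, hence
`t.card + 1` times in all. -/
theorem prod_pairWeight_sym2 {p : ℕ} (d : Fin p → ℝ) (t : Finset (Fin p)) :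
    ∏ s ∈ t.sym2, pairWeight d s = (∏ i ∈ t, d i) ^ (t.card + 1) := by
  induction t using Finset.cons_induction with
  | empty => simp
  | cons a t ha ih =>
    rw [Finset.sym2_cons, Finset.prod_disjUnion, Finset.prod_map, ih, Finset.prod_cons,
      Finset.prod_cons, Finset.card_cons]
    have h1 : ∀ b, pairWeight d (Sym2.mkEmbedding a b) = d a * d b := fun b => rfl
    simp only [h1, Finset.prod_mul_distrib, Finset.prod_const]
    ring

theorem det_congrMap_diagonal {p : ℕ} (d : Fin p → ℝ) :
    LinearMap.det (congrMap (diagonal d)) = (∏ i, d i) ^ (p + 1) := by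
  have h1 : congrMap (diagonal d) = LinearMap.pi fun s =>
      (pairWeight d s • LinearMap.id (R := ℝ) (M := ℝ)).comp (LinearMap.proj s) := by
    refine LinearMap.ext fun x => funext fun s => ?_
    induction s using Sym2.ind with
    | _ i j =>
      change symMat (congrMap (diagonal d) x) i j = d i * d j * x s(i, j)
      rw [symMat_congrMap, diagonal_transpose, mul_diagonal, diagonal_mul, symMat_apply]
      ring
  rw [h1, LinearMap.det_pi]
  have h2 := prod_pairWeight_sym2 d Finset.univ
  rw [Finset.sym2_univ, Finset.card_univ, Fintype.card_fin] at h2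
  rw [← h2]
  refine Finset.prod_congr rfl fun s _ => ?_
  simp

theorem det_congrMap_mul_det_congrMap {p : ℕ} {H K : Mat p} (h : H * K = 1) :
    LinearMap.det (congrMap H) * LinearMap.det (congrMap K) = 1 := by
  rw [← LinearMap.det_comp, ← congrMap_mul, h, congrMap_one, LinearMap.det_id]

/-- In `H = U * D * Uᵀ` the Jacobians of `U` and `Uᵀ` are inverse to each other, so only the
diagonal part counts. This Jacobian later accounts for the loss of `p + 1` degrees of freedom. -/
theorem det_congrMap_of_isHermitian {p : ℕ} {H : Mat p} (hH : H.IsHermitian) :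
    LinearMap.det (congrMap H) = H.det ^ (p + 1) := by
  obtain ⟨U, h1, h2, h3⟩ := hH.exists_orthogonal_conj
  have h4 : H.det = ∏ i, hH.eigenvalues i := by simpa using hH.det_eq_prod_eigenvalues
  rw [h4]
  conv_lhs => rw [h3]
  rw [congrMap_mul, congrMap_mul, LinearMap.det_comp, LinearMap.det_comp, det_congrMap_diagonal,
    mul_right_comm, det_congrMap_mul_det_congrMap h2, one_mul]

theorem det_congrMap_ne_zero {p : ℕ} {H : Mat p} (hH : IsUnit H.det) :
    LinearMap.det (congrMap H) ≠ 0 :=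
  left_ne_zero_of_mul_eq_one (det_congrMap_mul_det_congrMap (mul_nonsing_inv H hH))

theorem congrMap_injective {p : ℕ} {H : Mat p} (hH : IsUnit H.det) :
    Function.Injective (congrMap H) := by
  have h : congrMap H⁻¹ ∘ₗ congrMap H = LinearMap.id := by
    rw [← congrMap_mul, nonsing_inv_mul H hH, congrMap_one]
  exact Function.LeftInverse.injective (g := congrMap H⁻¹) fun x =>
    congrArg (fun f : _ →ₗ[ℝ] _ => f x) h

theorem lintegral_eq_congrMap {p : ℕ} {H : Mat p} (hH : IsUnit H.det) (f : SymCoord p → ℝ≥0∞) :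
    ∫⁻ x, f x = ENNReal.ofReal |LinearMap.det (congrMap H)| * ∫⁻ x, f (congrMap H x) := by
  have h0 := det_congrMap_ne_zero hH
  have hemb : MeasurableEmbedding (congrMap H) :=
    (LinearMap.continuous_of_finiteDimensional _).measurableEmbedding (congrMap_injective hH)
  have h1 := Measure.map_linearMap_addHaar_eq_smul_addHaar (volume : Measure (SymCoord p)) h0
  rw [← hemb.lintegral_map, h1, lintegral_smul_measure, smul_eq_mul, ← mul_assoc,
    ← ENNReal.ofReal_mul (abs_nonneg _), ← abs_mul, mul_inv_cancel₀ h0]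
  simp

theorem symMat_congrMap_posDef_iff {p : ℕ} {H : Mat p} (hH : IsUnit H.det) (x : SymCoord p) :
    (symMat (congrMap H x)).PosDef ↔ (symMat x).PosDef := by
  refine ⟨fun h => ?_, fun h => PosDef.conj h hH⟩
  have h1 := PosDef.conj h (R := H⁻¹) (by rwa [isUnit_nonsing_inv_det_iff])
  rw [symMat_congrMap, transpose_nonsing_inv] at h1
  have h2 : H⁻¹ * (H * symMat x * Hᵀ) * Hᵀ⁻¹ = symMat x := by
    rw [← mul_assoc, ← mul_assoc, nonsing_inv_mul _ hH, one_mul, mul_assoc,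
      mul_nonsing_inv _ (by rwa [det_transpose]), mul_one]
  rwa [h2] at h1

/-! ### The positive definite cone -/

theorem measurableSet_posDef {p : ℕ} : MeasurableSet {x : SymCoord p | (symMat x).PosDef} := by
  have : {x : SymCoord p | (symMat x).PosDef}
      = (⋂ w : Fin p → ℝ, {x | 0 ≤ w ⬝ᵥ symMat x *ᵥ w}) ∩ {x | (symMat x).det ≠ 0} := by
    ext x
    simp only [Set.mem_ofPred_eq, Set.mem_inter_iff, Set.mem_iInter]
    constructor
    · intro h
      exact ⟨fun w => by simpa using h.posSemidef.dotProduct_mulVec_nonneg w, h.det_pos.ne'⟩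
    · rintro ⟨h1, h2⟩
      have : (symMat x).PosSemidef :=
        PosSemidef.of_dotProduct_mulVec_nonneg (symMat_isHermitian x) fun w => by simpa using h1 w
      exact this.posDef_iff_det_ne_zero.2 h2
  rw [this]
  -- The intersection over `w` is uncountable, but every member is closed.
  refine (IsClosed.measurableSet (isClosed_iInter fun w => isClosed_le continuous_const ?_)).inter ?_
  · exact continuous_const.dotProduct (continuous_symMat.matrix_mulVec continuous_const)
  · exact (isOpen_ne_fun continuous_symMat.matrix_det continuous_const).measurableSet

theorem posDef_of_specNorm_sub_lt {p : ℕ} {A B : Mat p} {k : ℝ} (hA : A.IsHermitian)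
    (hB : ∀ w, k * (w ⬝ᵥ w) ≤ w ⬝ᵥ B *ᵥ w) (h : specNorm (A - B) < k) : A.PosDef := by
  refine PosDef.of_dotProduct_mulVec_pos hA fun w hw => ?_
  have h1 := (abs_le.1 (abs_dotProduct_mulVec_le (A - B) w)).1
  rw [sub_mulVec, dotProduct_sub] at h1
  have h2 : 0 < w ⬝ᵥ w := by
    have := dotProduct_star_self_pos_iff.2 hw
    simpa using this
  have := hB w
  simp only [star_trivial]
  nlinarith

theorem volume_posDef_pos {p : ℕ} : 0 < volume {x : SymCoord p | (symMat x).PosDef} := by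
  have hopen : IsOpen {x : SymCoord p | specNorm (symMat x - 1) < 1} :=
    isOpen_lt (continuous_specNorm.comp (continuous_symMat.sub continuous_const)) continuous_const
  have hne : {x : SymCoord p | specNorm (symMat x - 1) < 1}.Nonempty := by
    refine ⟨symCoords 1 transpose_one, ?_⟩
    simp [symMat_symCoords, specNorm]
  refine (hopen.measure_pos volume hne).trans_le (measure_mono fun x hx => ?_)
  exact posDef_of_specNorm_sub_lt (symMat_isHermitian x) (fun w => by simp) hx

/-- The inverse is not continuous on the whole coordinate space. Writing it as `det⁻¹` times the
adjugate makes measurability evident. -/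
theorem measurable_symMat_inv_trace {p : ℕ} :
    Measurable fun x : SymCoord p => (symMat x)⁻¹.trace := by
  have : (fun x : SymCoord p => (symMat x)⁻¹.trace)
      = fun x => ((symMat x).det)⁻¹ * (symMat x).adjugate.trace := by
    funext x
    rw [inv_def, trace_smul, Ring.inverse_eq_inv', smul_eq_mul]
  rw [this]
  exact continuous_symMat.matrix_det.measurable.inv.mul
    continuous_symMat.matrix_adjugate.matrix_trace.measurable

theorem measurable_steinLoss {p : ℕ} : Measurable fun x : SymCoord p => steinLoss (symMat x) :=
  (measurable_symMat_inv_trace.sub_const _).add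
    continuous_symMat.matrix_det.measurable.log

theorem measurable_symMat_inv_quadForm {p : ℕ} (w : Fin p → ℝ) :
    Measurable fun x : SymCoord p => w ⬝ᵥ (symMat x)⁻¹ *ᵥ w := by
  have : (fun x : SymCoord p => w ⬝ᵥ (symMat x)⁻¹ *ᵥ w)
      = fun x => ((symMat x).det)⁻¹ * (w ⬝ᵥ (symMat x).adjugate *ᵥ w) := by
    funext x
    rw [inv_def, smul_mulVec, dotProduct_smul, Ring.inverse_eq_inv', smul_eq_mul]
  rw [this]
  exact continuous_symMat.matrix_det.measurable.inv.mul
    (continuous_const.dotProduct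
      (continuous_symMat.matrix_adjugate.matrix_mulVec continuous_const)).measurable

/-! ### A finite net controlling the spectral norm of symmetric matrices -/

/-- A largest `1`-separated subset of the sphere of radius `2` is a `1`-net of it, since any point
at distance more than `1` could be added. The radius `2` is the one for which
`Besicovitch.card_le_of_separated` bounds the cardinality. -/
theorem exists_maximal_separated (E : Type*) [NormedAddCommGroup E] [NormedSpace ℝ E]
    [FiniteDimensional ℝ E] :
    ∃ s : Finset E, s.card ≤ 5 ^ Module.finrank ℝ E ∧ (∀ c ∈ s, ‖c‖ = 2) ∧
      ∀ x : E, ‖x‖ = 2 → ∃ c ∈ s, ‖x - c‖ ≤ 1 := by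
  classical
  let P : ℕ → Prop := fun m => ∃ s : Finset E, s.card = m ∧ (∀ c ∈ s, ‖c‖ = 2) ∧
    ∀ c ∈ s, ∀ d ∈ s, c ≠ d → 1 ≤ ‖c - d‖
  have hbound : ∀ m, P m → m ≤ 5 ^ Module.finrank ℝ E := by
    rintro m ⟨s, rfl, h1, h2⟩
    exact Besicovitch.card_le_of_separated s (fun c hc => (h1 c hc).le) h2
  have h0 : P 0 := ⟨∅, by simp⟩
  have hP := Nat.findGreatest_spec (P := P) (Nat.zero_le (5 ^ Module.finrank ℝ E)) h0
  obtain ⟨s, hs, h1, h2⟩ := hP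
  refine ⟨s, hbound _ ⟨s, rfl, h1, h2⟩, h1, fun x hx => ?_⟩
  by_contra! hcon
  have hxs : x ∉ s := fun h => by
    have := hcon x h
    simp at this
    linarith
  have hP' : P (s.card + 1) := by
    refine ⟨insert x s, Finset.card_insert_of_notMem hxs, ?_, ?_⟩
    · intro c hc
      rcases Finset.mem_insert.1 hc with rfl | hc
      · exact hx
      · exact h1 c hc
    · intro c hc d hd hcd
      rcases Finset.mem_insert.1 hc with rfl | hc' <;>
        rcases Finset.mem_insert.1 hd with rfl | hd'
      · exact absurd rfl hcd
      · exact (hcon d hd').le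
      · rw [norm_sub_rev]
        exact (hcon c hc').le
      · exact h2 c hc' d hd' hcd
  have := Nat.le_findGreatest (hbound _ hP') hP'
  omega

/-- Polarisation and the parallelogram law bound `2 * inner w (B v)` by `m * (‖w‖ ^ 2 + ‖v‖ ^ 2)`.
Taking `w` parallel to `B v` with the norm of `v` gives `‖B v‖ ≤ m * ‖v‖`. -/
theorem opNorm_le_of_quadForm {E : Type*} [NormedAddCommGroup E] [InnerProductSpace ℝ E]
    (B : E →L[ℝ] E) (hB : ∀ v w, inner ℝ (B v) w = inner ℝ v (B w)) {m : ℝ} (hm : 0 ≤ m)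
    (h : ∀ x, |inner ℝ x (B x)| ≤ m * ‖x‖ ^ 2) : ‖B‖ ≤ m := by
  have key : ∀ v w, 2 * inner ℝ w (B v) ≤ m * (‖w‖ ^ 2 + ‖v‖ ^ 2) := by
    intro v w
    have h1 := (abs_le.1 (h (w + v))).2
    have h2 := (abs_le.1 (h (w - v))).1
    have h3 := parallelogram_law_with_norm ℝ w v
    have h4 : inner ℝ v (B w) = inner ℝ w (B v) := by rw [← hB, real_inner_comm]
    simp only [map_add, map_sub, inner_add_left, inner_add_right, inner_sub_left,
      inner_sub_right] at h1 h2
    nlinarith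
  refine ContinuousLinearMap.opNorm_le_bound _ hm fun v => ?_
  rcases eq_or_ne (B v) 0 with h0 | h0
  · rw [h0, norm_zero]; positivity
  rcases eq_or_ne v 0 with hv | hv
  · rw [hv]; simp
  have hb : 0 < ‖B v‖ := norm_pos_iff.2 h0
  have hv' : 0 < ‖v‖ := norm_pos_iff.2 hv
  have h1 := key v ((‖v‖ / ‖B v‖) • B v)
  rw [real_inner_smul_left, real_inner_self_eq_norm_sq, norm_smul, Real.norm_of_nonneg (by positivity),
    div_mul_cancel₀ _ hb.ne'] at h1
  have h2 : ‖v‖ / ‖B v‖ * ‖B v‖ ^ 2 = ‖v‖ * ‖B v‖ := by field_simp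
  rw [h2] at h1
  nlinarith

theorem exists_specNorm_net (p : ℕ) :
    ∃ T : Finset (Fin p → ℝ), T.card ≤ 5 ^ p ∧ (∀ y ∈ T, y ⬝ᵥ y = 1) ∧
      ∀ B : Mat p, Bᵀ = B → ∀ t : ℝ, 0 ≤ t → (∀ y ∈ T, |y ⬝ᵥ B *ᵥ y| ≤ t) →
        specNorm B ≤ 32 * t := by
  classical
  obtain ⟨s, hs, h1, h2⟩ := exists_maximal_separated (EuclideanSpace ℝ (Fin p))
  rw [finrank_euclideanSpace_fin] at hs
  refine ⟨s.image fun c => (1 / 2 : ℝ) • c.ofLp, Finset.card_image_le.trans hs, ?_, ?_⟩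
  · intro y hy
    obtain ⟨c, hc, rfl⟩ := Finset.mem_image.1 hy
    have := euclidean_norm_sq c
    rw [h1 c hc] at this
    rw [smul_dotProduct, dotProduct_smul, ← this]
    norm_num
  · intro B hB t ht hT
    set L := Matrix.toEuclideanCLM (n := Fin p) (𝕜 := ℝ) B with hL
    have hsymm : ∀ v w, inner ℝ (L v) w = inner ℝ v (L w) := by
      intro v w
      rw [real_inner_comm, toEuclideanCLM_inner, toEuclideanCLM_inner, dotProduct_mulVec,
        ← mulVec_transpose, hB, dotProduct_comm]
    have hq : ∀ c ∈ s, |inner ℝ c (L c)| ≤ 4 * t := by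
      intro c hc
      have := hT _ (Finset.mem_image_of_mem _ hc)
      rw [smul_dotProduct, mulVec_smul, dotProduct_smul, ← toEuclideanCLM_inner, ← hL] at this
      simp only [smul_eq_mul, ← mul_assoc, abs_mul] at this
      norm_num at this
      linarith
    -- A point of the sphere is compared with its nearest net point through `inner x (L x) - inner c
    -- (L c) = inner (x - c) (L (x + c))`, and part of `‖L‖` reappears on the right. Rescaling from
    -- radius `2` to `1` makes its coefficient `31 / 32 < 1`, whence the constant `32`.
    have hx2 : ∀ x : EuclideanSpace ℝ (Fin p), ‖x‖ = 2 →
        |inner ℝ x (L x)| ≤ 4 * t + 31 / 8 * ‖L‖ := by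
      intro x hx
      obtain ⟨c, hc, hxc⟩ := h2 x hx
      have e1 : inner ℝ x (L x) - inner ℝ c (L c) = inner ℝ (x - c) (L (x + c)) := by
        have h4 : inner ℝ c (L x) = inner ℝ x (L c) := by rw [← hsymm, real_inner_comm]
        simp only [map_add, inner_add_right, inner_sub_left]
        linarith
      have e2 := abs_real_inner_le_norm (x - c) (L (x + c))
      have e3 := L.le_opNorm (x + c)
      have e4 := parallelogram_law_with_norm ℝ x c
      rw [hx, h1 c hc] at e4
      -- With `u = ‖x - c‖ ^ 2 ≤ 1`, the squared product is `u * (16 - u) ≤ 15`, and `15 < (31 / 8)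
      -- ^ 2`.
      have e5 : ‖x - c‖ * ‖x + c‖ ≤ 31 / 8 := by
        refine abs_le_of_sq_le_sq' ?_ (by norm_num) |>.2
        have : (‖x - c‖ * ‖x + c‖) ^ 2 = ‖x - c‖ ^ 2 * (16 - ‖x - c‖ ^ 2) := by nlinarith
        rw [this]
        have h5 : ‖x - c‖ ^ 2 ≤ 1 := by nlinarith [norm_nonneg (x - c)]
        nlinarith
      have e6 : ‖x - c‖ * ‖L (x + c)‖ ≤ 31 / 8 * ‖L‖ := by
        calc ‖x - c‖ * ‖L (x + c)‖ ≤ ‖x - c‖ * (‖L‖ * ‖x + c‖) := by gcongr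
          _ = (‖x - c‖ * ‖x + c‖) * ‖L‖ := by ring
          _ ≤ _ := by gcongr
      have e7 := hq c hc
      rw [← e1] at e2
      rw [abs_le] at e2 e7 ⊢
      constructor <;> linarith
    have hfin : ‖L‖ ≤ t + 31 / 32 * ‖L‖ := by
      refine opNorm_le_of_quadForm L hsymm (by positivity) fun x => ?_
      rcases eq_or_ne x 0 with hx | hx
      · simp [hx]
      have hxn : 0 < ‖x‖ := norm_pos_iff.2 hx
      have e1 := hx2 ((2 / ‖x‖) • x) (by
        rw [norm_smul, Real.norm_of_nonneg (by positivity), div_mul_cancel₀ _ hxn.ne'])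
      rw [map_smul, real_inner_smul_left, real_inner_smul_right, ← mul_assoc, abs_mul,
        abs_of_pos (by positivity)] at e1
      have e2 : 2 / ‖x‖ * (2 / ‖x‖) = 4 / ‖x‖ ^ 2 := by field_simp; norm_num
      rw [e2, div_mul_eq_mul_div, div_le_iff₀ (by positivity)] at e1
      nlinarith
    rw [specNorm, ← hL]
    linarith

/-! ### The measure with density a power of the Stein loss -/

/-- The density `exp (-(N / 2) * steinLoss A)` on the positive definite cone. -/
noncomputable def steinDensity (p : ℕ) (N : ℝ) : SymCoord p → ℝ≥0∞ :=
  {x | (symMat x).PosDef}.indicator fun x =>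
    ENNReal.ofReal (Real.exp (-(N / 2) * steinLoss (symMat x)))

theorem measurable_steinDensity (p : ℕ) (N : ℝ) : Measurable (steinDensity p N) :=
  ((measurable_steinLoss.const_mul _).exp.ennreal_ofReal).indicator measurableSet_posDef

/-- An unnormalised inverse Wishart distribution with `N` degrees of freedom. -/
noncomputable def steinMeasure (p : ℕ) (N : ℝ) : Measure (SymCoord p) :=
  volume.withDensity (steinDensity p N)

theorem norm_entry_le_specNorm {p : ℕ} (A : Mat p) (i j : Fin p) : |A i j| ≤ specNorm A := by
  have h := (Matrix.toEuclideanCLM (n := Fin p) (𝕜 := ℝ) A).le_opNorm (EuclideanSpace.single j 1)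
  have h2 := PiLp.norm_apply_le
    (Matrix.toEuclideanCLM (n := Fin p) (𝕜 := ℝ) A (EuclideanSpace.single j 1)) i
  rw [PiLp.norm_single, norm_one, mul_one] at h
  have h3 : (Matrix.toEuclideanCLM (n := Fin p) (𝕜 := ℝ) A (EuclideanSpace.single j 1)) i
      = A i j := by
    simp
  rw [h3] at h2
  exact h2.trans h

theorem norm_le_specNorm_symMat {p : ℕ} (x : SymCoord p) : ‖x‖ ≤ specNorm (symMat x) := by
  refine (pi_norm_le_iff_of_nonneg (specNorm_nonneg _)).2 fun s => ?_
  induction s using Sym2.ind with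
  | _ i j => exact norm_entry_le_specNorm (symMat x) i j

theorem exists_norm_le_eigenvalue {p : ℕ} (hp : 0 < p) {x : SymCoord p} (hx : (symMat x).PosDef) :
    ∃ i, ‖x‖ ≤ hx.isHermitian.eigenvalues i := by
  by_contra! hcon
  obtain ⟨U, h1, h2, h3⟩ := hx.isHermitian.exists_orthogonal_conj
  have hx0 : 0 < ‖x‖ := (hx.eigenvalues_pos ⟨0, hp⟩).trans (hcon _)
  have h4 : specNorm (symMat x) ≤ ‖hx.isHermitian.eigenvalues‖ := by
    conv_lhs => rw [h3]
    have := specNorm_conj_le (U := Uᵀ) (by simpa using h2) (diagonal hx.isHermitian.eigenvalues)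
    rwa [transpose_transpose, specNorm_diagonal] at this
  have h5 : ‖hx.isHermitian.eigenvalues‖ < ‖x‖ := (pi_norm_lt_iff hx0).2 fun i => by
    rw [Real.norm_of_nonneg (hx.eigenvalues_pos i).le]
    exact hcon i
  exact absurd (norm_le_specNorm_symMat x) (by linarith)

/-- Some eigenvalue is at least `‖x‖`, and its term alone makes the loss grow like `log ‖x‖`. The
Stein density therefore decays at least polynomially at infinity. -/
theorem log_one_add_norm_le_steinLoss {p : ℕ} (hp : 0 < p) {x : SymCoord p}
    (hx : (symMat x).PosDef) : Real.log (1 + ‖x‖) ≤ steinLoss (symMat x) + 2 := by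
  obtain ⟨i, hi⟩ := exists_norm_le_eigenvalue hp hx
  have hd := hx.eigenvalues_pos
  have h1 : (hx.isHermitian.eigenvalues i)⁻¹ - 1 + Real.log (hx.isHermitian.eigenvalues i)
      ≤ steinLoss (symMat x) := by
    rw [steinLoss_eq_sum hx]
    refine Finset.single_le_sum (f := fun i => (hx.isHermitian.eigenvalues i)⁻¹ - 1
      + Real.log (hx.isHermitian.eigenvalues i)) (fun j _ => ?_) (Finset.mem_univ i)
    have := Real.one_sub_inv_le_log_of_pos (hd j)
    linarith
  have h0 := steinLoss_nonneg hx
  set d := hx.isHermitian.eigenvalues i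
  have hdi : 0 < d := hd i
  have hinv : 0 < d⁻¹ := inv_pos.2 hdi
  rcases le_total d 1 with h | h
  · have := Real.log_le_sub_one_of_pos (show 0 < 1 + ‖x‖ by positivity)
    linarith
  · have h2 : Real.log (1 + ‖x‖) ≤ Real.log (2 * d) :=
      Real.log_le_log (by positivity) (by linarith)
    rw [Real.log_mul two_ne_zero hdi.ne'] at h2
    have := Real.log_le_sub_one_of_pos (show (0 : ℝ) < 2 by norm_num)
    linarith

theorem finrank_symCoord_le (p : ℕ) : Module.finrank ℝ (SymCoord p) ≤ p ^ 2 := by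
  rw [Module.finrank_fintype_fun_eq_card]
  refine (Fintype.card_le_of_surjective (fun q : Fin p × Fin p => s(q.1, q.2)) fun s => ?_).trans
    (by simp [sq])
  induction s using Sym2.ind with
  | _ i j => exact ⟨(i, j), rfl⟩

theorem steinMeasure_univ {p : ℕ} (N : ℝ) :
    steinMeasure p N Set.univ = ∫⁻ x, steinDensity p N x := by
  rw [steinMeasure, withDensity_apply _ MeasurableSet.univ, Measure.restrict_univ]

/-- The density is at most `exp N * (1 + ‖x‖) ^ (-(N / 2))`, which is integrable as soon as `N / 2`
exceeds the dimension, and the dimension is at most `p ^ 2`. This crude threshold suffices because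
`p ^ 5 / n → 0`. -/
theorem steinMeasure_univ_lt_top {p : ℕ} (hp : 0 < p) {N : ℝ} (hN : 2 * (p : ℝ) ^ 2 < N) :
    steinMeasure p N Set.univ < ∞ := by
  have hN0 : 0 < N := lt_of_le_of_lt (by positivity) hN
  have h1 : ∫⁻ x : SymCoord p, ENNReal.ofReal ((1 + ‖x‖) ^ (-(N / 2))) < ∞ := by
    refine finite_integral_one_add_norm (lt_of_le_of_lt (b := (p : ℝ) ^ 2) ?_ (by linarith))
    exact_mod_cast finrank_symCoord_le p
  rw [steinMeasure_univ]
  calc ∫⁻ x, steinDensity p N x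
      ≤ ∫⁻ x : SymCoord p, ENNReal.ofReal (Real.exp N) * ENNReal.ofReal ((1 + ‖x‖) ^ (-(N / 2))) := by
        refine lintegral_mono (Set.indicator_le fun x hx => ?_)
        rw [← ENNReal.ofReal_mul (Real.exp_pos _).le]
        apply ENNReal.ofReal_le_ofReal
        rw [Real.rpow_def_of_pos (by positivity), ← Real.exp_add]
        apply Real.exp_le_exp.2
        have := log_one_add_norm_le_steinLoss hp hx
        nlinarith
    _ < ∞ := by
        rw [lintegral_const_mul' _ _ ENNReal.ofReal_ne_top]
        exact ENNReal.mul_lt_top ENNReal.ofReal_lt_top h1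

theorem steinMeasure_univ_pos {p : ℕ} (N : ℝ) : 0 < steinMeasure p N Set.univ := by
  rw [steinMeasure_univ, lintegral_pos_iff_support (measurable_steinDensity p N)]
  refine volume_posDef_pos.trans_le (measure_mono fun x hx => ?_)
  rw [Function.mem_support, steinDensity, Set.indicator_of_mem hx]
  exact (ENNReal.ofReal_pos.2 (Real.exp_pos _)).ne'

/-! ### Exponential moments and tails under the Stein measure -/

theorem transpose_vecMulVec_self {p : ℕ} (w : Fin p → ℝ) :
    (vecMulVec w w)ᵀ = vecMulVec w w := by
  rw [transpose_vecMulVec]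

theorem vecMulVec_self_mul_self {p : ℕ} {w : Fin p → ℝ} (hw : w ⬝ᵥ w = 1) :
    vecMulVec w w * vecMulVec w w = vecMulVec w w := by
  rw [vecMulVec_mul_vecMulVec, hw, one_smul]

theorem det_one_add_smul_vecMulVec {p : ℕ} {w : Fin p → ℝ} (hw : w ⬝ᵥ w = 1) (c : ℝ) :
    (1 + c • vecMulVec w w).det = 1 + c := by
  have := det_one_add_replicateCol_mul_replicateRow (ι := Unit) (c • w) w
  rw [← vecMulVec_eq, smul_vecMulVec, dotProduct_smul, hw] at this
  simpa using this

theorem trace_mul_vecMulVec_self {p : ℕ} (B : Mat p) (w : Fin p → ℝ) :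
    (B * vecMulVec w w).trace = w ⬝ᵥ B *ᵥ w := by
  rw [mul_vecMulVec, trace_vecMulVec, dotProduct_comm]

/-- The matrix `H` is chosen with `H * H = 1 - s • w wᵀ`. After the substitution `x ↦ H x H` the
exponential tilt completes the trace to `tr ((H x H)⁻¹ * H * H) = tr x⁻¹`, so the untilted density
returns up to a power of `1 - s`. -/
theorem steinDensity_congrMap_mul {p : ℕ} (N : ℝ) {w : Fin p → ℝ} (hw : w ⬝ᵥ w = 1) {s : ℝ}
    (hs : s < 1) (x : SymCoord p) :
    steinDensity p N (congrMap (1 + (√(1 - s) - 1) • vecMulVec w w) x) *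
      ENNReal.ofReal (Real.exp (s * N / 2 *
        (w ⬝ᵥ (symMat (congrMap (1 + (√(1 - s) - 1) • vecMulVec w w) x))⁻¹ *ᵥ w)))
    = ENNReal.ofReal (Real.exp (-(N / 2) * Real.log (1 - s))) * steinDensity p N x := by
  set h := √(1 - s) with hh
  have hpos : 0 < h := Real.sqrt_pos.2 (by linarith)
  have hsq : h * h = 1 - s := Real.mul_self_sqrt (by linarith)
  set H : Mat p := 1 + (h - 1) • vecMulVec w w with hH
  have hdet : H.det = h := by rw [hH, det_one_add_smul_vecMulVec hw]; ring
  have hu : IsUnit H.det := by rw [hdet]; exact isUnit_iff_ne_zero.2 hpos.ne'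
  have hHt : Hᵀ = H := by rw [hH, transpose_add, transpose_one, transpose_smul,
    transpose_vecMulVec_self]
  have hHH : H * H = 1 - s • vecMulVec w w := by
    have h1 : s = 1 - h * h := by linarith
    rw [hH, add_mul, mul_add, mul_add, smul_mul_smul_comm, vecMulVec_self_mul_self hw, h1]
    simp only [one_mul, mul_one]
    module
  by_cases hx : (symMat x).PosDef
  · have hx' := (symMat_congrMap_posDef_iff hu x).2 hx
    rw [steinDensity, Set.indicator_of_mem (by exact hx'),
      Set.indicator_of_mem (by exact hx), ← ENNReal.ofReal_mul (Real.exp_pos _).le,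
      ← ENNReal.ofReal_mul (Real.exp_pos _).le, ← Real.exp_add, ← Real.exp_add]
    congr 2
    rw [symMat_congrMap, hHt] at hx' ⊢
    have htr : (H * symMat x * H)⁻¹.trace - s * (w ⬝ᵥ (H * symMat x * H)⁻¹ *ᵥ w)
        = (symMat x)⁻¹.trace := by
      have h2 : (H * symMat x * H)⁻¹ * (H * H) = H⁻¹ * (symMat x)⁻¹ * H := by
        rw [Matrix.mul_inv_rev, Matrix.mul_inv_rev]
        simp only [mul_assoc]
        rw [nonsing_inv_mul_cancel_left _ _ hu]
      rw [← trace_mul_vecMulVec_self, ← smul_eq_mul s, ← trace_smul, ← trace_sub,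
        ← mul_smul_comm]
      have h3 : (H * symMat x * H)⁻¹ - (H * symMat x * H)⁻¹ * s • vecMulVec w w
          = (H * symMat x * H)⁻¹ * (H * H) := by rw [hHH, mul_sub, mul_one]
      rw [h3, h2, trace_mul_comm, ← mul_assoc, mul_nonsing_inv _ hu, one_mul]
    have hld : Real.log (H * symMat x * H).det = Real.log (symMat x).det + Real.log (1 - s) := by
      rw [← hsq, ← Real.log_mul hx.det_pos.ne' (mul_pos hpos hpos).ne']
      congr 1
      simp only [det_mul, hdet]
      ring
    rw [steinLoss, steinLoss, hld, ← htr]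
    ring
  · have hx' := (symMat_congrMap_posDef_iff hu x).not.2 hx
    rw [steinDensity, Set.indicator_of_notMem (by exact hx'), Set.indicator_of_notMem (by exact hx)]
    simp

/-- This is the moment generating function of a chi-squared variable with `N - p - 1` degrees of
freedom: `N` comes from the density and `-(p + 1)` from the Jacobian `√(1 - s) ^ (p + 1)`. -/
theorem lintegral_steinDensity_mul_exp {p : ℕ} (N : ℝ) {w : Fin p → ℝ} (hw : w ⬝ᵥ w = 1) {s : ℝ}
    (hs : s < 1) :
    ∫⁻ x, steinDensity p N x *
      ENNReal.ofReal (Real.exp (s * N / 2 * (w ⬝ᵥ (symMat x)⁻¹ *ᵥ w)))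
    = ENNReal.ofReal (Real.exp (-((N - p - 1) / 2) * Real.log (1 - s))) *
        steinMeasure p N Set.univ := by
  have hpos : 0 < √(1 - s) := Real.sqrt_pos.2 (by linarith)
  have hdet : (1 + (√(1 - s) - 1) • vecMulVec w w : Mat p).det = √(1 - s) := by
    rw [det_one_add_smul_vecMulVec hw]; ring
  have hherm : (1 + (√(1 - s) - 1) • vecMulVec w w : Mat p).IsHermitian := by
    rw [IsHermitian, conjTranspose_eq_transpose_of_trivial, transpose_add, transpose_one,
      transpose_smul, transpose_vecMulVec_self]
  have hu : IsUnit (1 + (√(1 - s) - 1) • vecMulVec w w : Mat p).det := by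
    rw [hdet]; exact isUnit_iff_ne_zero.2 hpos.ne'
  rw [lintegral_eq_congrMap hu, det_congrMap_of_isHermitian hherm, hdet]
  simp only [steinDensity_congrMap_mul N hw hs]
  rw [lintegral_const_mul' _ _ ENNReal.ofReal_ne_top, ← mul_assoc, steinMeasure_univ,
    ← ENNReal.ofReal_mul (abs_nonneg _)]
  congr 2
  rw [abs_of_pos (by positivity), ← Real.exp_log (pow_pos hpos (p + 1)), ← Real.exp_add,
    Real.log_pow, Real.log_sqrt (by linarith)]
  congr 1
  push_cast
  ring

theorem steinMeasure_le_of_exp {p : ℕ} (N : ℝ) {w : Fin p → ℝ} (hw : w ⬝ᵥ w = 1) {s a b : ℝ}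
    (hs : s < 1) (hab : -((N - p - 1) / 2) * Real.log (1 - s) - a ≤ b) :
    steinMeasure p N {x | a ≤ s * N / 2 * (w ⬝ᵥ (symMat x)⁻¹ *ᵥ w)} ≤
      ENNReal.ofReal (Real.exp b) * steinMeasure p N Set.univ := by
  have hm : MeasurableSet {x : SymCoord p | a ≤ s * N / 2 * (w ⬝ᵥ (symMat x)⁻¹ *ᵥ w)} :=
    measurableSet_le measurable_const ((measurable_symMat_inv_quadForm w).const_mul _)
  rw [steinMeasure, withDensity_apply _ hm, ← steinMeasure]
  calc ∫⁻ x in {x | a ≤ s * N / 2 * (w ⬝ᵥ (symMat x)⁻¹ *ᵥ w)}, steinDensity p N x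
      ≤ ∫⁻ x in {x | a ≤ s * N / 2 * (w ⬝ᵥ (symMat x)⁻¹ *ᵥ w)},
          ENNReal.ofReal (Real.exp (-a)) * (steinDensity p N x *
            ENNReal.ofReal (Real.exp (s * N / 2 * (w ⬝ᵥ (symMat x)⁻¹ *ᵥ w)))) := by
        refine setLIntegral_mono' hm fun x hx => ?_
        rw [mul_left_comm, ← ENNReal.ofReal_mul (Real.exp_pos _).le, ← Real.exp_add]
        refine le_mul_of_one_le_right' ?_
        rw [ENNReal.one_le_ofReal]
        refine Real.one_le_exp ?_
        have : a ≤ s * N / 2 * (w ⬝ᵥ (symMat x)⁻¹ *ᵥ w) := hx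
        linarith
    _ ≤ ∫⁻ x, ENNReal.ofReal (Real.exp (-a)) * (steinDensity p N x *
            ENNReal.ofReal (Real.exp (s * N / 2 * (w ⬝ᵥ (symMat x)⁻¹ *ᵥ w)))) :=
        setLIntegral_le_lintegral _ _
    _ = ENNReal.ofReal (Real.exp (-a + -((N - p - 1) / 2) * Real.log (1 - s))) *
          steinMeasure p N Set.univ := by
        rw [lintegral_const_mul' _ _ ENNReal.ofReal_ne_top, lintegral_steinDensity_mul_exp N hw hs,
          ← mul_assoc, ← ENNReal.ofReal_mul (Real.exp_pos _).le, ← Real.exp_add]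
    _ ≤ _ := by
        gcongr
        linarith

theorem neg_log_one_sub_le {s : ℝ} (hs : s ≤ 1 / 2) :
    -Real.log (1 - s) ≤ s + 2 * s ^ 2 := by
  have h := Real.one_sub_inv_le_log_of_pos (show 0 < 1 - s by linarith)
  have h1 : (1 - s)⁻¹ ≤ 1 + s + 2 * s ^ 2 := by
    rw [inv_le_iff_one_le_mul₀ (by linarith)]
    nlinarith [mul_nonneg (sq_nonneg s) (sub_nonneg.2 hs)]
  linarith

theorem le_log_one_add {s : ℝ} (hs0 : 0 ≤ s) : s - s ^ 2 ≤ Real.log (1 + s) := by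
  have h := Real.one_sub_inv_le_log_of_pos (show 0 < 1 + s by linarith)
  have h1 : (1 + s)⁻¹ ≤ 1 - s + s ^ 2 := by
    rw [inv_le_iff_one_le_mul₀ (by linarith)]
    nlinarith [pow_nonneg hs0 3]
  linarith

theorem steinMeasure_quadForm_tail {p : ℕ} {N : ℝ} (hN : (p : ℝ) + 1 ≤ N) {w : Fin p → ℝ}
    (hw : w ⬝ᵥ w = 1) {t : ℝ} (ht0 : 0 < t) (ht : t ≤ 1) :
    steinMeasure p N {x | t < |w ⬝ᵥ ((symMat x)⁻¹ - 1) *ᵥ w|} ≤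
      2 * ENNReal.ofReal (Real.exp (-(N * t ^ 2 / 16) + (p + 1) * t / 8)) *
        steinMeasure p N Set.univ := by
  have hp0 : (0 : ℝ) ≤ p := Nat.cast_nonneg p
  have hN0 : 0 < N := by linarith
  -- Chernoff bounds at `s = t / 4` and `s = -(t / 4)`. The term `(p + 1) * t / 8` is needed for the
  -- lower tail only: the quadratic form is centred at `(N - p - 1) / N` rather than at `1`.
  have h1 := steinMeasure_le_of_exp N hw (s := t / 4) (a := t / 4 * N / 2 * (1 + t))
    (b := -(N * t ^ 2 / 16) + (p + 1) * t / 8) (by linarith) (by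
      have := neg_log_one_sub_le (s := t / 4) (by linarith)
      have h2 := mul_le_mul_of_nonneg_left this (show 0 ≤ (N - p - 1) / 2 by linarith)
      nlinarith [mul_nonneg hp0 ht0.le, mul_nonneg hp0 (sq_nonneg t)])
  have h2 := steinMeasure_le_of_exp N hw (s := -(t / 4)) (a := -(t / 4) * N / 2 * (1 - t))
    (b := -(N * t ^ 2 / 16) + (p + 1) * t / 8) (by linarith) (by
      have := le_log_one_add (s := t / 4) (by linarith)
      have h2 := mul_le_mul_of_nonneg_left this (show 0 ≤ (N - p - 1) / 2 by linarith)
      rw [sub_neg_eq_add]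
      nlinarith [mul_nonneg hp0 ht0.le, mul_nonneg hp0 (sq_nonneg t),
        mul_nonneg hN0.le (sq_nonneg t)])
  rw [two_mul, add_mul]
  refine (measure_mono fun x hx => ?_).trans ((measure_union_le _ _).trans (add_le_add h1 h2))
  have hx' : t < |w ⬝ᵥ ((symMat x)⁻¹ - 1) *ᵥ w| := hx
  rw [sub_mulVec, one_mulVec, dotProduct_sub, hw, lt_abs] at hx'
  rcases hx' with hx' | hx'
  · left
    change t / 4 * N / 2 * (1 + t) ≤ t / 4 * N / 2 * (w ⬝ᵥ (symMat x)⁻¹ *ᵥ w)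
    have : 0 < t / 4 * N / 2 := by positivity
    nlinarith
  · right
    change -(t / 4) * N / 2 * (1 - t) ≤ -(t / 4) * N / 2 * (w ⬝ᵥ (symMat x)⁻¹ *ᵥ w)
    have : 0 < t / 4 * N / 2 := by positivity
    nlinarith

theorem steinMeasure_tail {p : ℕ} {N : ℝ} (hN : (p : ℝ) + 1 ≤ N) {t : ℝ} (ht0 : 0 < t)
    (ht : t ≤ 1) :
    steinMeasure p N {x | 32 * t < specNorm ((symMat x)⁻¹ - 1)} ≤
      2 * 5 ^ p * ENNReal.ofReal (Real.exp (-(N * t ^ 2 / 16) + (p + 1) * t / 8)) *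
        steinMeasure p N Set.univ := by
  obtain ⟨T, hT, hT1, hT2⟩ := exists_specNorm_net p
  calc steinMeasure p N {x | 32 * t < specNorm ((symMat x)⁻¹ - 1)}
      ≤ steinMeasure p N (⋃ y ∈ T, {x | t < |y ⬝ᵥ ((symMat x)⁻¹ - 1) *ᵥ y|}) := by
        refine measure_mono fun x hx => ?_
        by_contra hcon
        simp only [Set.mem_iUnion, Set.mem_ofPred_eq, not_exists, not_lt] at hcon
        have hB : ((symMat x)⁻¹ - 1)ᵀ = (symMat x)⁻¹ - 1 := by
          rw [transpose_sub, transpose_nonsing_inv, symMat_transpose, transpose_one]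
        exact absurd (hT2 _ hB t ht0.le hcon) (not_le.2 hx)
    _ ≤ ∑ y ∈ T, steinMeasure p N {x | t < |y ⬝ᵥ ((symMat x)⁻¹ - 1) *ᵥ y|} :=
        measure_biUnion_finset_le _ _
    _ ≤ ∑ _y ∈ T, 2 * ENNReal.ofReal (Real.exp (-(N * t ^ 2 / 16) + (p + 1) * t / 8)) *
          steinMeasure p N Set.univ :=
        Finset.sum_le_sum fun y hy => steinMeasure_quadForm_tail hN (hT1 y hy) ht0 ht
    _ = T.card * (2 * ENNReal.ofReal (Real.exp (-(N * t ^ 2 / 16) + (p + 1) * t / 8)) *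
          steinMeasure p N Set.univ) := by rw [Finset.sum_const, nsmul_eq_mul]
    _ ≤ 5 ^ p * (2 * ENNReal.ofReal (Real.exp (-(N * t ^ 2 / 16) + (p + 1) * t / 8)) *
          steinMeasure p N Set.univ) := by
        gcongr
        exact_mod_cast hT
    _ = _ := by ring

/-! ### Comparison of the posterior with the Stein measure -/

/-- The trace term reduces to `tr ((G A G)⁻¹ * G * G) = tr A⁻¹` and the determinant factors, so the
data enter only through a constant. -/
theorem logLik_conj {n p : ℕ} {Y : Data n p} {A G : Mat p} (hG : G.PosDef)
    (hS : G * G = sampleCov Y) (hA : A.PosDef) :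
    logLik Y (G * A * G) = logLik Y (sampleCov Y) - (n : ℝ) / 2 * steinLoss A := by
  have hGu := PosDef.isUnit_det hG
  have hGG : 0 < (G * G).det := by rw [det_mul]; exact mul_pos hG.det_pos hG.det_pos
  have h1 : Real.log (G * A * G).det = Real.log (G * G).det + Real.log A.det := by
    rw [← Real.log_mul hGG.ne' hA.det_pos.ne']
    congr 1
    simp only [det_mul]
    ring
  have h2 : ((G * A * G)⁻¹ * (G * G)).trace = A⁻¹.trace := by
    rw [Matrix.mul_inv_rev, Matrix.mul_inv_rev]
    simp only [mul_assoc]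
    rw [nonsing_inv_mul_cancel_left _ _ hGu, trace_mul_comm, mul_assoc, mul_nonsing_inv _ hGu,
      mul_one]
  have h3 : ((G * G)⁻¹ * (G * G)).trace = p := by
    rw [nonsing_inv_mul _ (isUnit_iff_ne_zero.2 hGG.ne'), trace_one, Fintype.card_fin]
  rw [logLik, logLik, ← hS, h1, h2, h3, steinLoss]
  ring

/-- The logarithm of `π (G A G)` differs from that of `π (G G)` by at most
`b / 2 * (steinLoss A / τ + p τ)`. -/
def LogOscBound {p : ℕ} (π : Mat p → ℝ) (G : Mat p) (b τ : ℝ) : Prop :=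
  ∀ A : Mat p, A.PosDef → 0 < π (G * A * G) ∧
    |Real.log (π (G * A * G)) - Real.log (π (G * G))| ≤ b / 2 * (steinLoss A / τ + p * τ)

theorem measurableSet_specNorm_sub_gt {p : ℕ} (ε : ℝ) (A₀ : Mat p) :
    MeasurableSet {x : SymCoord p | ε < specNorm (symMat x - A₀)} :=
  (isOpen_lt continuous_const
    (continuous_specNorm.comp (continuous_symMat.sub continuous_const))).measurableSet

theorem measurable_specNorm_inv_sub_one {p : ℕ} :
    Measurable fun x : SymCoord p => specNorm ((symMat x)⁻¹ - 1) := by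
  have h : (fun x : SymCoord p => specNorm ((symMat x)⁻¹ - 1))
      = fun x => (fun q : ℝ × (Fin p → Fin p → ℝ) => specNorm (q.1 • Matrix.of q.2 - 1))
          (((symMat x).det)⁻¹, fun i j => (symMat x).adjugate i j) := by
    funext x
    simp only [inv_def, Ring.inverse_eq_inv']
    rfl
  rw [h]
  have hc : Continuous fun q : ℝ × (Fin p → Fin p → ℝ) => specNorm (q.1 • Matrix.of q.2 - 1) :=
    continuous_specNorm.comp ((continuous_fst.smul continuous_snd).sub continuous_const)
  refine hc.measurable.comp (Measurable.prodMk ?_ ?_)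
  · exact continuous_symMat.matrix_det.measurable.inv
  · exact measurable_pi_lambda _ fun i => measurable_pi_lambda _ fun j =>
      (continuous_symMat.matrix_adjugate.matrix_elem i j).measurable

theorem steinMeasure_not_posDef {p : ℕ} (N : ℝ) :
    steinMeasure p N {x | ¬ (symMat x).PosDef} = 0 := by
  have hm : MeasurableSet {x : SymCoord p | ¬ (symMat x).PosDef} := measurableSet_posDef.compl
  rw [steinMeasure, withDensity_apply _ hm]
  refine (setLIntegral_congr_fun hm fun x hx => ?_).trans (lintegral_zero (α := SymCoord p))
  rw [steinDensity, Set.indicator_of_notMem]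
  exact hx

section Comparison

variable {n p : ℕ} {Y : Data n p} {π : Mat p → ℝ} {G : Mat p} {b τ : ℝ}

/-- The part of the prior oscillation proportional to `steinLoss A` merges with the likelihood and
changes `n` into `n ∓ b / τ`. The rest is the constant `exp (± b p τ / 2)`. -/
theorem likelihood_mul_prior_bounds (hG : G.PosDef) (hS : G * G = sampleCov Y)
    (hosc : LogOscBound π G b τ) {A : Mat p} (hA : A.PosDef) :
    Real.exp (logLik Y (G * A * G)) * π (G * A * G) ≤
        Real.exp (logLik Y (sampleCov Y)) * π (G * G) * Real.exp (b * p * τ / 2) *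
          Real.exp (-((n - b / τ) / 2) * steinLoss A) ∧
      Real.exp (logLik Y (sampleCov Y)) * π (G * G) * Real.exp (-(b * p * τ / 2)) *
          Real.exp (-((n + b / τ) / 2) * steinLoss A) ≤
        Real.exp (logLik Y (G * A * G)) * π (G * A * G) := by
  obtain ⟨h1, h2⟩ := hosc A hA
  have h0 : 0 < π (G * G) := by simpa using (hosc 1 PosDef.one).1
  obtain ⟨h3, h4⟩ := abs_le.1 h2
  have e : b / 2 * (steinLoss A / τ + p * τ) = b / τ / 2 * steinLoss A + b * p * τ / 2 := by ring
  rw [e] at h3 h4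
  rw [logLik_conj hG hS hA, ← Real.exp_log h1, ← Real.exp_log h0,
    ← Real.exp_add, ← Real.exp_add, ← Real.exp_add, ← Real.exp_add, ← Real.exp_add,
    ← Real.exp_add, Real.exp_le_exp, Real.exp_le_exp]
  constructor <;> linarith

theorem unnormalizedPosterior_apply (hG : G.PosDef) {E : Set (SymCoord p)} (hE : MeasurableSet E) :
    unnormalizedPosterior π Y E = ENNReal.ofReal |LinearMap.det (congrMap G)| *
      ∫⁻ x in {x | congrMap G x ∈ E}, {x | (symMat x).PosDef}.indicator (fun x =>
        ENNReal.ofReal (Real.exp (logLik Y (G * symMat x * G)) * π (G * symMat x * G))) x := by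
  have hu := PosDef.isUnit_det hG
  have hE' : MeasurableSet {x | congrMap G x ∈ E} :=
    (LinearMap.continuous_of_finiteDimensional (congrMap G)).measurable hE
  rw [unnormalizedPosterior, withDensity_apply _ hE, ← lintegral_indicator hE,
    lintegral_eq_congrMap hu, ← lintegral_indicator hE']
  congr 2
  funext x
  have hsym : symMat (congrMap G x) = G * symMat x * G := by
    rw [symMat_congrMap, PosDef.transpose_eq hG]
  have hiff := symMat_congrMap_posDef_iff hu x
  rw [hsym] at hiff
  classical
  simp only [Set.indicator_apply, Set.mem_ofPred_eq, hsym, hiff]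

theorem unnormalizedPosterior_le (hG : G.PosDef) (hS : G * G = sampleCov Y)
    (hosc : LogOscBound π G b τ) {E : Set (SymCoord p)} (hE : MeasurableSet E) :
    unnormalizedPosterior π Y E ≤ ENNReal.ofReal |LinearMap.det (congrMap G)| *
      (ENNReal.ofReal (Real.exp (logLik Y (sampleCov Y)) * π (G * G) * Real.exp (b * p * τ / 2)) *
        steinMeasure p (n - b / τ) {x | congrMap G x ∈ E}) := by
  have hE' : MeasurableSet {x | congrMap G x ∈ E} :=
    (LinearMap.continuous_of_finiteDimensional (congrMap G)).measurable hE
  have h0 : 0 < π (G * G) := by simpa using (hosc 1 PosDef.one).1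
  rw [unnormalizedPosterior_apply hG hE, steinMeasure, withDensity_apply _ hE',
    ← lintegral_const_mul' (ENNReal.ofReal (Real.exp (logLik Y (sampleCov Y)) * π (G * G) *
      Real.exp (b * p * τ / 2))) _ ENNReal.ofReal_ne_top]
  refine mul_le_mul_right (lintegral_mono fun x => ?_) _
  by_cases h2 : (symMat x).PosDef
  · rw [steinDensity, Set.indicator_of_mem (by exact h2), Set.indicator_of_mem (by exact h2),
      ← ENNReal.ofReal_mul (by positivity)]
    exact ENNReal.ofReal_le_ofReal (likelihood_mul_prior_bounds hG hS hosc h2).1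
  · rw [Set.indicator_of_notMem (by exact h2)]
    exact bot_le

/-- The natural lower bound has `n + b / τ` degrees of freedom. Where `A⁻¹` is `t`-close to the
identity the loss is at most `2 p t²`, so these can be lowered to `n - b / τ` at the price `exp (-(b
/ τ) * 2 p t²)`. Numerator and denominator then refer to the same Stein measure. -/
theorem le_unnormalizedPosterior_univ (hb : 0 ≤ b) (hτ : 0 < τ) (hG : G.PosDef)
    (hS : G * G = sampleCov Y) (hosc : LogOscBound π G b τ) {t : ℝ} (ht : t ≤ 1 / 2) :
    ENNReal.ofReal |LinearMap.det (congrMap G)| *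
      (ENNReal.ofReal (Real.exp (logLik Y (sampleCov Y)) * π (G * G) *
          Real.exp (-(b * p * τ / 2) - b / τ * (p * (2 * t ^ 2)))) *
        steinMeasure p (n - b / τ) {x | specNorm ((symMat x)⁻¹ - 1) ≤ t})
      ≤ unnormalizedPosterior π Y Set.univ := by
  have h0 : 0 < π (G * G) := by simpa using (hosc 1 PosDef.one).1
  have hm : MeasurableSet {x : SymCoord p | specNorm ((symMat x)⁻¹ - 1) ≤ t} :=
    measurableSet_le measurable_specNorm_inv_sub_one measurable_const
  rw [unnormalizedPosterior_apply hG MeasurableSet.univ, steinMeasure, withDensity_apply _ hm,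
    ← lintegral_const_mul' (ENNReal.ofReal (Real.exp (logLik Y (sampleCov Y)) * π (G * G) *
      Real.exp (-(b * p * τ / 2) - b / τ * (p * (2 * t ^ 2))))) _ ENNReal.ofReal_ne_top]
  have huniv : {x | congrMap G x ∈ Set.univ} = Set.univ := by ext; simp
  rw [huniv, Measure.restrict_univ]
  refine mul_le_mul_right (le_trans (setLIntegral_mono' hm fun x hx => ?_)
    (setLIntegral_le_lintegral _ _)) _
  by_cases h2 : (symMat x).PosDef
  · rw [steinDensity, Set.indicator_of_mem (by exact h2), Set.indicator_of_mem (by exact h2),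
      ← ENNReal.ofReal_mul (by positivity)]
    refine ENNReal.ofReal_le_ofReal
      (le_trans ?_ (likelihood_mul_prior_bounds hG hS hosc h2).2)
    rw [mul_assoc, mul_assoc (_ * _), ← Real.exp_add, ← Real.exp_add]
    refine mul_le_mul_of_nonneg_left (Real.exp_le_exp.2 ?_) (by positivity)
    have h3 := steinLoss_le_of_near_one h2 ht hx
    have h4 : 0 ≤ b / τ := by positivity
    nlinarith [mul_le_mul_of_nonneg_left h3 h4]
  · rw [steinDensity, Set.indicator_of_notMem (by exact h2), mul_zero]
    exact bot_le

/-- The upper bound for a set is divided by the lower bound for the total mass. The likelihood at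
`S`, the prior at `S`, the Jacobian and the mass of the Stein measure all cancel; the factor `2`
pays for a neighbourhood of the identity holding half of that mass. -/
theorem posterior_comparison (hb : 0 ≤ b) (hτ : 0 < τ) (hG : G.PosDef)
    (hS : G * G = sampleCov Y) (hosc : LogOscBound π G b τ) {t : ℝ} (ht : t ≤ 1 / 2)
    (hfin : steinMeasure p (n - b / τ) Set.univ < ∞)
    (hhalf : steinMeasure p (n - b / τ) {x | t < specNorm ((symMat x)⁻¹ - 1)} ≤
      ENNReal.ofReal (1 / 2) * steinMeasure p (n - b / τ) Set.univ) :
    IsProbabilityMeasure (posterior π Y) ∧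
      ∀ E : Set (SymCoord p), MeasurableSet E → ∀ r : ℝ≥0∞,
        steinMeasure p (n - b / τ) {x | congrMap G x ∈ E} ≤
          r * steinMeasure p (n - b / τ) Set.univ →
        posterior π Y E ≤
          ENNReal.ofReal (2 * Real.exp (b * p * τ + b / τ * (p * (2 * t ^ 2)))) * r := by
  set ρ := steinMeasure p (n - b / τ) with hρ
  set J := ENNReal.ofReal |LinearMap.det (congrMap G)| with hJ
  have hJ0 : J ≠ 0 := (ENNReal.ofReal_pos.2
    (abs_pos.2 (det_congrMap_ne_zero (PosDef.isUnit_det hG)))).ne'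
  have h0 : 0 < π (G * G) := by simpa using (hosc 1 PosDef.one).1
  set C := Real.exp (logLik Y (sampleCov Y)) * π (G * G) with hC
  have hC0 : 0 < C := mul_pos (Real.exp_pos _) h0
  have hpos : 0 < ρ Set.univ := steinMeasure_univ_pos _
  have hgood : ENNReal.ofReal (1 / 2) * ρ Set.univ ≤
      ρ {x | specNorm ((symMat x)⁻¹ - 1) ≤ t} := by
    have h1 : ρ Set.univ ≤ ρ {x | t < specNorm ((symMat x)⁻¹ - 1)} +
        ρ {x | specNorm ((symMat x)⁻¹ - 1) ≤ t} := by
      refine le_trans (measure_mono fun x _ => ?_) (measure_union_le _ _)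
      exact lt_or_ge t (specNorm ((symMat x)⁻¹ - 1))
    have h2 : ρ Set.univ = ENNReal.ofReal (1 / 2) * ρ Set.univ
        + ENNReal.ofReal (1 / 2) * ρ Set.univ := by
      rw [← add_mul, ← ENNReal.ofReal_add (by norm_num) (by norm_num)]
      norm_num
    have h3 : ENNReal.ofReal (1 / 2) * ρ Set.univ ≠ ∞ :=
      (ENNReal.mul_lt_top ENNReal.ofReal_lt_top hfin).ne
    have h4 := h1.trans (add_le_add_left hhalf _)
    conv_lhs at h4 => rw [h2]
    exact (ENNReal.add_le_add_iff_left h3).1 h4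
  have hlow : J * (ENNReal.ofReal (C *
      Real.exp (-(b * p * τ / 2) - b / τ * (p * (2 * t ^ 2)))) *
        (ENNReal.ofReal (1 / 2) * ρ Set.univ)) ≤ unnormalizedPosterior π Y Set.univ := by
    refine le_trans ?_ (le_unnormalizedPosterior_univ hb hτ hG hS hosc ht)
    gcongr
  have hne0 : unnormalizedPosterior π Y Set.univ ≠ 0 := by
    refine (lt_of_lt_of_le ?_ hlow).ne'
    refine ENNReal.mul_pos hJ0 (ENNReal.mul_pos ?_ (ENNReal.mul_pos ?_ hpos.ne').ne').ne'
    · exact (ENNReal.ofReal_pos.2 (by positivity)).ne'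
    · exact (ENNReal.ofReal_pos.2 (by norm_num)).ne'
  have hnetop : unnormalizedPosterior π Y Set.univ ≠ ∞ := by
    refine ne_top_of_le_ne_top ?_
      (unnormalizedPosterior_le hG hS hosc MeasurableSet.univ)
    refine ENNReal.mul_ne_top ENNReal.ofReal_ne_top
      (ENNReal.mul_ne_top ENNReal.ofReal_ne_top ?_)
    exact ne_top_of_le_ne_top hfin.ne (measure_mono (Set.subset_univ _))
  refine ⟨⟨?_⟩, fun E hE r hr => ?_⟩
  · rw [posterior, Measure.smul_apply, smul_eq_mul, ENNReal.inv_mul_cancel hne0 hnetop]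
  · rw [posterior, Measure.smul_apply, smul_eq_mul, mul_comm, ← div_eq_mul_inv]
    refine ENNReal.div_le_of_le_mul ?_
    calc unnormalizedPosterior π Y E
        ≤ J * (ENNReal.ofReal (C * Real.exp (b * p * τ / 2)) * ρ {x | congrMap G x ∈ E}) :=
          unnormalizedPosterior_le hG hS hosc hE
      _ ≤ J * (ENNReal.ofReal (C * Real.exp (b * p * τ / 2)) * (r * ρ Set.univ)) := by gcongr
      _ = ENNReal.ofReal (2 * Real.exp (b * p * τ + b / τ * (p * (2 * t ^ 2)))) * r *
            (J * (ENNReal.ofReal (C *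
              Real.exp (-(b * p * τ / 2) - b / τ * (p * (2 * t ^ 2)))) *
                (ENNReal.ofReal (1 / 2) * ρ Set.univ))) := by
          have : C * Real.exp (b * p * τ / 2) =
              2 * Real.exp (b * p * τ + b / τ * (p * (2 * t ^ 2))) *
                (C * Real.exp (-(b * p * τ / 2) - b / τ * (p * (2 * t ^ 2)))) * (1 / 2) := by
            have : Real.exp (b * p * τ / 2) = Real.exp (b * p * τ + b / τ * (p * (2 * t ^ 2))) *
                Real.exp (-(b * p * τ / 2) - b / τ * (p * (2 * t ^ 2))) := by
              rw [← Real.exp_add]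
              ring_nf
            rw [this]
            ring
          rw [this, ENNReal.ofReal_mul (by positivity), ENNReal.ofReal_mul (by positivity)]
          ring
      _ ≤ _ := by gcongr

end Comparison

/-- Otherwise both terms of `G A G - A₀ = G (A - 1) G + (G G - A₀)` are at most `ε / 2`. The
threshold is set by `2 / k * (2 * (k ε / 8)) = ε / 2`. -/
theorem specNorm_inv_sub_one_gt {p : ℕ} {A G A₀ : Mat p} (hA : A.PosDef) (hG : G.PosDef)
    {k ε : ℝ} (hk : 0 < k) (hS : specNorm (G * G) ≤ 2 / k)
    (hS0 : specNorm (G * G - A₀) ≤ ε / 2) (hε : k * ε / 8 ≤ 1 / 2)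
    (h : ε < specNorm (G * A * G - A₀)) : k * ε / 8 < specNorm (A⁻¹ - 1) := by
  by_contra! hcon
  have h1 := specNorm_sub_one_le hA hε hcon
  have h2 : G * A * G - A₀ = G * (A - 1) * G + (G * G - A₀) := by
    rw [mul_sub, sub_mul, mul_one]
    abel
  have h3 := specNorm_symm_conj_le (PosDef.transpose_eq hG) (A - 1)
  have h4 := specNorm_add_le (G * (A - 1) * G) (G * G - A₀)
  rw [← h2] at h4
  have h5 : specNorm (G * G) * specNorm (A - 1) ≤ 2 / k * (2 * (k * ε / 8)) :=
    mul_le_mul hS h1 (specNorm_nonneg _) (by positivity)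
  have h6 : 2 / k * (2 * (k * ε / 8)) = ε / 2 := by field_simp; ring
  linarith

theorem posteriorTail_le {n p : ℕ} {Y : Data n p} {π : Mat p → ℝ} {G A₀ : Mat p} {b τ : ℝ}
    (hb : 0 ≤ b) (hτ : 0 < τ) (hG : G.PosDef) (hS : G * G = sampleCov Y)
    (hosc : LogOscBound π G b τ) {t₁ : ℝ} (ht₁0 : 0 < t₁) (ht₁ : 32 * t₁ ≤ 1 / 2)
    (hfin : steinMeasure p (n - b / τ) Set.univ < ∞) (hN : (p : ℝ) + 1 ≤ n - b / τ)
    (hhalf : 2 * 5 ^ p * Real.exp (-((n - b / τ) * t₁ ^ 2 / 16) + (p + 1) * t₁ / 8) ≤ 1 / 2)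
    {k ε : ℝ} (hk : 0 < k) (hSn : specNorm (G * G) ≤ 2 / k)
    (hS0 : specNorm (G * G - A₀) ≤ ε / 2) (hε0 : 0 < ε) (hε : k * ε / 8 ≤ 1 / 2) :
    IsProbabilityMeasure (posterior π Y) ∧
    posteriorTail π Y A₀ ε ≤
      ENNReal.ofReal (2 * Real.exp (b * p * τ + b / τ * (p * (2 * (32 * t₁) ^ 2))) *
        (2 * 5 ^ p * Real.exp (-((n - b / τ) * (k * ε / 256) ^ 2 / 16)
          + (p + 1) * (k * ε / 256) / 8))) := by
  have hconv : ∀ c : ℝ, (2 : ℝ≥0∞) * 5 ^ p * ENNReal.ofReal (Real.exp c)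
      = ENNReal.ofReal (2 * 5 ^ p * Real.exp c) := by
    intro c
    rw [ENNReal.ofReal_mul (by positivity), ENNReal.ofReal_mul (by positivity),
      ENNReal.ofReal_pow (by positivity)]
    norm_num
  have h1 := steinMeasure_tail hN ht₁0 (by linarith)
  rw [hconv] at h1
  obtain ⟨hprob, hcmp⟩ := posterior_comparison hb hτ hG hS hosc ht₁ hfin
    (h1.trans (by gcongr))
  refine ⟨hprob, ?_⟩
  have hεpos : 0 < k * ε := mul_pos hk hε0
  -- The radius is `(k * ε / 8) / 32`, the `32` being the loss in passing from the net to the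
  -- spectral norm.
  have h2 := steinMeasure_tail hN (t := k * ε / 256) (by positivity) (by linarith)
  rw [hconv] at h2
  rw [posteriorTail, ENNReal.ofReal_mul (by positivity)]
  refine hcmp _ (measurableSet_specNorm_sub_gt ε A₀) _ (le_trans ?_ h2)
  have h3 : {x | congrMap G x ∈ {x : SymCoord p | ε < specNorm (symMat x - A₀)}} ⊆
      {x | 32 * (k * ε / 256) < specNorm ((symMat x)⁻¹ - 1)} ∪ {x | ¬ (symMat x).PosDef} := by
    intro x hx
    have hx' : ε < specNorm (symMat (congrMap G x) - A₀) := hx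
    rw [symMat_congrMap, PosDef.transpose_eq hG] at hx'
    by_cases hpd : (symMat x).PosDef
    · left
      have := specNorm_inv_sub_one_gt hpd hG hk hSn hS0 hε hx'
      change 32 * (k * ε / 256) < specNorm ((symMat x)⁻¹ - 1)
      linarith
    · exact Or.inr hpd
  refine (measure_mono h3).trans ((measure_union_le _ _).trans_eq ?_)
  rw [steinMeasure_not_posDef, add_zero]

/-! ### Eigenvalue bounds -/

theorem quadForm_bounds {p : ℕ} {A : Mat p} (hA : A.IsHermitian) {a b : ℝ}
    (h : ∀ i, a ≤ hA.eigenvalues i ∧ hA.eigenvalues i ≤ b) (w : Fin p → ℝ) :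
    a * (w ⬝ᵥ w) ≤ w ⬝ᵥ A *ᵥ w ∧ w ⬝ᵥ A *ᵥ w ≤ b * (w ⬝ᵥ w) := by
  obtain ⟨U, h1, h2, h3⟩ := hA.exists_orthogonal_conj
  have e1 : A - a • 1 = U * diagonal (fun i => hA.eigenvalues i - a) * Uᵀ := by
    rw [← diagonal_sub, mul_sub, sub_mul, ← h3, ← smul_one_eq_diagonal, mul_smul_comm, mul_one,
      smul_mul_assoc, h2]
  have e2 : b • 1 - A = U * diagonal (fun i => b - hA.eigenvalues i) * Uᵀ := by
    rw [← diagonal_sub, mul_sub, sub_mul, ← h3, ← smul_one_eq_diagonal, mul_smul_comm, mul_one,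
      smul_mul_assoc, h2]
  have p1 := (PosSemidef.conj (PosSemidef.diagonal fun i => sub_nonneg.2 (h i).1)
    U).dotProduct_mulVec_nonneg w
  have p2 := (PosSemidef.conj (PosSemidef.diagonal fun i => sub_nonneg.2 (h i).2)
    U).dotProduct_mulVec_nonneg w
  rw [← e1] at p1
  rw [← e2] at p2
  simp only [star_trivial, sub_mulVec, smul_mulVec, one_mulVec, dotProduct_sub, dotProduct_smul,
    smul_eq_mul] at p1 p2
  constructor <;> linarith

theorem EigenvaluesBounded.posDef {p : ℕ} {k : ℝ} (hk : 0 < k) {A : Mat p}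
    (h : EigenvaluesBounded k A) : A.PosDef := by
  obtain ⟨hA, h⟩ := h
  exact hA.posDef_iff_eigenvalues_pos.2 fun i => hk.trans_le (h i).1

theorem EigenvaluesBounded.quadForm {p : ℕ} {k : ℝ} {A : Mat p} (h : EigenvaluesBounded k A)
    (w : Fin p → ℝ) : k * (w ⬝ᵥ w) ≤ w ⬝ᵥ A *ᵥ w ∧ w ⬝ᵥ A *ᵥ w ≤ 1 / k * (w ⬝ᵥ w) := by
  obtain ⟨hA, h⟩ := h
  exact quadForm_bounds hA h w

theorem EigenvaluesBounded.specNorm_le {p : ℕ} {k : ℝ} (hk : 0 < k) {A : Mat p}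
    (h : EigenvaluesBounded k A) : specNorm A ≤ 1 / k := by
  obtain ⟨hA, h⟩ := h
  obtain ⟨U, h1, h2, h3⟩ := hA.exists_orthogonal_conj
  conv_lhs => rw [h3]
  have := specNorm_conj_le (U := Uᵀ) (by simpa using h2) (diagonal hA.eigenvalues)
  rw [transpose_transpose, specNorm_diagonal] at this
  refine this.trans ((pi_norm_le_iff_of_nonneg (by positivity)).2 fun i => ?_)
  rw [Real.norm_of_nonneg (hk.le.trans (h i).1)]
  exact (h i).2

/-! ### Moments of one-dimensional projections -/

section Law

variable {p : ℕ} {k σ₀ : ℝ} {μ : Measure (EuclideanSpace ℝ (Fin p))}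

theorem continuous_projection (w : Fin p → ℝ) :
    Continuous fun y : EuclideanSpace ℝ (Fin p) => w ⬝ᵥ y.ofLp :=
  continuous_const.dotProduct (PiLp.continuous_ofLp 2 _)

/-- With `G` the square root of the covariance, `w · y = (G w) · (G⁻¹ y)`. The norm of `G w` is at
most `1 / √k`, and the sub-Gaussian hypothesis applies to the normalised direction. -/
theorem eLpNorm_projection_le (hk : 0 < k) (hσ₀ : 0 < σ₀) (hμ : IsAdmissibleLaw k σ₀ μ)
    {w : Fin p → ℝ} (hw : w ⬝ᵥ w = 1) {q : ℝ} (hq : 1 ≤ q) :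
    eLpNorm (fun y => w ⬝ᵥ y.ofLp) (ENNReal.ofReal q) μ ≤ ENNReal.ofReal (σ₀ / √k * √q) := by
  obtain ⟨G, hG, hGG, hinv⟩ := exists_posDef_sqrt_inv_eq (hμ.eigenvalues.posDef hk)
  have hGt := PosDef.transpose_eq hG
  have hq0 : 0 < q := by linarith
  set v := G *ᵥ w with hv
  have hvv : v ⬝ᵥ v = w ⬝ᵥ covMatrix μ *ᵥ w := by
    rw [← hGG, ← mulVec_mulVec, dotProduct_mulVec w, ← mulVec_transpose, hGt]
  have hub : v ⬝ᵥ v ≤ 1 / k := by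
    rw [hvv]
    simpa [hw] using (hμ.eigenvalues.quadForm w).2
  have hlb : 0 < v ⬝ᵥ v := by
    rw [hvv]
    have := (hμ.eigenvalues.quadForm w).1
    rw [hw] at this
    linarith
  set r := √(v ⬝ᵥ v) with hr
  have hr0 : 0 < r := Real.sqrt_pos.2 hlb
  have hrr : r * r = v ⬝ᵥ v := Real.mul_self_sqrt hlb.le
  set u : EuclideanSpace ℝ (Fin p) := WithLp.toLp 2 (r⁻¹ • v) with hu
  have hu1 : ‖u‖ = 1 := by
    have : ‖u‖ ^ 2 = 1 := by
      rw [euclidean_norm_sq, hu]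
      simp only [smul_dotProduct, dotProduct_smul, smul_eq_mul, ← hrr]
      field_simp
    nlinarith [norm_nonneg u]
  have h1 : (fun y : EuclideanSpace ℝ (Fin p) => w ⬝ᵥ y.ofLp)
      = r • fun y => ∑ i, u i * (invSqrt (covMatrix μ) *ᵥ fun i => y i) i := by
    funext y
    have e1 : ∑ i, u i * (invSqrt (covMatrix μ) *ᵥ fun i => y i) i
        = r⁻¹ * (v ⬝ᵥ G⁻¹ *ᵥ y.ofLp) := by
      rw [hinv, dotProduct, Finset.mul_sum]
      refine Finset.sum_congr rfl fun i _ => ?_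
      simp only [hu, Pi.smul_apply, smul_eq_mul]
      ring
    have e2 : v ⬝ᵥ G⁻¹ *ᵥ y.ofLp = w ⬝ᵥ y.ofLp := by
      rw [hv, ← vecMul_transpose, hGt, ← dotProduct_mulVec, mulVec_mulVec,
        mul_nonsing_inv _ (PosDef.isUnit_det hG), one_mulVec]
    rw [Pi.smul_apply, e1, e2, smul_eq_mul, mul_inv_cancel_left₀ hr0.ne']
  have h2 : ENNReal.ofReal (q ^ (-(1 / 2) : ℝ)) *
      eLpNorm (fun y => ∑ i, u i * (invSqrt (covMatrix μ) *ᵥ fun i => y i) i)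
        (ENNReal.ofReal q) μ ≤ ENNReal.ofReal σ₀ := by
    refine le_trans ?_ hμ.subGaussian
    rw [vecSubGaussianNorm]
    refine le_trans ?_ (le_iSup₂ u hu1)
    rw [subGaussianNorm]
    exact le_iSup₂ (f := fun (q : ℝ) (_ : 1 ≤ q) => ENNReal.ofReal (q ^ (-(1 / 2) : ℝ)) *
      eLpNorm (fun y => ∑ i, u i * (invSqrt (covMatrix μ) *ᵥ fun i => y i) i)
        (ENNReal.ofReal q) μ) q hq
  have hsq : 0 < √q := Real.sqrt_pos.2 hq0
  have hqpow : q ^ (-(1 / 2) : ℝ) = (√q)⁻¹ := by rw [Real.rpow_neg hq0.le, Real.sqrt_eq_rpow]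
  have h3 : eLpNorm (fun y => ∑ i, u i * (invSqrt (covMatrix μ) *ᵥ fun i => y i) i)
        (ENNReal.ofReal q) μ ≤ ENNReal.ofReal (√q * σ₀) := by
    rw [ENNReal.ofReal_mul hsq.le]
    refine le_trans (le_of_eq ?_) (mul_le_mul_right h2 _)
    rw [← mul_assoc, ← ENNReal.ofReal_mul hsq.le, hqpow, mul_inv_cancel₀ hsq.ne',
      ENNReal.ofReal_one, one_mul]
  have hrk : r ≤ 1 / √k := by
    rw [hr]
    refine (Real.sqrt_le_sqrt hub).trans_eq ?_
    rw [Real.sqrt_div zero_le_one, Real.sqrt_one]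
  rw [h1, eLpNorm_const_smul, Real.enorm_of_nonneg hr0.le]
  calc ENNReal.ofReal r * _ ≤ ENNReal.ofReal r * ENNReal.ofReal (√q * σ₀) := mul_le_mul_right h3 _
    _ = ENNReal.ofReal (r * (√q * σ₀)) := (ENNReal.ofReal_mul hr0.le).symm
    _ ≤ ENNReal.ofReal (1 / √k * (√q * σ₀)) := by gcongr
    _ = _ := by congr 1; ring

theorem lintegral_projection_pow_le (hk : 0 < k) (hσ₀ : 0 < σ₀) (hμ : IsAdmissibleLaw k σ₀ μ)
    {w : Fin p → ℝ} (hw : w ⬝ᵥ w = 1) {m : ℕ} (hm : 1 ≤ m) :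
    ∫⁻ y, ENNReal.ofReal (((w ⬝ᵥ y.ofLp) ^ 2) ^ m) ∂μ ≤
      ENNReal.ofReal ((σ₀ ^ 2 / k * (2 * m)) ^ m) := by
  have hm' : (1 : ℝ) ≤ m := by exact_mod_cast hm
  have hq : (1 : ℝ) ≤ 2 * m := by linarith
  have hq0 : (0 : ℝ) < 2 * m := by linarith
  have h := eLpNorm_projection_le hk hσ₀ hμ hw hq
  rw [eLpNorm_eq_lintegral_rpow_enorm_toReal (ENNReal.ofReal_pos.2 hq0).ne' ENNReal.ofReal_ne_top,
    ENNReal.toReal_ofReal hq0.le, one_div, ENNReal.rpow_inv_le_iff hq0] at h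
  have e1 : ∀ y : EuclideanSpace ℝ (Fin p), ENNReal.ofReal (((w ⬝ᵥ y.ofLp) ^ 2) ^ m)
      = ‖w ⬝ᵥ y.ofLp‖ₑ ^ (2 * m : ℝ) := by
    intro y
    rw [← pow_mul, ← (even_two_mul m).pow_abs, ENNReal.ofReal_pow (abs_nonneg _),
      ← Real.enorm_eq_ofReal_abs, ← ENNReal.rpow_natCast]
    push_cast
    rfl
  simp only [e1]
  refine h.trans_eq ?_
  rw [ENNReal.ofReal_rpow_of_nonneg (by positivity) hq0.le]
  congr 1
  have : (2 * m : ℝ) = ((2 * m : ℕ) : ℝ) := by push_cast; rfl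
  rw [this, Real.rpow_natCast, pow_mul, mul_pow, div_pow, Real.sq_sqrt hk.le,
    Real.sq_sqrt (by positivity)]

theorem integrable_projection_sq (hk : 0 < k) (hσ₀ : 0 < σ₀) (hμ : IsAdmissibleLaw k σ₀ μ)
    {w : Fin p → ℝ} (hw : w ⬝ᵥ w = 1) : Integrable (fun y => (w ⬝ᵥ y.ofLp) ^ 2) μ := by
  refine ⟨((continuous_projection w).pow 2).aestronglyMeasurable, ?_⟩
  rw [hasFiniteIntegral_iff_ofReal (ae_of_all _ fun y => sq_nonneg _)]
  have := lintegral_projection_pow_le hk hσ₀ hμ hw le_rfl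
  simp only [pow_one] at this
  exact this.trans_lt ENNReal.ofReal_lt_top

theorem memLp_coord (hk : 0 < k) (hσ₀ : 0 < σ₀) (hμ : IsAdmissibleLaw k σ₀ μ) (i : Fin p) :
    MemLp (fun y : EuclideanSpace ℝ (Fin p) => y i) 2 μ := by
  have h := integrable_projection_sq hk hσ₀ hμ (w := Pi.single i 1) (by simp)
  simp only [single_one_dotProduct] at h
  refine (memLp_two_iff_integrable_sq ?_).2 h
  simpa using (continuous_projection (Pi.single i 1)).aestronglyMeasurable (μ := μ)

theorem integral_projection_sq (hk : 0 < k) (hσ₀ : 0 < σ₀) (hμ : IsAdmissibleLaw k σ₀ μ)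
    (w : Fin p → ℝ) : ∫ y, (w ⬝ᵥ y.ofLp) ^ 2 ∂μ = w ⬝ᵥ covMatrix μ *ᵥ w := by
  have hint : ∀ i j, Integrable (fun y : EuclideanSpace ℝ (Fin p) => y i * y j) μ := fun i j =>
    (memLp_coord hk hσ₀ hμ i).integrable_mul (memLp_coord hk hσ₀ hμ j)
  have hcov : ∀ i j, covMatrix μ i j = ∫ y, y i * y j ∂μ := by
    intro i j
    change covariance (fun y : EuclideanSpace ℝ (Fin p) => y i) (fun y => y j) μ = _
    rw [covariance, hμ.mean_zero, hμ.mean_zero]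
    simp
  have e1 : ∀ y : EuclideanSpace ℝ (Fin p), (w ⬝ᵥ y.ofLp) ^ 2
      = ∑ i, ∑ j, w i * w j * (y i * y j) := by
    intro y
    rw [sq, dotProduct, Finset.sum_mul_sum]
    exact Finset.sum_congr rfl fun i _ => Finset.sum_congr rfl fun j _ => by ring
  simp only [e1]
  rw [integral_finsetSum _ fun i _ => integrable_finsetSum _ fun j _ => (hint i j).const_mul _]
  rw [dotProduct]
  refine Finset.sum_congr rfl fun i _ => ?_
  rw [integral_finsetSum _ fun j _ => (hint i j).const_mul _, mulVec, dotProduct, Finset.mul_sum]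
  refine Finset.sum_congr rfl fun j _ => ?_
  rw [integral_const_mul, hcov]
  ring

/-! ### Exponential moments -/

theorem hasSum_exp_sub_two_terms (x : ℝ) :
    HasSum (fun m : ℕ => x ^ (m + 2) / (m + 2).factorial) (Real.exp x - 1 - x) := by
  have h := NormedSpace.expSeries_div_hasSum_exp x
  rw [← Real.exp_eq_exp_ℝ] at h
  have := (hasSum_nat_add_iff' 2).2 h
  simpa [Finset.sum_range_succ, sub_sub] using this

/-- The power series are compared termwise from order two on. Keeping the linear term exact lets the
true variance appear after integration; only the remainder is bounded by absolute moments. -/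
theorem exp_le_one_add_add_abs (x : ℝ) : Real.exp x ≤ 1 + x + (Real.exp |x| - 1 - |x|) := by
  have h1 := hasSum_exp_sub_two_terms x
  have h2 := hasSum_exp_sub_two_terms |x|
  have := hasSum_le (fun m => ?_) h1 h2
  · linarith
  · rw [← abs_pow]
    gcongr
    exact le_abs_self _

theorem natCast_pow_le_exp_mul_factorial (m : ℕ) :
    (m : ℝ) ^ m / m.factorial ≤ Real.exp 1 ^ m := by
  have := Real.pow_div_factorial_le_exp (x := m) (Nat.cast_nonneg m) m
  rwa [← Real.exp_one_rpow (m : ℝ), Real.rpow_natCast] at this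

/-- The moments of order `m` grow like `m ^ m`, and `m ^ m / m! ≤ e ^ m`. The series is therefore
dominated by a geometric one of ratio `c ≤ 1 / 2`, starting at `c ^ 2`. -/
theorem lintegral_exp_remainder_le (hk : 0 < k) (hσ₀ : 0 < σ₀) (hμ : IsAdmissibleLaw k σ₀ μ)
    {w : Fin p → ℝ} (hw : w ⬝ᵥ w = 1) {l : ℝ}
    (hl : 2 * Real.exp 1 * (σ₀ ^ 2 / k) * |l| ≤ 1 / 2) :
    ∫⁻ y, ENNReal.ofReal (Real.exp |l * (w ⬝ᵥ y.ofLp) ^ 2| - 1 - |l * (w ⬝ᵥ y.ofLp) ^ 2|) ∂μ ≤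
      ENNReal.ofReal (2 * (2 * Real.exp 1 * (σ₀ ^ 2 / k) * |l|) ^ 2) := by
  set c := 2 * Real.exp 1 * (σ₀ ^ 2 / k) * |l| with hc
  have hc0 : 0 ≤ c := by positivity
  have e1 : ∀ y : EuclideanSpace ℝ (Fin p),
      ENNReal.ofReal (Real.exp |l * (w ⬝ᵥ y.ofLp) ^ 2| - 1 - |l * (w ⬝ᵥ y.ofLp) ^ 2|) =
        ∑' m : ℕ, ENNReal.ofReal (|l| ^ (m + 2) / (m + 2).factorial) *
          ENNReal.ofReal (((w ⬝ᵥ y.ofLp) ^ 2) ^ (m + 2)) := by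
    intro y
    have h := hasSum_exp_sub_two_terms |l * (w ⬝ᵥ y.ofLp) ^ 2|
    rw [← h.tsum_eq, ENNReal.ofReal_tsum_of_nonneg (fun m => by positivity) h.summable]
    refine tsum_congr fun m => ?_
    rw [← ENNReal.ofReal_mul (by positivity), abs_mul, abs_of_nonneg (sq_nonneg (w ⬝ᵥ y.ofLp)),
      mul_pow]
    congr 1
    ring
  simp only [e1]
  rw [lintegral_tsum fun m => (Measurable.aemeasurable (by
    refine Measurable.const_mul ?_ _
    exact (((continuous_projection w).pow 2).pow (m + 2)).measurable.ennreal_ofReal))]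
  have hterm : ∀ m : ℕ, ∫⁻ y, ENNReal.ofReal (|l| ^ (m + 2) / (m + 2).factorial) *
      ENNReal.ofReal (((w ⬝ᵥ y.ofLp) ^ 2) ^ (m + 2)) ∂μ ≤ ENNReal.ofReal (c ^ 2 * c ^ m) := by
    intro m
    rw [lintegral_const_mul' _ _ ENNReal.ofReal_ne_top]
    refine (mul_le_mul_right (lintegral_projection_pow_le hk hσ₀ hμ hw (by omega)) _).trans ?_
    rw [← ENNReal.ofReal_mul (by positivity)]
    apply ENNReal.ofReal_le_ofReal
    have h2 := natCast_pow_le_exp_mul_factorial (m + 2)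
    calc |l| ^ (m + 2) / (m + 2).factorial * (σ₀ ^ 2 / k * (2 * ((m + 2 : ℕ) : ℝ))) ^ (m + 2)
        = (2 * (σ₀ ^ 2 / k) * |l|) ^ (m + 2) *
            (((m + 2 : ℕ) : ℝ) ^ (m + 2) / (m + 2).factorial) := by
          rw [show σ₀ ^ 2 / k * (2 * ((m + 2 : ℕ) : ℝ))
            = (2 * (σ₀ ^ 2 / k)) * ((m + 2 : ℕ) : ℝ) by ring, mul_pow, mul_pow _ |l|]
          ring
      _ ≤ (2 * (σ₀ ^ 2 / k) * |l|) ^ (m + 2) * Real.exp 1 ^ (m + 2) := by gcongr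
      _ = c ^ 2 * c ^ m := by
          rw [← mul_pow, hc]
          ring
  refine (ENNReal.tsum_le_tsum hterm).trans ?_
  have hgeo := (hasSum_geometric_of_lt_one hc0 (by linarith)).mul_left (c ^ 2)
  rw [← ENNReal.ofReal_tsum_of_nonneg (fun m => by positivity) hgeo.summable, hgeo.tsum_eq]
  apply ENNReal.ofReal_le_ofReal
  have : (1 - c)⁻¹ ≤ 2 := by
    rw [inv_le_comm₀ (by linarith) (by norm_num)]
    linarith
  nlinarith [sq_nonneg c]

theorem integrable_exp_projection_sq (hk : 0 < k) (hσ₀ : 0 < σ₀) (hμ : IsAdmissibleLaw k σ₀ μ)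
    {w : Fin p → ℝ} (hw : w ⬝ᵥ w = 1) {l : ℝ}
    (hl : 2 * Real.exp 1 * (σ₀ ^ 2 / k) * |l| ≤ 1 / 2) :
    Integrable (fun y => Real.exp (l * (w ⬝ᵥ y.ofLp) ^ 2)) μ ∧
    ∫ y, Real.exp (l * (w ⬝ᵥ y.ofLp) ^ 2) ∂μ ≤ Real.exp (l * (w ⬝ᵥ covMatrix μ *ᵥ w) +
      2 * (2 * Real.exp 1 * (σ₀ ^ 2 / k) * |l|) ^ 2) := by
  have := hμ.prob
  set R : EuclideanSpace ℝ (Fin p) → ℝ := fun y =>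
    Real.exp |l * (w ⬝ᵥ y.ofLp) ^ 2| - 1 - |l * (w ⬝ᵥ y.ofLp) ^ 2| with hR
  have hR0 : ∀ y, 0 ≤ R y := fun y => by
    have := Real.add_one_le_exp |l * (w ⬝ᵥ y.ofLp) ^ 2|
    simp only [hR]
    linarith
  have hcont : Continuous fun y : EuclideanSpace ℝ (Fin p) => l * (w ⬝ᵥ y.ofLp) ^ 2 :=
    continuous_const.mul ((continuous_projection w).pow 2)
  have hRc : Continuous R := ((Real.continuous_exp.comp hcont.abs).sub continuous_const).sub
    hcont.abs
  have hRlin := lintegral_exp_remainder_le hk hσ₀ hμ hw hl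
  have hRint : Integrable R μ := by
    refine ⟨hRc.aestronglyMeasurable, ?_⟩
    rw [hasFiniteIntegral_iff_ofReal (ae_of_all _ hR0)]
    exact hRlin.trans_lt ENNReal.ofReal_lt_top
  have hRle : ∫ y, R y ∂μ ≤ 2 * (2 * Real.exp 1 * (σ₀ ^ 2 / k) * |l|) ^ 2 := by
    rw [integral_eq_lintegral_of_nonneg_ae (ae_of_all _ hR0) hRc.aestronglyMeasurable]
    exact ENNReal.toReal_le_of_le_ofReal (by positivity) hRlin
  have hsq := integrable_projection_sq hk hσ₀ hμ hw
  have hlin : Integrable (fun y => 1 + l * (w ⬝ᵥ y.ofLp) ^ 2) μ :=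
    (integrable_const 1).add (hsq.const_mul l)
  have hdom : Integrable (fun y => 1 + l * (w ⬝ᵥ y.ofLp) ^ 2 + R y) μ := hlin.add hRint
  have hle : ∀ y, Real.exp (l * (w ⬝ᵥ y.ofLp) ^ 2) ≤ 1 + l * (w ⬝ᵥ y.ofLp) ^ 2 + R y :=
    fun y => exp_le_one_add_add_abs _
  have hint : Integrable (fun y => Real.exp (l * (w ⬝ᵥ y.ofLp) ^ 2)) μ := by
    refine hdom.mono' (Real.continuous_exp.comp hcont).aestronglyMeasurable (ae_of_all _ fun y => ?_)
    rw [Real.norm_of_nonneg (Real.exp_pos _).le]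
    exact hle y
  refine ⟨hint, (integral_mono hint hdom hle).trans ?_⟩
  rw [integral_add hlin hRint,
    integral_add (integrable_const 1) (hsq.const_mul l), integral_const_mul,
    integral_projection_sq hk hσ₀ hμ]
  simp only [integral_const, probReal_univ, smul_eq_mul, mul_one]
  have := Real.add_one_le_exp (l * (w ⬝ᵥ covMatrix μ *ᵥ w) +
      2 * (2 * Real.exp 1 * (σ₀ ^ 2 / k) * |l|) ^ 2)
  linarith

end Law

/-! ### Concentration of the sample covariance matrix -/

section Concentration

variable {p : ℕ} {k σ₀ : ℝ} {μ : Measure (EuclideanSpace ℝ (Fin p))}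

theorem quadForm_sampleCov {n : ℕ} (Y : Data n p) (w : Fin p → ℝ) :
    w ⬝ᵥ sampleCov Y *ᵥ w = 1 / (n : ℝ) * ∑ i, (w ⬝ᵥ (Y i).ofLp) ^ 2 := by
  have h : ∀ i, (w ⬝ᵥ (Y i).ofLp) ^ 2 = ∑ a, ∑ b, w a * w b * (Y i a * Y i b) := by
    intro i
    rw [sq, dotProduct, Finset.sum_mul_sum]
    exact Finset.sum_congr rfl fun a _ => Finset.sum_congr rfl fun b _ => by ring
  simp only [h]
  rw [Finset.sum_comm, dotProduct, Finset.mul_sum]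
  refine Finset.sum_congr rfl fun a _ => ?_
  rw [Finset.sum_comm, mulVec, dotProduct, Finset.mul_sum, Finset.mul_sum]
  refine Finset.sum_congr rfl fun b _ => ?_
  rw [sampleCov, of_apply, ← Finset.mul_sum]
  ring

theorem sampleCov_transpose {n : ℕ} (Y : Data n p) : (sampleCov Y)ᵀ = sampleCov Y := by
  ext a b
  simp only [sampleCov, transpose_apply, of_apply, mul_comm (Y _ a)]

theorem isProbabilityMeasure_dataLaw {n : ℕ} (hμ : IsAdmissibleLaw k σ₀ μ) :
    IsProbabilityMeasure (dataLaw n μ) := by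
  have := hμ.prob
  exact inferInstanceAs (IsProbabilityMeasure (Measure.pi fun _ : Fin n => μ))

theorem dataLaw_chernoff (hk : 0 < k) (hσ₀ : 0 < σ₀) (hμ : IsAdmissibleLaw k σ₀ μ)
    {n : ℕ} {w : Fin p → ℝ} (hw : w ⬝ᵥ w = 1) {l a : ℝ}
    (hl : 2 * Real.exp 1 * (σ₀ ^ 2 / k) * |l| ≤ 1 / 2) :
    dataLaw n μ {Y | n * (l * (w ⬝ᵥ covMatrix μ *ᵥ w)) + a ≤ l * ∑ i, (w ⬝ᵥ (Y i).ofLp) ^ 2} ≤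
      ENNReal.ofReal (Real.exp (n * (2 * (2 * Real.exp 1 * (σ₀ ^ 2 / k) * |l|) ^ 2) - a)) := by
  have := hμ.prob
  have := isProbabilityMeasure_dataLaw (n := n) hμ
  obtain ⟨hint, hle⟩ := integrable_exp_projection_sq hk hσ₀ hμ hw hl
  set f : EuclideanSpace ℝ (Fin p) → ℝ := fun y => Real.exp (l * (w ⬝ᵥ y.ofLp) ^ 2) with hf
  have hprod : ∀ Y : Data n p, ∏ i, f (Y i) = Real.exp (l * ∑ i, (w ⬝ᵥ (Y i).ofLp) ^ 2) := by
    intro Y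
    rw [Finset.mul_sum, Real.exp_sum]
  have hintp : Integrable (fun Y : Data n p => ∏ i, f (Y i)) (dataLaw n μ) :=
    Integrable.fintype_prod (f := fun _ : Fin n => f) (fun _ => hint)
  have hval : ∫ Y, ∏ i, f (Y i) ∂(dataLaw n μ) = (∫ y, f y ∂μ) ^ n := by
    have := integral_fintype_prod_eq_pow (ι := Fin n) f (μ := μ)
    rwa [Fintype.card_fin] at this
  set A := n * (l * (w ⬝ᵥ covMatrix μ *ᵥ w)) + a with hA
  have hmk := mul_meas_ge_le_integral_of_nonneg
    (ae_of_all (dataLaw n μ) fun Y : Data n p => Finset.prod_nonneg fun i _ =>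
      (Real.exp_pos (l * (w ⬝ᵥ (Y i).ofLp) ^ 2)).le) hintp (Real.exp A)
  rw [hval] at hmk
  have hpow : (∫ y, f y ∂μ) ^ n ≤ Real.exp (n * (l * (w ⬝ᵥ covMatrix μ *ᵥ w) +
      2 * (2 * Real.exp 1 * (σ₀ ^ 2 / k) * |l|) ^ 2)) := by
    rw [Real.exp_nat_mul]
    exact pow_le_pow_left₀ (integral_nonneg fun y => (Real.exp_pos _).le) hle n
  have hset : {Y : Data n p | A ≤ l * ∑ i, (w ⬝ᵥ (Y i).ofLp) ^ 2}
      = {Y | Real.exp A ≤ ∏ i, f (Y i)} := by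
    ext Y
    change A ≤ _ ↔ Real.exp A ≤ _
    rw [hprod, Real.exp_le_exp]
  rw [hset, ← ofReal_measureReal]
  apply ENNReal.ofReal_le_ofReal
  rw [← mul_le_mul_iff_right₀ (Real.exp_pos A), ← Real.exp_add]
  refine hmk.trans (hpow.trans_eq ?_)
  congr 1
  rw [hA]
  ring

theorem dataLaw_quadForm_tail (hk : 0 < k) (hσ₀ : 0 < σ₀) (hμ : IsAdmissibleLaw k σ₀ μ)
    {n : ℕ} (hn : 0 < n) {w : Fin p → ℝ} (hw : w ⬝ᵥ w = 1) {t : ℝ} (ht0 : 0 < t)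
    (ht : t ≤ 2 * (2 * Real.exp 1 * (σ₀ ^ 2 / k))) :
    dataLaw n μ {Y | t < |w ⬝ᵥ (sampleCov Y - covMatrix μ) *ᵥ w|} ≤
      2 * ENNReal.ofReal
        (Real.exp (-(n * t ^ 2 / (8 * (2 * Real.exp 1 * (σ₀ ^ 2 / k)) ^ 2)))) := by
  set c := 2 * Real.exp 1 * (σ₀ ^ 2 / k) with hc
  have hc0 : 0 < c := by positivity
  have hn0 : (0 : ℝ) < n := by exact_mod_cast hn
  -- The value `t / (4 c²)` of `|l|` minimises the exponent `2 c² l² - |l| t`. The restriction `c *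
  -- |l| ≤ 1 / 2` is then exactly `t ≤ 2 c`.
  have hcl : c * (t / (4 * c ^ 2)) = t / (4 * c) := by field_simp
  have hcl2 : c * (t / (4 * c ^ 2)) ≤ 1 / 2 := by
    rw [hcl, div_le_iff₀ (by positivity)]
    linarith
  have hlpos : 0 < t / (4 * c ^ 2) := by positivity
  have hb : ∀ l : ℝ, |l| = t / (4 * c ^ 2) →
      n * (2 * (c * |l|) ^ 2) - n * (t / (4 * c ^ 2)) * t = -(n * t ^ 2 / (8 * c ^ 2)) := by
    intro l hl
    rw [hl, hcl]
    field_simp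
    ring
  have h1 := dataLaw_chernoff hk hσ₀ hμ (n := n) hw (l := t / (4 * c ^ 2))
    (a := n * (t / (4 * c ^ 2)) * t) (by rw [abs_of_pos hlpos]; exact hcl2)
  have h2 := dataLaw_chernoff hk hσ₀ hμ (n := n) hw (l := -(t / (4 * c ^ 2)))
    (a := n * (t / (4 * c ^ 2)) * t) (by rw [abs_neg, abs_of_pos hlpos]; exact hcl2)
  rw [← hc, hb _ (abs_of_pos hlpos)] at h1
  rw [← hc, hb _ (by rw [abs_neg, abs_of_pos hlpos])] at h2
  rw [two_mul]
  refine (measure_mono fun Y hY => ?_).trans ((measure_union_le _ _).trans (add_le_add h1 h2))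
  have hY' : t < |w ⬝ᵥ (sampleCov Y - covMatrix μ) *ᵥ w| := hY
  rw [sub_mulVec, dotProduct_sub, quadForm_sampleCov, lt_abs] at hY'
  set s := ∑ i, (w ⬝ᵥ (Y i).ofLp) ^ 2 with hs
  set v := w ⬝ᵥ covMatrix μ *ᵥ w
  set l := t / (4 * c ^ 2)
  have hns : (n : ℝ) * (1 / n * s) = s := by field_simp
  have hnl : 0 < n * l := by positivity
  rcases hY' with h | h
  · left
    change n * (l * v) + n * l * t ≤ l * s
    nlinarith [mul_lt_mul_of_pos_left h hnl]
  · right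
    change n * (-l * v) + n * l * t ≤ -l * s
    nlinarith [mul_lt_mul_of_pos_left h hnl]

theorem dataLaw_specNorm_tail (hk : 0 < k) (hσ₀ : 0 < σ₀) (hμ : IsAdmissibleLaw k σ₀ μ)
    {n : ℕ} (hn : 0 < n) {t : ℝ} (ht0 : 0 < t)
    (ht : t ≤ 2 * (2 * Real.exp 1 * (σ₀ ^ 2 / k))) :
    dataLaw n μ {Y | 32 * t < specNorm (sampleCov Y - covMatrix μ)} ≤
      ENNReal.ofReal (2 * 5 ^ p *
        Real.exp (-(n * t ^ 2 / (8 * (2 * Real.exp 1 * (σ₀ ^ 2 / k)) ^ 2)))) := by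
  obtain ⟨T, hT, hT1, hT2⟩ := exists_specNorm_net p
  set e := Real.exp (-(n * t ^ 2 / (8 * (2 * Real.exp 1 * (σ₀ ^ 2 / k)) ^ 2)))
  have hsymm : (covMatrix μ)ᵀ = covMatrix μ :=
    PosDef.transpose_eq (hμ.eigenvalues.posDef hk)
  calc dataLaw n μ {Y | 32 * t < specNorm (sampleCov Y - covMatrix μ)}
      ≤ dataLaw n μ (⋃ y ∈ T, {Y | t < |y ⬝ᵥ (sampleCov Y - covMatrix μ) *ᵥ y|}) := by
        refine measure_mono fun Y hY => ?_
        by_contra hcon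
        simp only [Set.mem_iUnion, Set.mem_ofPred_eq, not_exists, not_lt] at hcon
        have hB : (sampleCov Y - covMatrix μ)ᵀ = sampleCov Y - covMatrix μ := by
          rw [transpose_sub, sampleCov_transpose, hsymm]
        exact absurd (hT2 _ hB t ht0.le hcon) (not_le.2 hY)
    _ ≤ ∑ y ∈ T, dataLaw n μ {Y | t < |y ⬝ᵥ (sampleCov Y - covMatrix μ) *ᵥ y|} :=
        measure_biUnion_finset_le _ _
    _ ≤ ∑ _y ∈ T, 2 * ENNReal.ofReal e :=
        Finset.sum_le_sum fun y hy => dataLaw_quadForm_tail hk hσ₀ hμ hn (hT1 y hy) ht0 ht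
    _ = T.card * (2 * ENNReal.ofReal e) := by rw [Finset.sum_const, nsmul_eq_mul]
    _ ≤ 5 ^ p * (2 * ENNReal.ofReal e) := by
        gcongr
        exact_mod_cast hT
    _ = _ := by
        rw [ENNReal.ofReal_mul (by positivity), ENNReal.ofReal_mul (by positivity),
          ENNReal.ofReal_pow (by positivity)]
        norm_num
        ring

end Concentration

/-! ### Quantitative bounds for the matrix-`F` prior -/

theorem IsMatrixFDensity.pos {p : ℕ} {ν νs : ℝ} {Ψ A : Mat p} {π : Mat p → ℝ}
    (hΨ : Ψ.PosDef) (hπ : IsMatrixFDensity ν νs Ψ π) (hA : A.PosDef) : 0 < π A := by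
  obtain ⟨c, hc, h⟩ := hπ
  rw [h A hA]
  exact mul_pos hc (matrixFKernel_pos hΨ hA)

theorem IsMatrixFDensity.abs_log_sub_le {p : ℕ} {ν νs : ℝ} (h1 : 0 ≤ ν + 2 * p)
    (h2 : 0 ≤ νs + ν + p - 1) {Ψ A G : Mat p} {π : Mat p → ℝ} (hΨ : Ψ.PosDef)
    (hπ : IsMatrixFDensity ν νs Ψ π) (hA : A.PosDef) (hG : G.PosDef) :
    |Real.log (π (G * A * G)) - Real.log (π (G * G))| ≤
      ((ν + 2 * p) + (νs + ν + p - 1)) / 2 * logSpread hA := by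
  obtain ⟨c, hc, h⟩ := hπ
  have hGG : (G * G).PosDef := by simpa using PosDef.conj_symm PosDef.one hG
  have hGA := PosDef.conj_symm hA hG
  rw [h _ hGA, h _ hGG, Real.log_mul hc.ne' (matrixFKernel_pos hΨ hGA).ne',
    Real.log_mul hc.ne' (matrixFKernel_pos hΨ hGG).ne', add_sub_add_left_eq_sub]
  exact abs_log_matrixFKernel_sub_le h1 h2 hΨ hA hG

theorem IsMatrixFDensity.logOscBound {p : ℕ} {ν νs : ℝ} (h1 : 0 ≤ ν + 2 * p)
    (h2 : 0 ≤ νs + ν + p - 1) {Ψ G : Mat p} {π : Mat p → ℝ} (hΨ : Ψ.PosDef)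
    (hπ : IsMatrixFDensity ν νs Ψ π) (hG : G.PosDef) {τ : ℝ} (hτ : 0 < τ) (hτ1 : τ ≤ 1 / 3) :
    LogOscBound π G ((ν + 2 * p) + (νs + ν + p - 1)) τ := fun A hA =>
  ⟨hπ.pos hΨ (PosDef.conj_symm hA hG), (hπ.abs_log_sub_le h1 h2 hΨ hA hG).trans
    (mul_le_mul_of_nonneg_left (logSpread_le hA hτ hτ1) (by linarith))⟩

theorem specNorm_inv_le {p : ℕ} {S : Mat p} (hS : S.PosDef) {a : ℝ} (ha : 0 < a)
    (h : ∀ w, a * (w ⬝ᵥ w) ≤ w ⬝ᵥ S *ᵥ w) : specNorm S⁻¹ ≤ 1 / a := by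
  have hd : ∀ i, a ≤ hS.isHermitian.eigenvalues i := by
    intro i
    rw [hS.isHermitian.eigenvalues_eq]
    have h1 := h (hS.isHermitian.eigenvectorBasis i).ofLp
    rw [← euclidean_norm_sq, hS.isHermitian.eigenvectorBasis.orthonormal.1 i] at h1
    simpa using h1
  obtain ⟨U, h1, h2, h3⟩ := hS.isHermitian.exists_orthogonal_conj
  rw [PosDef.inv_eq_conj_diagonal hS.eigenvalues_pos h1 h2 h3]
  have := specNorm_conj_le (U := Uᵀ) (by simpa using h2)
    (diagonal fun i => (hS.isHermitian.eigenvalues i)⁻¹)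
  rw [transpose_transpose, specNorm_diagonal] at this
  refine this.trans ((pi_norm_le_iff_of_nonneg (by positivity)).2 fun i => ?_)
  rw [Real.norm_of_nonneg (inv_nonneg.2 (ha.le.trans (hd i))), one_div]
  exact inv_anti₀ ha (hd i)

/-- Write `S + T / √n = G A G`. Then `A` is within `ε / a` and `A⁻¹` within `2 ε / a` of the
identity, so `logSpread` is at most `p * (4 ε / a)`. The final factor `2` comes from `|exp δ - 1| ≤
2 |δ|` for `|δ| ≤ 1`. -/
theorem oscillation_le {n p : ℕ} (hn : 0 < n) {ν νs : ℝ} (h1 : 0 ≤ ν + 2 * p)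
    (h2 : 0 ≤ νs + ν + p - 1) {Ψ : Mat p} {π : Mat p → ℝ} (hΨ : Ψ.PosDef)
    (hπ : IsMatrixFDensity ν νs Ψ π) {Y : Data n p} (hS : (sampleCov Y).PosDef) {a ε : ℝ}
    (ha : 0 < a) (hSa : ∀ w, a * (w ⬝ᵥ w) ≤ w ⬝ᵥ sampleCov Y *ᵥ w) (hε : 2 * ε / a ≤ 1 / 2)
    (hsmall : ((ν + 2 * p) + (νs + ν + p - 1)) * p * (2 * ε / a) ≤ 1) :
    oscillation π Y ε ≤
      ENNReal.ofReal (2 * (((ν + 2 * p) + (νs + ν + p - 1)) * p * (2 * ε / a))) := by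
  refine iSup₂_le fun T hT => ENNReal.ofReal_le_ofReal ?_
  obtain ⟨hX, hTn⟩ := hT
  have hn0 : (0 : ℝ) < √(n : ℝ) := Real.sqrt_pos.2 (by exact_mod_cast hn)
  set X := sampleCov Y + (1 / √(n : ℝ)) • T with hXdef
  have hXS : specNorm (X - sampleCov Y) ≤ ε := by
    rw [hXdef, add_sub_cancel_left, specNorm_smul, abs_of_pos (by positivity), one_div,
      inv_mul_le_iff₀ hn0]
    exact hTn
  obtain ⟨G, hG, hGG⟩ := exists_posDef_sqrt hS
  have hGu := PosDef.isUnit_det hG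
  have hA : (G⁻¹ * X * G⁻¹).PosDef := PosDef.conj_symm hX hG.inv
  have hGAG : G * (G⁻¹ * X * G⁻¹) * G = X := by
    calc G * (G⁻¹ * X * G⁻¹) * G = (G * G⁻¹) * X * (G⁻¹ * G) := by simp only [mul_assoc]
      _ = X := by rw [nonsing_inv_mul _ hGu, mul_nonsing_inv _ hGu, one_mul, mul_one]
  have hA1 : specNorm (G⁻¹ * X * G⁻¹ - 1) ≤ ε / a := by
    have e1 : G⁻¹ * X * G⁻¹ - 1 = G⁻¹ * (X - sampleCov Y) * G⁻¹ := by
      have : G⁻¹ * (G * G) * G⁻¹ = 1 := by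
        rw [← mul_assoc, nonsing_inv_mul _ hGu, one_mul, mul_nonsing_inv _ hGu]
      rw [mul_sub, sub_mul, ← hGG, this]
    have e2 := specNorm_symm_conj_le (PosDef.transpose_eq hG.inv) (X - sampleCov Y)
    rw [← Matrix.mul_inv_rev, hGG] at e2
    rw [e1]
    refine e2.trans ((mul_le_mul (specNorm_inv_le hS ha hSa) hXS (specNorm_nonneg _)
      (by positivity)).trans_eq ?_)
    ring
  have hA2 : specNorm ((G⁻¹ * X * G⁻¹)⁻¹ - 1) ≤ 2 * ε / a := by
    have := specNorm_sub_one_le hA.inv (t := ε / a) (by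
      have := specNorm_nonneg (G⁻¹ * X * G⁻¹ - 1)
      rw [mul_div_assoc] at hε
      linarith) (by rwa [nonsing_inv_nonsing_inv _ (PosDef.isUnit_det hA)])
    rwa [mul_div_assoc]
  have hlog := hπ.abs_log_sub_le h1 h2 hΨ hA hG
  rw [hGAG, hGG] at hlog
  have hspread := logSpread_le_of_near_one hA hε hA2
  have hδ : |Real.log (π X) - Real.log (π (sampleCov Y))| ≤
      ((ν + 2 * p) + (νs + ν + p - 1)) * p * (2 * ε / a) := by
    refine hlog.trans ((mul_le_mul_of_nonneg_left hspread (by linarith)).trans_eq ?_)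
    ring
  have hexp : π X / π (sampleCov Y)
      = Real.exp (Real.log (π X) - Real.log (π (sampleCov Y))) := by
    rw [Real.exp_sub, Real.exp_log (hπ.pos hΨ hX), Real.exp_log (hπ.pos hΨ hS)]
  rw [hexp]
  exact (Real.abs_exp_sub_one_le (hδ.trans hsmall)).trans (by linarith)

theorem five_pow_le_exp (p : ℕ) : (5 : ℝ) ^ p ≤ Real.exp (2 * p) := by
  have h : (5 : ℝ) ≤ Real.exp 2 := by
    have := Real.quadratic_le_exp_of_nonneg (x := 2) (by norm_num)
    linarith
  rw [mul_comm, Real.exp_nat_mul]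
  exact pow_le_pow_left₀ (by norm_num) h p

theorem two_mul_five_pow_le_exp {p : ℕ} (hp : 0 < p) : 2 * (5 : ℝ) ^ p ≤ Real.exp (3 * p) := by
  have hp1 : (1 : ℝ) ≤ p := by exact_mod_cast hp
  have h2 : (2 : ℝ) ≤ Real.exp p := by
    have := Real.add_one_le_exp (p : ℝ)
    linarith
  calc 2 * (5 : ℝ) ^ p ≤ Real.exp p * Real.exp (2 * p) :=
        mul_le_mul h2 (five_pow_le_exp p) (by positivity) (Real.exp_pos _).le
    _ = _ := by rw [← Real.exp_add]; ring_nf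

/-- The radius `12 * r` gives a Gaussian exponent of `-9/2 p`, which beats `3 p` from the net
together with the bias of at most `p / 4`. -/
theorem two_mul_five_pow_mul_exp_le_half {p : ℕ} (hp : 0 < p) {n N r : ℝ} (hN : n / 2 ≤ N)
    (hr0 : 0 < r) (hr : 12 * r ≤ 1) (hnr : n * r ^ 2 = p) :
    2 * (5 : ℝ) ^ p * Real.exp (-(N * (12 * r) ^ 2 / 16) + (p + 1) * (12 * r) / 8) ≤ 1 / 2 := by
  have hp1 : (1 : ℝ) ≤ p := by exact_mod_cast hp
  have h1 : n / 2 * (12 * r) ^ 2 ≤ N * (12 * r) ^ 2 :=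
    mul_le_mul_of_nonneg_right hN (by positivity)
  have h2 : n / 2 * (12 * r) ^ 2 = 72 * p := by rw [← hnr]; ring
  have h3 : (p + 1) * (12 * r) ≤ 2 * p * 1 :=
    mul_le_mul (by linarith) hr (by positivity) (by positivity)
  calc 2 * (5 : ℝ) ^ p * Real.exp (-(N * (12 * r) ^ 2 / 16) + (p + 1) * (12 * r) / 8)
      ≤ Real.exp (3 * p) * Real.exp (-(17 / 4 * p)) :=
        mul_le_mul (two_mul_five_pow_le_exp hp) (Real.exp_le_exp.2 (by linarith))
          (Real.exp_pos _).le (Real.exp_pos _).le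
    _ = Real.exp (-(5 / 4 * p)) := by rw [← Real.exp_add]; ring_nf
    _ ≤ Real.exp (-1) := Real.exp_le_exp.2 (by linarith)
    _ ≤ 1 / 2 := by
        have := Real.exp_neg_one_lt_d9
        linarith

/-- The Gaussian exponent is `x² p / 2 ^ 21`. Half of it is at least `4 p` because `x² ≥ 2 ^ 24`,
and this absorbs the net and the bias. -/
theorem two_mul_five_pow_mul_exp_le {p : ℕ} (hp : 0 < p) {n N r x : ℝ} (hN : n / 2 ≤ N)
    (hnr : n * r ^ 2 = p) (hx0 : 0 ≤ x * r) (hx : x * r ≤ 4) (hx2 : 2 ^ 24 ≤ x ^ 2) :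
    2 * (5 : ℝ) ^ p * Real.exp (-(N * (x * r / 256) ^ 2 / 16) + (p + 1) * (x * r / 256) / 8) ≤
      Real.exp (-(x ^ 2 * p / 2 ^ 22)) := by
  have hp1 : (1 : ℝ) ≤ p := by exact_mod_cast hp
  have h1 : n / 2 * (x * r / 256) ^ 2 ≤ N * (x * r / 256) ^ 2 :=
    mul_le_mul_of_nonneg_right hN (by positivity)
  have h2 : n / 2 * (x * r / 256) ^ 2 = x ^ 2 * p / 2 ^ 17 := by rw [← hnr]; ring
  have h3 : (p + 1) * (x * r) ≤ 2 * p * 4 :=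
    mul_le_mul (by linarith) hx hx0 (by positivity)
  have h4 := mul_le_mul_of_nonneg_right hx2 (show (0 : ℝ) ≤ p by linarith)
  calc _ ≤ Real.exp (3 * p) * Real.exp (p - x ^ 2 * p / 2 ^ 21) :=
        mul_le_mul (two_mul_five_pow_le_exp hp) (Real.exp_le_exp.2 (by linarith))
          (Real.exp_pos _).le (Real.exp_pos _).le
    _ ≤ _ := by
        rw [← Real.exp_add]
        apply Real.exp_le_exp.2
        linarith

/-- Here `τ = 1 / (3 p²)`. The first term is bounded since `b = O(p)`; the second is of order `b p⁴
/ n`, and this is where contraction uses the full power `p⁵`. The constant is `884736 = 3 * 2 * (32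
* 12) ^ 2`. -/
theorem comparison_exponent_le {b B p n r : ℝ} (hp : 0 < p) (hn : 0 < n) (hB : 0 ≤ B)
    (hbB : b ≤ B * p) (hr : r ^ 2 = p / n) (hq : 884736 * p ^ 5 ≤ n) :
    b * p * (1 / (3 * p ^ 2)) + b / (1 / (3 * p ^ 2)) * (p * (2 * (32 * (12 * r)) ^ 2)) ≤
      2 * B := by
  have h1 : b * p * (1 / (3 * p ^ 2)) ≤ B := by
    rw [mul_one_div, div_le_iff₀ (by positivity)]
    nlinarith [mul_nonneg hB (sq_nonneg p)]
  have h2 : b / (1 / (3 * p ^ 2)) * (p * (2 * (32 * (12 * r)) ^ 2))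
      = 884736 * (b * p ^ 4) / n := by
    rw [mul_pow, mul_pow, hr]
    field_simp
    ring
  have h3 : 884736 * (b * p ^ 4) / n ≤ B := by
    rw [div_le_iff₀ hn]
    have : b * p ^ 4 ≤ B * p ^ 5 := by
      calc b * p ^ 4 ≤ B * p * p ^ 4 := by gcongr
        _ = _ := by ring
    have h4 := mul_le_mul_of_nonneg_left hq hB
    linarith
  linarith

theorem posteriorTail_le_exp {n p : ℕ} (hn : 0 < n) (hp : 0 < p) {Y : Data n p} {π : Mat p → ℝ}
    {G A₀ : Mat p} {b B : ℝ} (hb : 0 ≤ b) (hbB : b ≤ B * p) (hG : G.PosDef)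
    (hS : G * G = sampleCov Y) (hosc : LogOscBound π G b (1 / (3 * (p : ℝ) ^ 2)))
    (hq1 : 884736 * (p : ℝ) ^ 5 ≤ n) (hq2 : 6 * B * (p : ℝ) ^ 5 ≤ n)
    {k M : ℝ} (hk : 0 < k) (hM : 0 < M) (hkM : 2 ^ 24 ≤ (k * M) ^ 2)
    (hkε : k * M * √((p : ℝ) / n) ≤ 4) (hSn : specNorm (sampleCov Y) ≤ 2 / k)
    (hS0 : specNorm (sampleCov Y - A₀) ≤ M * √((p : ℝ) / n) / 2) :
    IsProbabilityMeasure (posterior π Y) ∧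
      posteriorTail π Y A₀ (M * √((p : ℝ) / n)) ≤
        ENNReal.ofReal (2 * Real.exp (2 * B) * Real.exp (-((k * M) ^ 2 * p / 2 ^ 22))) := by
  have hp1 : (1 : ℝ) ≤ p := by exact_mod_cast hp
  have hn0 : (0 : ℝ) < n := by exact_mod_cast hn
  have hp0 : (0 : ℝ) < p := by linarith
  have hB : 0 ≤ B := nonneg_of_mul_nonneg_left (hb.trans hbB) hp0
  have hp15 : (p : ℝ) ≤ (p : ℝ) ^ 5 := le_self_pow₀ hp1 (by norm_num)
  have hp25 : (p : ℝ) ^ 2 ≤ (p : ℝ) ^ 5 := pow_le_pow_right₀ hp1 (by norm_num)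
  have hp35 : (p : ℝ) ^ 3 ≤ (p : ℝ) ^ 5 := pow_le_pow_right₀ hp1 (by norm_num)
  have hr0 : 0 < √((p : ℝ) / n) := Real.sqrt_pos.2 (by positivity)
  have hr2 : √((p : ℝ) / n) ^ 2 = p / n := Real.sq_sqrt (by positivity)
  generalize √((p : ℝ) / n) = r at *
  have hnr : n * r ^ 2 = p := by rw [hr2]; field_simp
  -- This is `32 * (12 * r) ≤ 1 / 2`, the size condition on the neighbourhood of the identity.
  have hr768 : 768 * r ≤ 1 := by
    have : (768 * r) ^ 2 ≤ 1 := by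
      rw [mul_pow, hr2, ← mul_div_assoc, div_le_one hn0]
      linarith
    nlinarith
  have hexpo := comparison_exponent_le hp0 hn0 hB hbB hr2 hq1
  have hbτ : b / (1 / (3 * (p : ℝ) ^ 2)) = 3 * (b * (p : ℝ) ^ 2) := by field_simp
  have hbp : b * (p : ℝ) ^ 2 ≤ B * (p : ℝ) ^ 5 :=
    calc b * (p : ℝ) ^ 2 ≤ B * p * (p : ℝ) ^ 2 := by gcongr
      _ = B * (p : ℝ) ^ 3 := by ring
      _ ≤ _ := by gcongr
  have hN : (n : ℝ) / 2 ≤ n - b / (1 / (3 * (p : ℝ) ^ 2)) := by rw [hbτ]; linarith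
  have hτ : 0 < 1 / (3 * (p : ℝ) ^ 2) := by positivity
  generalize 1 / (3 * (p : ℝ) ^ 2) = τ at *
  have hkMr : 0 ≤ k * M * r := by positivity
  have hmain := posteriorTail_le hb hτ hG hS hosc
    (t₁ := 12 * r) (by positivity) (by linarith)
    (steinMeasure_univ_lt_top hp (by linarith)) (by linarith)
    (two_mul_five_pow_mul_exp_le_half hp hN hr0 (by linarith) hnr)
    hk (hS.symm ▸ hSn) (hS.symm ▸ hS0) (mul_pos hM hr0) (by linarith)
  refine ⟨hmain.1, hmain.2.trans (ENNReal.ofReal_le_ofReal ?_)⟩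
  have e2 := two_mul_five_pow_mul_exp_le hp hN hnr hkMr hkε hkM
  rw [← mul_assoc k M r]
  exact mul_le_mul (mul_le_mul_of_nonneg_left (Real.exp_le_exp.2 hexpo) (by norm_num)) e2
    (by positivity) (by positivity)

theorem dataLaw_specNorm_tail_le_exp {n p : ℕ} (hn : 0 < n) (hp : 0 < p) {k σ₀ : ℝ}
    {μ : Measure (EuclideanSpace ℝ (Fin p))} (hk : 0 < k) (hσ₀ : 0 < σ₀)
    (hμ : IsAdmissibleLaw k σ₀ μ) {M : ℝ} (hM : 0 < M)
    (hM1 : 196608 * (2 * Real.exp 1 * (σ₀ ^ 2 / k)) ^ 2 ≤ M ^ 2)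
    (hM2 : M * √((p : ℝ) / n) ≤ 128 * (2 * Real.exp 1 * (σ₀ ^ 2 / k))) :
    dataLaw n μ {Y | specNorm (sampleCov Y - covMatrix μ) ≤ M * √((p : ℝ) / n) / 2}ᶜ ≤
      ENNReal.ofReal
        (Real.exp (-(1 / (65536 * (2 * Real.exp 1 * (σ₀ ^ 2 / k)) ^ 2) * (M ^ 2 * p)))) := by
  set c := 2 * Real.exp 1 * (σ₀ ^ 2 / k) with hc
  have hc0 : 0 < c := by positivity
  have hn0 : (0 : ℝ) < n := by exact_mod_cast hn
  have hp0 : (0 : ℝ) < p := by exact_mod_cast hp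
  set r := √((p : ℝ) / n) with hr
  have hr0 : 0 < r := Real.sqrt_pos.2 (by positivity)
  have hr2 : r ^ 2 = p / n := Real.sq_sqrt (by positivity)
  have hnr : n * r ^ 2 = p := by rw [hr2]; field_simp
  have h := dataLaw_specNorm_tail hk hσ₀ hμ hn (t := M * r / 64) (by positivity)
    (by rw [← hc]; linarith)
  rw [← hc] at h
  have hset : {Y : Data n p | specNorm (sampleCov Y - covMatrix μ) ≤ M * r / 2}ᶜ
      = {Y | 32 * (M * r / 64) < specNorm (sampleCov Y - covMatrix μ)} := by
    ext Y
    rw [Set.mem_compl_iff, Set.mem_ofPred_eq, Set.mem_ofPred_eq, not_le]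
    rw [show 32 * (M * r / 64) = M * r / 2 by ring]
  rw [hset]
  refine h.trans (ENNReal.ofReal_le_ofReal ?_)
  -- Half of this exponent absorbs the factor `2 * 5 ^ p ≤ exp (3 p)`; the constant `196608 = 3 *
  -- 65536` is chosen for that.
  have e1 : n * (M * r / 64) ^ 2 / (8 * c ^ 2) = 2 * (1 / (65536 * c ^ 2) * (M ^ 2 * p)) := by
    rw [← hnr]; field_simp; norm_num
  have e2 : 3 * (p : ℝ) ≤ 1 / (65536 * c ^ 2) * (M ^ 2 * p) := by
    rw [one_div_mul_eq_div, le_div_iff₀ (by positivity)]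
    nlinarith [mul_le_mul_of_nonneg_right hM1 hp0.le]
  rw [e1]
  calc _ ≤ Real.exp (3 * p) * Real.exp (-(2 * (1 / (65536 * c ^ 2) * (M ^ 2 * p)))) := by
        gcongr
        exact two_mul_five_pow_le_exp hp
    _ ≤ _ := by
        rw [← Real.exp_add]
        apply Real.exp_le_exp.2
        linarith

/-! ### Asymptotics -/

theorem tendstoZeroInProb_of_event {Ω : ℕ → Type*} [∀ n, MeasurableSpace (Ω n)]
    {P : ∀ n, Measure (Ω n)} {E : ∀ n, Set (Ω n)} {f : ∀ n, Ω n → ℝ≥0∞} {g : ℕ → ℝ≥0∞}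
    (hE : Tendsto (fun n => P n (E n)ᶜ) atTop (𝓝 0))
    (hfg : ∀ᶠ n in atTop, ∀ ω ∈ E n, f n ω ≤ g n) (hg : Tendsto g atTop (𝓝 0)) :
    TendstoZeroInProb P f := by
  intro δ hδ
  refine tendsto_of_tendsto_of_tendsto_of_le_of_le' tendsto_const_nhds hE
    (Eventually.of_forall fun n => bot_le) ?_
  filter_upwards [hfg, hg.eventually_lt_const hδ] with n h1 h2
  refine measure_mono fun ω hω hωE => ?_
  exact absurd (hω.trans (h1 ω hωE)) (not_le.2 h2)

theorem posteriorTail_anti {n p : ℕ} (π : Mat p → ℝ) (Y : Data n p) (A₀ : Mat p) {ε ε' : ℝ}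
    (h : ε ≤ ε') : posteriorTail π Y A₀ ε' ≤ posteriorTail π Y A₀ ε :=
  measure_mono fun _ hx => h.trans_lt hx

theorem sampleCov_bounds_of_close {n p : ℕ} {k σ₀ : ℝ} (hk : 0 < k) (hk1 : k ≤ 1)
    {μ : Measure (EuclideanSpace ℝ (Fin p))} (hμ : IsAdmissibleLaw k σ₀ μ) {Y : Data n p}
    (h : specNorm (sampleCov Y - covMatrix μ) ≤ k / 2) :
    (sampleCov Y).PosDef ∧ (∀ w, k / 2 * (w ⬝ᵥ w) ≤ w ⬝ᵥ sampleCov Y *ᵥ w) ∧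
      specNorm (sampleCov Y) ≤ 2 / k := by
  have hquad := fun w => (hμ.eigenvalues.quadForm w).1
  refine ⟨posDef_of_specNorm_sub_lt ?_ hquad (h.trans_lt (by linarith)), fun w => ?_, ?_⟩
  · rw [IsHermitian, conjTranspose_eq_transpose_of_trivial, sampleCov_transpose]
  · have h1 := (abs_le.1 (abs_dotProduct_mulVec_le (sampleCov Y - covMatrix μ) w)).1
    rw [sub_mulVec, dotProduct_sub] at h1
    have h2 : 0 ≤ w ⬝ᵥ w := by simpa using dotProduct_star_self_nonneg w
    nlinarith [hquad w]
  · have h1 := specNorm_add_le (sampleCov Y - covMatrix μ) (covMatrix μ)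
    rw [sub_add_cancel] at h1
    have h2 := hμ.eigenvalues.specNorm_le hk
    have h3 : k / 2 ≤ 1 / k := by rw [div_le_div_iff₀ (by norm_num) hk]; nlinarith
    have h4 : 2 / k = 1 / k + 1 / k := by ring
    linarith

section Sequences

variable {p : ℕ → ℕ} (hp : ∀ n, 0 < p n)
  (hp5 : Tendsto (fun n => (p n : ℝ) ^ 5 / (n : ℝ)) atTop (𝓝 0))

include hp5 in
theorem eventually_const_mul_pow_le (c : ℝ) : ∀ᶠ n : ℕ in atTop, c * (p n : ℝ) ^ 5 ≤ n := by
  have h := (hp5.const_mul c).eventually_lt_const (u := 1) (by simp)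
  filter_upwards [h, eventually_gt_atTop 0] with n h1 h2
  have hn : (0 : ℝ) < n := by exact_mod_cast h2
  rw [← mul_div_assoc, div_lt_one hn] at h1
  exact h1.le

include hp hp5 in
theorem tendsto_sqrt_ratio : Tendsto (fun n => √((p n : ℝ) / n)) atTop (𝓝 0) := by
  have h : Tendsto (fun n => (p n : ℝ) / (n : ℝ)) atTop (𝓝 0) := by
    refine squeeze_zero (fun n => by positivity) (fun n => ?_) hp5
    have : (1 : ℝ) ≤ p n := by exact_mod_cast hp n
    gcongr
    exact le_self_pow₀ this (by norm_num)
  have := (Real.continuous_sqrt.tendsto 0).comp h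
  rwa [Real.sqrt_zero] at this

/-- A multiplier `M n` tending to infinity so slowly that `M n * √(p n / n)` tends to zero. -/
noncomputable def slowRate (p : ℕ → ℕ) (n : ℕ) : ℝ := (√(√((p n : ℝ) / n)))⁻¹

include hp hp5 in
theorem tendsto_slowRate : Tendsto (slowRate p) atTop atTop := by
  have h1 := (Real.continuous_sqrt.tendsto 0).comp (tendsto_sqrt_ratio hp hp5)
  rw [Real.sqrt_zero] at h1
  refine tendsto_inv_nhdsGT_zero.comp (tendsto_nhdsWithin_iff.2 ⟨h1, ?_⟩)
  filter_upwards [eventually_gt_atTop 0] with n hn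
  have hn0 : (0 : ℝ) < n := by exact_mod_cast hn
  have hp0 : (0 : ℝ) < p n := by exact_mod_cast hp n
  exact Real.sqrt_pos.2 (Real.sqrt_pos.2 (by positivity))

include hp hp5 in
theorem tendsto_slowRate_mul :
    Tendsto (fun n => slowRate p n * √((p n : ℝ) / n)) atTop (𝓝 0) := by
  have h1 := (Real.continuous_sqrt.tendsto 0).comp (tendsto_sqrt_ratio hp hp5)
  rw [Real.sqrt_zero] at h1
  refine h1.congr fun n => ?_
  simp only [Function.comp_apply, slowRate]
  set x := √((p n : ℝ) / n)
  rcases (Real.sqrt_nonneg x).eq_or_lt with h | h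
  · rw [← h]; simp
  · rw [eq_comm, inv_mul_eq_iff_eq_mul₀ h.ne', Real.mul_self_sqrt (Real.sqrt_nonneg _)]

include hp in
theorem tendsto_sq_mul_of_tendsto {M : ℕ → ℝ} (hM : Tendsto M atTop atTop) :
    Tendsto (fun n => M n ^ 2 * (p n : ℝ)) atTop atTop := by
  refine tendsto_atTop_mono' _ ?_ hM
  filter_upwards [hM.eventually_ge_atTop 1] with n hn
  have : (1 : ℝ) ≤ p n := by exact_mod_cast hp n
  nlinarith [mul_le_mul_of_nonneg_left this (sq_nonneg (M n))]

/-- The least multiplier for which the concentration and contraction bounds apply. -/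
noncomputable def minRate (k σ₀ : ℝ) : ℝ :=
  max (4096 / k) (444 * (2 * Real.exp 1 * (σ₀ ^ 2 / k)))

theorem minRate_pos {k : ℝ} (hk : 0 < k) (σ₀ : ℝ) : 0 < minRate k σ₀ :=
  lt_max_of_lt_left (by positivity)

variable {k σ₀ : ℝ} (hk : 0 < k) (hk1 : k ≤ 1) (hσ₀ : 0 < σ₀)
  {μ : ∀ n, Measure (EuclideanSpace ℝ (Fin (p n)))} (hμ : ∀ n, IsAdmissibleLaw k σ₀ (μ n))

/-- The event that the sample covariance matrix is within `M n * √(p n / n) / 2` of the true one. -/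
def closeEvent (μ : ∀ n, Measure (EuclideanSpace ℝ (Fin (p n)))) (M : ℕ → ℝ) (n : ℕ) :
    Set (Data n (p n)) :=
  {Y | specNorm (sampleCov Y - covMatrix (μ n)) ≤ M n * √((p n : ℝ) / n) / 2}

include hp hk hσ₀ hμ in
theorem tendsto_closeEvent_compl {M : ℕ → ℝ} (hM0 : ∀ᶠ n in atTop, minRate k σ₀ ≤ M n)
    (hMr : Tendsto (fun n => M n * √((p n : ℝ) / n)) atTop (𝓝 0))
    (hMp : Tendsto (fun n => M n ^ 2 * (p n : ℝ)) atTop atTop) :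
    Tendsto (fun n => dataLaw n (μ n) (closeEvent μ M n)ᶜ) atTop (𝓝 0) := by
  set c := 2 * Real.exp 1 * (σ₀ ^ 2 / k) with hc
  have hc0 : 0 < c := by positivity
  have hlim : Tendsto (fun n => ENNReal.ofReal
      (Real.exp (-(1 / (65536 * c ^ 2) * (M n ^ 2 * p n))))) atTop (𝓝 0) := by
    have h1 := Real.tendsto_exp_neg_atTop_nhds_zero.comp
      (hMp.const_mul_atTop (show 0 < 1 / (65536 * c ^ 2) by positivity))
    have := (ENNReal.continuous_ofReal.tendsto 0).comp h1
    rwa [ENNReal.ofReal_zero] at this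
  refine tendsto_of_tendsto_of_tendsto_of_le_of_le' tendsto_const_nhds hlim
    (Eventually.of_forall fun n => bot_le) ?_
  filter_upwards [hM0, hMr.eventually_lt_const (u := 128 * c) (by positivity),
    eventually_gt_atTop 0] with n h1 h2 h3
  have h4 : 444 * c ≤ M n := (le_max_right _ _).trans h1
  refine dataLaw_specNorm_tail_le_exp h3 (hp n) hk hσ₀ (hμ n)
    ((minRate_pos hk σ₀).trans_le h1) ?_ h2.le
  rw [← hc]
  -- The `444` in `minRate` satisfies `444 ^ 2 = 197136 ≥ 196608`.
  nlinarith [mul_self_le_mul_self (by positivity) h4]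

/-! ### Contraction and flatness of the matrix-`F` posterior along the sequence. -/

variable {ν : ℝ} (hν : 0 < ν) {νs : ℕ → ℝ} (hνs : ∀ n, 0 < νs n)
  (hνsO : νs =O[atTop] (fun n => (p n : ℝ))) {Ψ : ∀ n, Mat (p n)} (hΨ : ∀ n, (Ψ n).PosDef)
  {π : ∀ n, Mat (p n) → ℝ} (hπ : ∀ n, IsMatrixFDensity ν (νs n) (Ψ n) (π n))

include hp hν hνsO in
theorem exists_prior_exponent_bound : ∃ B : ℝ, 0 < B ∧
    ∀ᶠ n in atTop, (ν + 2 * p n) + (νs n + ν + p n - 1) ≤ B * p n := by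
  obtain ⟨C, hC, h⟩ := hνsO.exists_pos
  refine ⟨2 * ν + 3 + C, by positivity, ?_⟩
  filter_upwards [h.bound] with n hn
  have hp1 : (1 : ℝ) ≤ p n := by exact_mod_cast hp n
  rw [Real.norm_of_nonneg (show (0 : ℝ) ≤ p n by linarith)] at hn
  have := (le_abs_self _).trans hn
  nlinarith

include hp hp5 hk hk1 hμ hν hνs hνsO hΨ hπ in
-- On `closeEvent` the statement is deterministic. The constant `B` is chosen before `M`, so the
-- same bound serves constant and diverging multipliers.
theorem exists_posterior_bound : ∃ B : ℝ, ∀ M : ℕ → ℝ, (∀ᶠ n in atTop, minRate k σ₀ ≤ M n) →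
    Tendsto (fun n => M n * √((p n : ℝ) / n)) atTop (𝓝 0) →
    ∀ᶠ n in atTop, ∀ Y ∈ closeEvent μ M n, (sampleCov Y).PosDef ∧
      IsProbabilityMeasure (posterior (π n) Y) ∧
      posteriorTail (π n) Y (covMatrix (μ n)) (M n * √((p n : ℝ) / n)) ≤
        ENNReal.ofReal (2 * Real.exp (2 * B) * Real.exp (-((k * M n) ^ 2 * p n / 2 ^ 22))) := by
  obtain ⟨B, hB, hbB⟩ := exists_prior_exponent_bound hp hν hνsO
  refine ⟨B, fun M hM0 hMr => ?_⟩
  filter_upwards [hbB, hM0, hMr.eventually_lt_const hk, eventually_gt_atTop 0,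
    eventually_const_mul_pow_le hp5 884736, eventually_const_mul_pow_le hp5 (6 * B)]
    with n h1 h2 h3 hn h4 h5 Y hY
  have hY' : specNorm (sampleCov Y - covMatrix (μ n)) ≤ M n * √((p n : ℝ) / n) / 2 := hY
  obtain ⟨hS, -, hSn⟩ := sampleCov_bounds_of_close hk hk1 (hμ n) (hY'.trans (by linarith))
  obtain ⟨G, hG, hGG⟩ := exists_posDef_sqrt hS
  have hp1 : (1 : ℝ) ≤ p n := by exact_mod_cast hp n
  have hνn := hνs n
  have hMpos := (minRate_pos hk σ₀).trans_le h2
  -- Squaring gives `(k * M n) ^ 2 ≥ 2 ^ 24`.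
  have h6 : 4096 ≤ k * M n := by
    have := (le_max_left _ _).trans h2
    rwa [div_le_iff₀' hk] at this
  have hMr0 : 0 ≤ M n * √((p n : ℝ) / n) := by positivity
  refine ⟨hS, posteriorTail_le_exp hn (hp n) (by linarith) h1 hG hGG
    ((hπ n).logOscBound (by linarith) (by linarith) (hΨ n) hG (by positivity) ?_) h4 h5 hk hMpos
    (by nlinarith) (by nlinarith) hSn hY'⟩
  rw [div_le_div_iff₀ (by positivity) (by norm_num)]
  nlinarith

include hp hp5 hk hk1 hσ₀ hμ hν hνs hνsO hΨ hπ in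
theorem posteriorContracts_of_rate {M : ℕ → ℝ} (hM0 : ∀ᶠ n in atTop, minRate k σ₀ ≤ M n)
    (hMr : Tendsto (fun n => M n * √((p n : ℝ) / n)) atTop (𝓝 0))
    (hMp : Tendsto (fun n => M n ^ 2 * (p n : ℝ)) atTop atTop) :
    PosteriorContracts μ π (fun n => M n * √((p n : ℝ) / n)) := by
  obtain ⟨B, hB⟩ := exists_posterior_bound hp hp5 hk hk1 hμ hν hνs hνsO hΨ hπ
  refine tendstoZeroInProb_of_event (tendsto_closeEvent_compl hp hk hσ₀ hμ hM0 hMr hMp)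
    ((hB M hM0 hMr).mono fun n h Y hY => (h Y hY).2.2) ?_
  have h1 := (Real.tendsto_exp_neg_atTop_nhds_zero.comp
    (hMp.const_mul_atTop (show 0 < k ^ 2 / 2 ^ 22 by positivity))).const_mul (2 * Real.exp (2 * B))
  rw [mul_zero] at h1
  have h2 := (ENNReal.continuous_ofReal.tendsto 0).comp h1
  rw [ENNReal.ofReal_zero] at h2
  refine h2.congr fun n => ?_
  simp only [Function.comp_apply]
  congr 4
  ring

include hp hp5 hk hk1 hσ₀ hμ hν hνs hνsO hΨ hπ in
-- The bounds require the radius to tend to zero, so `M` is first capped by `slowRate`. A smaller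
-- radius only enlarges the tail probability.
theorem posteriorContracts_of_tendsto_atTop {M : ℕ → ℝ} (hM : Tendsto M atTop atTop) :
    PosteriorContracts μ π (fun n => M n * √((p n : ℝ) / n)) := by
  have hmin : Tendsto (fun n => min (M n) (slowRate p n)) atTop atTop :=
    tendsto_atTop.2 fun b => (hM.eventually_ge_atTop b).mp
      (((tendsto_slowRate hp hp5).eventually_ge_atTop b).mono fun _ h1 h2 => le_min h2 h1)
  have hr : Tendsto (fun n => min (M n) (slowRate p n) * √((p n : ℝ) / n)) atTop (𝓝 0) := by
    refine tendsto_of_tendsto_of_tendsto_of_le_of_le' tendsto_const_nhds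
      (tendsto_slowRate_mul hp hp5) ?_ (Eventually.of_forall fun n => ?_)
    · filter_upwards [hmin.eventually_ge_atTop 0] with n hn
      positivity
    · exact mul_le_mul_of_nonneg_right (min_le_right _ _) (Real.sqrt_nonneg _)
  have h := posteriorContracts_of_rate hp hp5 hk hk1 hσ₀ hμ hν hνs hνsO hΨ hπ
    (hmin.eventually_ge_atTop _) hr (tendsto_sq_mul_of_tendsto hp hmin)
  intro δ hδ
  refine tendsto_of_tendsto_of_tendsto_of_le_of_le tendsto_const_nhds (h δ hδ)
    (fun n => bot_le) fun n => measure_mono fun Y hY => ?_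
  exact le_trans (b := posteriorTail (π n) Y (covMatrix (μ n)) (M n * √((p n : ℝ) / n))) hY
    (posteriorTail_anti _ _ _ (mul_le_mul_of_nonneg_right (min_le_left _ _) (Real.sqrt_nonneg _)))

include hp hp5 hk hσ₀ hμ in
-- A constant multiplier would leave an error bound `exp (-c p)`, which does not vanish when `p`
-- stays bounded. A slowly diverging one works in every case.
theorem tendsto_closeEvent_slowRate_compl :
    Tendsto (fun n => dataLaw n (μ n) (closeEvent μ (slowRate p) n)ᶜ) atTop (𝓝 0) :=
  tendsto_closeEvent_compl hp hk hσ₀ hμ ((tendsto_slowRate hp hp5).eventually_ge_atTop _)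
    (tendsto_slowRate_mul hp hp5) (tendsto_sq_mul_of_tendsto hp (tendsto_slowRate hp hp5))

include hp hp5 hk hk1 hσ₀ hμ hν hνs hνsO hΨ hπ in
theorem withProbTendingToOne_posterior :
    WithProbTendingToOne (fun n => dataLaw n (μ n))
      (fun n => {Y | (sampleCov Y).PosDef ∧ IsProbabilityMeasure (posterior (π n) Y)}) := by
  obtain ⟨B, hB⟩ := exists_posterior_bound hp hp5 hk hk1 hμ hν hνs hνsO hΨ hπ
  refine tendsto_of_tendsto_of_tendsto_of_le_of_le' tendsto_const_nhds
    (tendsto_closeEvent_slowRate_compl hp hp5 hk hσ₀ hμ) (Eventually.of_forall fun n => bot_le) ?_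
  filter_upwards [hB _ ((tendsto_slowRate hp hp5).eventually_ge_atTop _)
    (tendsto_slowRate_mul hp hp5)] with n hn
  exact measure_mono (Set.compl_subset_compl.2 fun Y hY => ⟨(hn Y hY).1, (hn Y hY).2.1⟩)

include hp hp5 hk hk1 hσ₀ hμ hν hνs hνsO hΨ hπ in
theorem isFlat_of_isMatrixFDensity {M : ℝ} (hM : 0 < M) :
    IsFlat μ π (fun n => M * √((p n : ℝ) / n)) := by
  obtain ⟨B, hB, hbB⟩ := exists_prior_exponent_bound hp hν hνsO
  have hlim : Tendsto (fun n => B * (4 * M / k) * √((p n : ℝ) ^ 5 / n)) atTop (𝓝 0) := by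
    have := ((Real.continuous_sqrt.tendsto 0).comp hp5).const_mul (B * (4 * M / k))
    rwa [Real.sqrt_zero, mul_zero] at this
  have hlim2 : Tendsto (fun n => 2 * (M * √((p n : ℝ) / n)) / (k / 2)) atTop (𝓝 0) := by
    have := (tendsto_sqrt_ratio hp hp5).const_mul (2 * M / (k / 2))
    rw [mul_zero] at this
    exact this.congr fun n => by ring
  have hg : Tendsto (fun n => ENNReal.ofReal (2 * (B * (4 * M / k) * √((p n : ℝ) ^ 5 / n))))
      atTop (𝓝 0) := by
    have := (ENNReal.continuous_ofReal.tendsto _).comp (hlim.const_mul 2)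
    rwa [mul_zero, ENNReal.ofReal_zero] at this
  refine tendstoZeroInProb_of_event (tendsto_closeEvent_slowRate_compl hp hp5 hk hσ₀ hμ) ?_ hg
  filter_upwards [hbB, (tendsto_slowRate_mul hp hp5).eventually_lt_const hk,
    hlim.eventually_lt_const one_pos, hlim2.eventually_lt_const one_half_pos,
    eventually_gt_atTop 0] with n h1 h2 h3 h4 hn Y hY
  have hY' : specNorm (sampleCov Y - covMatrix (μ n)) ≤ slowRate p n * √((p n : ℝ) / n) / 2 := hY
  obtain ⟨hS, hSq, -⟩ := sampleCov_bounds_of_close hk hk1 (hμ n) (hY'.trans (by linarith))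
  have hp1 : (1 : ℝ) ≤ p n := by exact_mod_cast hp n
  have hνn := hνs n
  -- The oscillation has order `p * p * √(p / n) = √(p⁵ / n)`.
  have hle : ((ν + 2 * p n) + (νs n + ν + p n - 1)) * p n *
      (2 * (M * √((p n : ℝ) / n)) / (k / 2)) ≤ B * (4 * M / k) * √((p n : ℝ) ^ 5 / n) := by
    have e1 : √((p n : ℝ) ^ 5 / n) = (p n : ℝ) ^ 2 * √((p n : ℝ) / n) := by
      rw [show (p n : ℝ) ^ 5 / n = ((p n : ℝ) ^ 2) ^ 2 * (p n / n) by ring,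
        Real.sqrt_mul (by positivity), Real.sqrt_sq (by positivity)]
    have e2 : B * (4 * M / k) * ((p n : ℝ) ^ 2 * √((p n : ℝ) / n))
        = B * p n * p n * (2 * (M * √((p n : ℝ) / n)) / (k / 2)) := by
      field_simp
      ring
    rw [e1, e2]
    gcongr
  refine (oscillation_le hn (by linarith) (by linarith) (hΨ n) (hπ n) hS (half_pos hk) hSq h4.le
    (hle.trans h3.le)).trans (ENNReal.ofReal_le_ofReal (by linarith))

end Sequences

end HighDimCov

theorem mainTheorem11
    (k σ₀ : ℝ) (hk : 0 < k) (hk1 : k ≤ 1) (hσ₀ : 0 < σ₀)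
    (p : ℕ → ℕ) (hp : ∀ n, 0 < p n)
    (hp5 : Tendsto (fun n => (p n : ℝ) ^ 5 / (n : ℝ)) atTop (𝓝 0))
    (μ : ∀ n, Measure (EuclideanSpace ℝ (Fin (p n))))
    (hμ : ∀ n, HighDimCov.IsAdmissibleLaw k σ₀ (μ n))
    (ν : ℝ) (hν : 0 < ν)
    (νs : ℕ → ℝ) (hνs : ∀ n, 0 < νs n) (hνsO : νs =O[atTop] (fun n => (p n : ℝ)))
    (Ψ : ∀ n, HighDimCov.Mat (p n)) (hΨ : ∀ n, (Ψ n).PosDef)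
    (π : ∀ n, HighDimCov.Mat (p n) → ℝ)
    (hπ : ∀ n, HighDimCov.IsMatrixFDensity ν (νs n) (Ψ n) (π n)) :
    -- the sample covariance matrix is invertible and the posterior is a genuine distribution
    HighDimCov.WithProbTendingToOne (fun n => HighDimCov.dataLaw n (μ n))
      (fun n => {Y | (HighDimCov.sampleCov Y).PosDef ∧
        IsProbabilityMeasure (HighDimCov.posterior (π n) Y)}) ∧
    -- flatness around the sample covariance matrix
    (∀ M : ℝ, 0 < M →
      HighDimCov.IsFlat μ π (fun n => M * √((p n : ℝ) / (n : ℝ)))) ∧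
    -- posterior contraction rate
    (∀ M : ℕ → ℝ, Tendsto M atTop atTop →
      HighDimCov.PosteriorContracts μ π (fun n => M n * √((p n : ℝ) / (n : ℝ)))) ∧
    (Tendsto p atTop atTop →
      ∃ M₀ : ℝ, 0 < M₀ ∧ ∀ M : ℝ, M₀ ≤ M →
        HighDimCov.PosteriorContracts μ π (fun n => M * √((p n : ℝ) / (n : ℝ)))) := by
  refine ⟨HighDimCov.withProbTendingToOne_posterior hp hp5 hk hk1 hσ₀ hμ hν hνs hνsO hΨ hπ,
    fun M hM => HighDimCov.isFlat_of_isMatrixFDensity hp hp5 hk hk1 hσ₀ hμ hν hνs hνsO hΨ hπ hM,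
    fun M hM =>
      HighDimCov.posteriorContracts_of_tendsto_atTop hp hp5 hk hk1 hσ₀ hμ hν hνs hνsO hΨ hπ hM,
    fun hpt => ⟨HighDimCov.minRate k σ₀, HighDimCov.minRate_pos hk σ₀, fun M hM =>
      HighDimCov.posteriorContracts_of_rate hp hp5 hk hk1 hσ₀ hμ hν hνs hνsO hΨ hπ
        (Eventually.of_forall fun _ => hM) ?_ ?_⟩⟩
  · have := (HighDimCov.tendsto_sqrt_ratio hp hp5).const_mul M
    rwa [mul_zero] at this
  -- For a constant multiplier, `M² p → ∞` has to come from `p → ∞`.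
  · have hM0 : 0 < M := (HighDimCov.minRate_pos hk σ₀).trans_le hM
    exact (tendsto_natCast_atTop_atTop.comp hpt).const_mul_atTop (by positivity)
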